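/- **Setting.** Let $H=L^2(0,1)$ with norm $|\cdot|$, and let $A$ be the Laplacian on $(0,1)$ with homogeneous Dirichlet boundary conditions, with $Ae_p=-\lambda_pe_p$, $\lambda_p=(\pi p)^2$, $e_p=\sqrt2\sin(p\pi\cdot)$, $p\ge 1$. Write $e^{tA}u=\sum_p e^{-\lambda_pt}\langle u,e_p\rangle e_p$ and, for $r\in\mathbb R$, $|u|_r^2=\sum_p\lambda_p^{2r}\langle u,e_p\rangle^2\in[0,\infty]$; for $r\ge0$, $D((-A)^r)=\{u\in H:|u|_r<\infty\}$. *Assumption 1 (on $F$).* $F:H\to H$ is globally Lipschitz continuous and twice Fréchet differentiable, with bounded first and second order derivatives. Moreover, for all $\alpha\in(0,\frac12)$ and $\kappa\in(0,\frac12-\alpha)$ there is $C\in(0,\infty)$ such that - $|DF(u).h|_{-\alpha}\le C(1+|u|_{\alpha+\kappa})|h|_{-\alpha}$ for all $u\in D((-A)^{\alpha+\kappa})$, $h\in H$; - $|DF(u).h|_{\alpha-\kappa}\le C(1+|u|_{\alpha})|h|_{\alpha}$ for all $u,h\in D((-A)^{\alpha})$; - $|(DF(u_2)-DF(u_1)).h|_{-\alpha}\le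 C(1+|u_1|_{\alpha+\kappa}+|u_2|_{\alpha+\kappa})|u_2-u_1|_{-\alpha}|h|_{\alpha+\kappa}$ for all $u_1,u_2,h\in D((-A)^{\alpha+\kappa})$. *Noise.* Let $(\varepsilon_p)$ be a complete orthonormal system of $H$, $\gamma_p\ge0$, and $(\beta_p)$ independent standard real Wiener processes on a probability space; $W^Q(t)=\sum_p\sqrt{\gamma_p}\,\beta_p(t)\varepsilon_p$ and $Q^{1/2}\varepsilon_p=\sqrt{\gamma_p}\,\varepsilon_p$. For $h>0$, $e^{hA}(W^Q(t)-W^Q(s))$ denotes the $L^2(\Omega;H)$-limit of $\sum_{p\le m}\sqrt{\gamma_p}(\beta_p(t)-\beta_p(s))e^{hA}\varepsilon_p$ as $m\to\infty$. *Assumption 2 (on $Q$).* There is $\alpha>0$ such that the Hilbert–Schmidt norm $\|(-A)^{\alpha-\frac12}Q^{\frac12}\|_{\mathcal L_2(H)}$ is finite. Let $\overline\alpha\in(0,\infty]$ be the supremum of all such $\alpha$. *Parareal algorithm.* Let $u_0\in H$, $\Delta T\in(0,1)$, $J\ge1$ an integer, $\delta t=\Delta T/J$, $t_n=n\Delta T$,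 $t_{n,j}=t_n+j\delta t$. The exponential Euler step of size $h$ from time $s$ is $$\Phi_{s,h}(u)=e^{hA}u+h\,e^{hA}F(u)+e^{hA}\bigl(W^Q(s+h)-W^Q(s)\bigr).$$ The coarse integrator is $\mathcal G_n=\Phi_{t_n,\Delta T}$ and the fine integrator is $\mathcal F_n=\Phi_{t_{n,J-1},\delta t}\circ\cdots\circ\Phi_{t_{n,0},\delta t}$. The reference solution is $u^{\rm ref}_0=u_0$, $u^{\rm ref}_{n+1}=\mathcal F_n(u^{\rm ref}_n)$. The parareal iterates are $u^{(k)}_0=u_0$ for all $k\ge 0$, $u^{(0)}_{n+1}=\mathcal G_n(u^{(0)}_n)$ and $$u^{(k+1)}_{n+1}=\mathcal G_n(u^{(k+1)}_n)+\mathcal F_n(u^{(k)}_n)-\mathcal G_n(u^{(k)}_n).$$ The error is $\epsilon^{(k)}_n=u^{(k)}_n-u^{\rm ref}_n$. **Theorem.** Let Assumptions 1 and 2 hold. Let $T\in(0,\infty)$, $k\in\{0,1,2,\dots\}$, $q\in\{1,2,\dots\}$, $\alpha\in[0,\min(\overline\alpha,\frac12))$, $\kappa>0$ and $u_0\in D((-A)^\alpha)$.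 Then there exists $C\in(0,\infty)$, independent of $\Delta T$ and $J$, such that for all $\Delta T\in(0,1)$ and all $J\ge1$, the errors $\epsilon^{(k)}_n$ with $n\Delta T\le T$ have finite $q$-th moments and $$\sup_{n\Delta T\le T}\bigl(\mathbb E|\epsilon^{(k)}_n|^q\bigr)^{1/q}\le C\,\Delta T^{(k+1)(\alpha-\kappa)}.$$ -/

import Mathlib

open MeasureTheory ProbabilityTheory Filter Topology
open scoped ENNReal NNReal

namespace Parareal

noncomputable section

/-- The Hilbert space `H = L²(0,1)`. -/
abbrev H : Type := Lp ℝ 2 (volume.restrict (Set.Ioo (0 : ℝ) 1))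

/-! ### The Dirichlet Laplacian `A u = u''` on `(0,1)`, through its spectral decomposition

The modes are indexed by `p = 0, 1, 2, …`; index `p` stands for frequency `p + 1`. -/

/-- The function `x ↦ √2 sin((p+1)πx)`. -/
def sineMode (p : ℕ) (x : ℝ) : ℝ := √2 * Real.sin (((p : ℝ) + 1) * Real.pi * x)

/-- The eigenvalue `λ_p = ((p+1)π)²` of `-A`. -/
def eigval (p : ℕ) : ℝ := (Real.pi * ((p : ℝ) + 1)) ^ 2

/-- The sine modes satisfy the Dirichlet boundary conditions. -/
theorem sineMode_boundary (p : ℕ) : sineMode p 0 = 0 ∧ sineMode p 1 = 0 := by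
  refine ⟨by simp [sineMode], ?_⟩
  have h := Real.sin_nat_mul_pi (p + 1)
  push_cast at h
  simp [sineMode, h]

/-- The sine modes are eigenfunctions: `φ_p'' = -λ_p φ_p`. -/
theorem sineMode_eigen (p : ℕ) (x : ℝ) :
    deriv (deriv (sineMode p)) x = -eigval p * sineMode p x := by
  have hd : ∀ y : ℝ, HasDerivAt (fun z : ℝ => ((p : ℝ) + 1) * Real.pi * z)
      (((p : ℝ) + 1) * Real.pi) y := fun y => by
    simpa using (hasDerivAt_id y).const_mul (((p : ℝ) + 1) * Real.pi)
  have h1 : deriv (sineMode p) = fun y => √2 *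
      (Real.cos (((p : ℝ) + 1) * Real.pi * y) * (((p : ℝ) + 1) * Real.pi)) := by
    funext y
    exact (((hd y).sin).const_mul √2).deriv
  rw [h1, ((((hd x).cos).mul_const (((p : ℝ) + 1) * Real.pi)).const_mul √2).deriv]
  simp only [eigval, sineMode]
  ring

theorem memLp_sineMode (p : ℕ) :
    MemLp (sineMode p) 2 (volume.restrict (Set.Ioo (0 : ℝ) 1)) := by
  refine MemLp.of_bound (C := √2) ?_ ?_
  · apply Continuous.aestronglyMeasurable
    unfold sineMode
    fun_prop
  · refine Eventually.of_forall fun x => ?_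
    rw [sineMode, Real.norm_eq_abs, abs_mul, abs_of_nonneg (Real.sqrt_nonneg 2)]
    exact mul_le_of_le_one_right (Real.sqrt_nonneg 2) (Real.abs_sin_le_one _)

/-- The eigenfunction `e_p = √2 sin((p+1)π ·)` as an element of `H`. -/
def eigvec (p : ℕ) : H := (memLp_sineMode p).toLp (sineMode p)

/-- The semigroup `e^{tA} u = ∑_p e^{-λ_p t} ⟨u, e_p⟩ e_p`. -/
def heat (t : ℝ) (u : H) : H :=
  ∑' p : ℕ, (Real.exp (-eigval p * t) * inner ℝ (eigvec p) u) • eigvec p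

/-- `|u|_r = (∑_p λ_p^{2r} ⟨u, e_p⟩²)^{1/2}`, with values in `[0,∞]`, for `r` of any sign.
For `r ≥ 0` it is finite exactly when `u ∈ D((-A)^r)`. -/
def fracNorm (r : ℝ) (u : H) : ℝ≥0∞ :=
  (∑' p : ℕ, ENNReal.ofReal (eigval p ^ (2 * r) * (inner ℝ (eigvec p) u) ^ 2)) ^ (1 / 2 : ℝ)

/-- The domain `D((-A)^r)`, for `r ≥ 0`. -/
def fracDomain (r : ℝ) : Set H := {u | fracNorm r u < ∞}

/-! ### The nonlinearity -/

/-- The assumptions on the nonlinear operator `F`. -/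
structure AssumptionF (F : H → H) : Prop where
  lipschitz : ∃ L : ℝ≥0, LipschitzWith L F
  differentiable : Differentiable ℝ F
  differentiable_fderiv : Differentiable ℝ (fderiv ℝ F)
  bounded_fderiv : ∃ M : ℝ, ∀ u, ‖fderiv ℝ F u‖ ≤ M
  bounded_fderiv_fderiv : ∃ M : ℝ, ∀ u, ‖fderiv ℝ (fderiv ℝ F) u‖ ≤ M
  estimates : ∀ α : ℝ, 0 < α → α < 1 / 2 → ∀ κ : ℝ, 0 < κ → κ < 1 / 2 - α →
    ∃ C : ℝ, 0 < C ∧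
      (∀ u ∈ fracDomain (α + κ), ∀ h : H,
        fracNorm (-α) (fderiv ℝ F u h) ≤
          ENNReal.ofReal C * (1 + fracNorm (α + κ) u) * fracNorm (-α) h) ∧
      (∀ u ∈ fracDomain α, ∀ h ∈ fracDomain α,
        fracNorm (α - κ) (fderiv ℝ F u h) ≤
          ENNReal.ofReal C * (1 + fracNorm α u) * fracNorm α h) ∧
      (∀ u₁ ∈ fracDomain (α + κ), ∀ u₂ ∈ fracDomain (α + κ), ∀ h ∈ fracDomain (α + κ),
        fracNorm (-α) ((fderiv ℝ F u₂ - fderiv ℝ F u₁) h) ≤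
          ENNReal.ofReal C * (1 + fracNorm (α + κ) u₁ + fracNorm (α + κ) u₂) *
            fracNorm (-α) (u₂ - u₁) * fracNorm (α + κ) h)

/-! ### The noise

`ε` is a complete orthonormal system of `H`, `γ` a sequence of nonnegative numbers, and
`W^Q(t) = ∑_p √γ_p β_p(t) ε_p`. -/

/-- `Q^{1/2} u = ∑_p √γ_p ⟨u, ε_p⟩ ε_p`. If `γ` is unbounded, this is meaningful on the domain of
`Q^{1/2}`, which contains every `ε_p`; only the vectors `Q^{1/2} ε_p` are used below. -/
def sqrtQ (γ : ℕ → ℝ) (ε : HilbertBasis ℕ ℝ H) (u : H) : H :=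
  ∑' p : ℕ, (√(γ p) * inner ℝ (ε p) u) • ε p

/-- The squared Hilbert-Schmidt norm `‖(-A)^r Q^{1/2}‖²`, with values in `[0,∞]`. -/
def hsNormSq (r : ℝ) (γ : ℕ → ℝ) (ε : HilbertBasis ℕ ℝ H) : ℝ≥0∞ :=
  ∑' p : ℕ, fracNorm r (sqrtQ γ ε (ε p)) ^ 2

/-- The assumption on the covariance operator `Q`. -/
def AssumptionQ (γ : ℕ → ℝ) (ε : HilbertBasis ℕ ℝ H) : Prop :=
  ∃ α : ℝ, 0 < α ∧ hsNormSq (α - 1 / 2) γ ε < ∞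

/-- The regularity parameter `ᾱ` of the noise; it may be `+∞`. -/
def alphaBar (γ : ℕ → ℝ) (ε : HilbertBasis ℕ ℝ H) : EReal :=
  sSup ((fun a : ℝ => (a : EReal)) '' {a : ℝ | 0 < a ∧ hsNormSq (a - 1 / 2) γ ε < ∞})

variable {Ω : Type*} [MeasurableSpace Ω]

/-- `β` is a sequence of independent standard real Wiener processes. -/
structure IsIndepWiener (P : Measure Ω) (β : ℕ → ℝ≥0 → Ω → ℝ) : Prop where
  measurable : ∀ p t, Measurable (β p t)
  brownian : ∀ p, IsBrownianReal (β p) P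
  indep : iIndepFun (fun p ω t => β p t ω) P

open Classical in
/-- The `H`-valued random variable `e^{hA}(W^Q(t) - W^Q(s))`: the limit in `L²(Ω;H)` of the series
`∑_p √γ_p (β_p(t) - β_p(s)) e^{hA} ε_p` (and `0` if that series does not converge). The series for
`W^Q(t) - W^Q(s)` itself need not converge in `H`. -/
def smoothedIncrement (P : Measure Ω) (γ : ℕ → ℝ) (ε : HilbertBasis ℕ ℝ H)
    (β : ℕ → ℝ≥0 → Ω → ℝ) (h s t : ℝ≥0) : Ω → H :=
  if hX : ∃ X : Ω → H, StronglyMeasurable X ∧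
      Tendsto (fun m : ℕ => eLpNorm (fun ω =>
        ∑ p ∈ Finset.range m, (√(γ p) * (β p t ω - β p s ω)) • heat h (ε p) - X ω) 2 P)
        atTop (𝓝 0)
  then hX.choose else 0

/-! ### The integrators and the parareal algorithm -/

/-- One step of the exponential Euler scheme from time `s` to time `s + h`, started at `u`:
`e^{hA} u + h e^{hA} F(u) + e^{hA}(W^Q(s+h) - W^Q(s))`. -/
def expEuler (P : Measure Ω) (γ : ℕ → ℝ) (ε : HilbertBasis ℕ ℝ H) (β : ℕ → ℝ≥0 → Ω → ℝ)
    (F : H → H) (h s : ℝ≥0) (ω : Ω) (u : H) : H :=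
  heat h u + (h : ℝ) • heat h (F u) + smoothedIncrement P γ ε β h s (s + h) ω

/-- The coarse integrator `𝒢(·, t_n, t_{n+1})`, `t_n = n ΔT`: one step of size `ΔT`. -/
def coarse (P : Measure Ω) (γ : ℕ → ℝ) (ε : HilbertBasis ℕ ℝ H) (β : ℕ → ℝ≥0 → Ω → ℝ)
    (F : H → H) (ΔT : ℝ≥0) (n : ℕ) (ω : Ω) (u : H) : H :=
  expEuler P γ ε β F ΔT (n * ΔT) ω u

/-- `v_{n,j}`: the result of `j` steps of size `δt = ΔT / J` from time `t_n`, started at `u`. -/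
def fineSteps (P : Measure Ω) (γ : ℕ → ℝ) (ε : HilbertBasis ℕ ℝ H) (β : ℕ → ℝ≥0 → Ω → ℝ)
    (F : H → H) (ΔT : ℝ≥0) (J n : ℕ) (ω : Ω) (u : H) : ℕ → H
  | 0 => u
  | j + 1 => expEuler P γ ε β F (ΔT / J) (n * ΔT + j * (ΔT / J)) ω
      (fineSteps P γ ε β F ΔT J n ω u j)

/-- The fine integrator `ℱ(·, t_n, t_{n+1})`: `J` steps of size `δt = ΔT / J`. -/
def fine (P : Measure Ω) (γ : ℕ → ℝ) (ε : HilbertBasis ℕ ℝ H) (β : ℕ → ℝ≥0 → Ω → ℝ)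
    (F : H → H) (ΔT : ℝ≥0) (J n : ℕ) (ω : Ω) (u : H) : H :=
  fineSteps P γ ε β F ΔT J n ω u J

/-- The reference solution `u_n^ref`. -/
def reference (P : Measure Ω) (γ : ℕ → ℝ) (ε : HilbertBasis ℕ ℝ H) (β : ℕ → ℝ≥0 → Ω → ℝ)
    (F : H → H) (u₀ : H) (ΔT : ℝ≥0) (J : ℕ) (ω : Ω) : ℕ → H
  | 0 => u₀
  | n + 1 => fine P γ ε β F ΔT J n ω (reference P γ ε β F u₀ ΔT J ω n)

/-- The parareal solution `u_n^{(k)}`; the arguments after `ω` are `k` and `n`. -/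
def parareal (P : Measure Ω) (γ : ℕ → ℝ) (ε : HilbertBasis ℕ ℝ H) (β : ℕ → ℝ≥0 → Ω → ℝ)
    (F : H → H) (u₀ : H) (ΔT : ℝ≥0) (J : ℕ) (ω : Ω) : ℕ → ℕ → H
  | _, 0 => u₀
  | 0, n + 1 => coarse P γ ε β F ΔT n ω (parareal P γ ε β F u₀ ΔT J ω 0 n)
  | k + 1, n + 1 =>
      coarse P γ ε β F ΔT n ω (parareal P γ ε β F u₀ ΔT J ω (k + 1) n)
        + fine P γ ε β F ΔT J n ω (parareal P γ ε β F u₀ ΔT J ω k n)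
        - coarse P γ ε β F ΔT n ω (parareal P γ ε β F u₀ ΔT J ω k n)

/-- The error `ϵ_n^{(k)} = u_n^{(k)} - u_n^ref`. -/
def pararealError (P : Measure Ω) (γ : ℕ → ℝ) (ε : HilbertBasis ℕ ℝ H) (β : ℕ → ℝ≥0 → Ω → ℝ)
    (F : H → H) (u₀ : H) (ΔT : ℝ≥0) (J k n : ℕ) (ω : Ω) : H :=
  parareal P γ ε β F u₀ ΔT J ω k n - reference P γ ε β F u₀ ΔT J ω n

end

end Parareal

namespace Parareal

noncomputable section

/-! ### Completeness of the sine system -/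

/-! Put `δ = ΔT/J` and let `v_j(u)` be the result of `j` fine steps from `u`. The coarse drift `ΔT
e^{ΔT A} F(u)` equals `∑_j δ e^{(J-j)δA} e^{jδA} F(u)`. Hence the coarse and fine integrators have
the same mild form on the fine grid and differ only in the drift, `e^{jδA} F(u)` against
`F(v_j(u))`, and in the accumulated noise (`coarse_eq`, `fine_eq`). In the parareal update the two
coarse noises cancel, so from the first correction on the iterate and the reference carry the same
noise, and the error solves a noise-free recursion. Its drift is the Lipschitz part
`e^{jδA}(F(u^{(k+1)}) - F(u^ref))` plus the defect `(F(v_j(u)) - F(v_j(v))) - e^{jδA}(F(u) - F(v))`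
with `u = u^{(k)}`, `v = u^ref`.

Let `s = max(α - κ, 0)`. In the norm `|·|_{-s}` the defect is at most `‖u - v‖` times a random
factor of size `ΔT^s` (`DriftBounds.fracNorm_defect_le`). Indeed it is a second-order difference of
`F` up to a term with `e^{jδA} - 1`. The second derivative of `F` meets the displacements `v_j(u) -
u` and `v_j(v) - v`, of order `ΔT^α` in moments. The first derivative, bounded in `|·|_{-s}` with a
constant linear in `|·|_α`, meets `(v_j(u) - v_j(v)) - (u - v)`, in which the noise has cancelled
and `e^{jδA} - 1` costs `s` powers of `-A`. The semigroup returns from `|·|_{-s}` to `H` at the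
price of the summable kernel `t^{-s}`, and a discrete Gronwall inequality closes the estimate
(`HasRate.of_isMild`). Each iteration thus gains `ΔT^s`. Cauchy–Schwarz doubles the moment exponent,
so the induction on `k` is over all moments at once (`hasRate_pararealError`).

The argument starts from the coarse scheme, whose error against the reference has order `s`, and
needs moments of `|·|_α` for all iterates. Both rest on bounds for discrete stochastic convolutions,
uniform in `J`: the modes are Gaussian sums, Minkowski's inequality assembles them, and `∑ t^{-b} δ`
absorbs the time singularity (`eLpNorm_fracNorm_convolution_le`). All of this is computed in the
sine basis, whose completeness is proved first. -/

theorem continuous_sineMode (p : ℕ) : Continuous (sineMode p) := by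
  unfold sineMode
  fun_prop

theorem inner_eigvec (p : ℕ) (f : H) :
    inner ℝ (eigvec p) f = ∫ x in Set.Ioo (0 : ℝ) 1, sineMode p x * f x := by
  rw [L2.inner_def]
  refine integral_congr_ae ?_
  filter_upwards [(memLp_sineMode p).coeFn_toLp] with x hx
  rw [eigvec, hx]
  simp [mul_comm]

theorem integral_cos_nat_mul_pi (n : ℕ) (hn : n ≠ 0) :
    ∫ x in (0 : ℝ)..1, Real.cos ((n : ℝ) * Real.pi * x) = 0 := by
  have h0 : (n : ℝ) * Real.pi ≠ 0 := by positivity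
  rw [intervalIntegral.integral_comp_mul_left (fun x => Real.cos x) h0]
  simp [Real.sin_nat_mul_pi]

/-- The product-to-sum formula gives a difference of two cosines of integer frequency. Each
integrates to zero over `(0,1)` unless its frequency vanishes, which happens only for the frequency
`q - p` when `p = q`. -/
theorem integral_sineMode_mul (p q : ℕ) :
    ∫ x in Set.Ioo (0 : ℝ) 1, sineMode p x * sineMode q x = if p = q then 1 else 0 := by
  rw [← integral_Ioc_eq_integral_Ioo, ← intervalIntegral.integral_of_le zero_le_one]
  wlog hpq : p ≤ q generalizing p q
  · rw [← if_congr (eq_comm (a := q) (b := p)) rfl rfl, ← this q p (by omega)]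
    simp_rw [mul_comm]
  obtain ⟨d, rfl⟩ := Nat.exists_eq_add_of_le hpq
  have h : ∀ x : ℝ, sineMode p x * sineMode (p + d) x =
      Real.cos ((d : ℝ) * Real.pi * x) -
        Real.cos (((2 * p + d + 2 : ℕ) : ℝ) * Real.pi * x) := by
    intro x
    have h2 : √2 * √2 = (2 : ℝ) := Real.mul_self_sqrt (by norm_num)
    have e1 : (d : ℝ) * Real.pi * x = (((p + d : ℕ) : ℝ) + 1) * Real.pi * x
        - ((p : ℝ) + 1) * Real.pi * x := by push_cast; ring
    have e2 : ((2 * p + d + 2 : ℕ) : ℝ) * Real.pi * x = (((p + d : ℕ) : ℝ) + 1) * Real.pi * x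
        + ((p : ℝ) + 1) * Real.pi * x := by push_cast; ring
    rw [e1, e2, Real.cos_sub, Real.cos_add, sineMode, sineMode]
    linear_combination (Real.sin (((p : ℝ) + 1) * Real.pi * x)
      * Real.sin ((((p + d : ℕ) : ℝ) + 1) * Real.pi * x)) * h2
  simp_rw [h]
  rw [intervalIntegral.integral_sub, integral_cos_nat_mul_pi (2 * p + d + 2) (by omega)]
  · by_cases hd : d = 0
    · simp [hd]
    · rw [integral_cos_nat_mul_pi d hd]
      simp [hd]
  · exact Continuous.intervalIntegrable (by fun_prop) _ _
  · exact Continuous.intervalIntegrable (by fun_prop) _ _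

theorem orthonormal_eigvec : Orthonormal ℝ eigvec := by
  rw [orthonormal_iff_ite]
  intro p q
  rw [inner_eigvec, ← integral_sineMode_mul p q]
  refine integral_congr_ae ?_
  filter_upwards [(memLp_sineMode q).coeFn_toLp] with x hx
  rw [eigvec, hx]

theorem integrable_mul_coe (f : H) {g : ℝ → ℝ} (hg : Continuous g) :
    IntegrableOn (fun x => g x * f x) (Set.Ioo (0 : ℝ) 1) := by
  have hf : Integrable (fun x => f x) (volume.restrict (Set.Ioo (0 : ℝ) 1)) :=
    (Lp.memLp f).integrable (by norm_num)
  obtain ⟨C, hC⟩ := (isCompact_Icc (a := (0 : ℝ)) (b := 1)).exists_bound_of_continuousOn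
    hg.continuousOn
  refine hf.bdd_mul (c := C) hg.aestronglyMeasurable ?_
  refine (ae_restrict_iff' measurableSet_Ioo).2 (Eventually.of_forall fun x hx => ?_)
  exact hC x (Set.Ioo_subset_Icc_self hx)

/-- The fundamental lemma of the calculus of variations; smooth functions compactly supported in
`(0,1)` are among the admissible `g`. -/
theorem eq_zero_of_integral_continuous_mul {f : ℝ → ℝ}
    (hf : IntegrableOn f (Set.Ioo (0 : ℝ) 1))
    (h : ∀ g : ℝ → ℝ, Continuous g → ∫ x in Set.Ioo (0 : ℝ) 1, g x * f x = 0) :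
    ∀ᵐ x ∂(volume.restrict (Set.Ioo (0 : ℝ) 1)), f x = 0 := by
  have := isOpen_Ioo.ae_eq_zero_of_integral_contDiff_smul_eq_zero (μ := volume)
    (U := Set.Ioo (0 : ℝ) 1) (f := f) hf.locallyIntegrableOn (fun g hg _ hs => by
      rw [← h g hg.continuous, eq_comm]
      refine setIntegral_eq_integral_of_forall_compl_eq_zero fun x hx => ?_
      rw [image_eq_zero_of_notMem_tsupport (fun h' => hx (hs h')), zero_mul])
  rwa [ae_restrict_iff' measurableSet_Ioo]

/-- A function orthogonal to all `sin((p+1)πx) cos(πx)^k` integrates to zero against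
`sin(πx)` times any polynomial in `cos(πx)`. -/
theorem integral_cos_pow_mul_sineMode (f : H) (hf : ∀ p, inner ℝ (eigvec p) f = 0) (k p : ℕ) :
    ∫ x in Set.Ioo (0 : ℝ) 1, (Real.cos (Real.pi * x) ^ k * sineMode p x) * f x = 0 := by
  induction k generalizing p with
  | zero => simpa [inner_eigvec] using hf p
  | succ k ih =>
    have hc : ∀ q, Continuous fun x => Real.cos (Real.pi * x) ^ k * sineMode q x := fun q =>
      (by fun_prop : Continuous fun x => Real.cos (Real.pi * x) ^ k).mul (continuous_sineMode q)
    -- The identity `2 cos(πx) sin(mπx) = sin((m+1)πx) + sin((m-1)πx)` trades one power of the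
    -- cosine for a shift of the mode. For the lowest mode the second sine is zero.
    cases p with
    | zero =>
      have h : ∀ x : ℝ, (Real.cos (Real.pi * x) ^ (k + 1) * sineMode 0 x) * f x =
          (1 / 2) * ((Real.cos (Real.pi * x) ^ k * sineMode 1 x) * f x) := by
        intro x
        have : sineMode 1 x = 2 * Real.cos (Real.pi * x) * sineMode 0 x := by
          simp only [sineMode]
          have : ((1 : ℕ) + 1 : ℝ) * Real.pi * x = 2 * (Real.pi * x) := by push_cast; ring
          rw [this, Real.sin_two_mul]
          simp
          ring
        rw [this]
        ring
      simp_rw [h]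
      rw [integral_const_mul, ih 1, mul_zero]
    | succ p =>
      have h : ∀ x : ℝ, (Real.cos (Real.pi * x) ^ (k + 1) * sineMode (p + 1) x) * f x =
          (1 / 2) * ((Real.cos (Real.pi * x) ^ k * sineMode (p + 2) x) * f x) +
          (1 / 2) * ((Real.cos (Real.pi * x) ^ k * sineMode p x) * f x) := by
        intro x
        have : sineMode (p + 2) x + sineMode p x =
            2 * Real.cos (Real.pi * x) * sineMode (p + 1) x := by
          simp only [sineMode]
          have e1 : (((p + 2 : ℕ) : ℝ) + 1) * Real.pi * x =
            (((p + 1 : ℕ) : ℝ) + 1) * Real.pi * x + Real.pi * x := by push_cast; ring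
          have e2 : ((p : ℝ) + 1) * Real.pi * x =
            (((p + 1 : ℕ) : ℝ) + 1) * Real.pi * x - Real.pi * x := by push_cast; ring
          rw [e1, e2, Real.sin_add, Real.sin_sub]
          ring
        linear_combination (-(1 / 2) * Real.cos (Real.pi * x) ^ k * f x) * this
      simp_rw [h]
      rw [integral_add ((integrable_mul_coe f (hc _)).const_mul _)
        ((integrable_mul_coe f (hc _)).const_mul _), integral_const_mul, integral_const_mul,
        ih, ih]
      simp

/-- `x ↦ cos(πx)` on `[0,1]`. -/
def cosPi : C(Set.Icc (0 : ℝ) 1, ℝ) := ⟨fun x => Real.cos (Real.pi * x), by fun_prop⟩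

/-- Stone–Weierstrass: `cos(π·)` is injective on `[0,1]`, so this one generator already separates
points. -/
theorem cosPi_adjoin_dense : (Algebra.adjoin ℝ {cosPi}).topologicalClosure = ⊤ := by
  refine ContinuousMap.subalgebra_topologicalClosure_eq_top_of_separatesPoints _ ?_
  intro x y hxy
  refine ⟨cosPi, ⟨cosPi, Algebra.subset_adjoin rfl, rfl⟩, fun h => hxy ?_⟩
  have hπ := Real.pi_pos
  have := Real.injOn_cos (x₁ := Real.pi * x) (x₂ := Real.pi * y)
    ⟨by have := x.2.1; positivity, by nlinarith [x.2.2]⟩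
    ⟨by have := y.2.1; positivity, by nlinarith [y.2.2]⟩ h
  exact Subtype.ext (mul_left_cancel₀ hπ.ne' this)

/-- The functional `g ↦ ∫ g sin(πx) f` is continuous in the sup norm and vanishes on polynomials in
`cos(πx)`, hence on all of `C([0,1])`. So `sin(πx) f = 0` almost everywhere, and `sin(πx) > 0`
inside the interval. -/
theorem eigvec_complete (f : H) (hf : ∀ p, inner ℝ (eigvec p) f = 0) : f = 0 := by
  have hs : IntegrableOn (fun x => sineMode 0 x * f x) (Set.Ioo (0 : ℝ) 1) :=
    integrable_mul_coe f (continuous_sineMode 0)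
  let ext : C(Set.Icc (0 : ℝ) 1, ℝ) → ℝ → ℝ := fun g => Set.IccExtend zero_le_one g
  have hext : ∀ g, Continuous (ext g) := fun g => g.continuous.Icc_extend'
  have hextv : ∀ g, ∀ x ∈ Set.Ioo (0 : ℝ) 1, ∃ hx : x ∈ Set.Icc (0 : ℝ) 1, ext g x = g ⟨x, hx⟩ :=
    fun g x hx => ⟨Set.Ioo_subset_Icc_self hx, Set.IccExtend_of_mem _ _ _⟩
  have hbd : ∀ g, ∀ x ∈ Set.Ioo (0 : ℝ) 1, ‖ext g x‖ ≤ ‖g‖ := fun g x hx => by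
    obtain ⟨hx', h⟩ := hextv g x hx
    rw [h]
    exact g.norm_coe_le_norm _
  have hint : ∀ g, IntegrableOn (fun x => ext g x * (sineMode 0 x * f x)) (Set.Ioo (0 : ℝ) 1) := by
    intro g
    refine hs.bdd_mul (c := ‖g‖) (hext g).aestronglyMeasurable ?_
    exact (ae_restrict_iff' measurableSet_Ioo).2 (Eventually.of_forall fun x hx => hbd g x hx)
  let φ : C(Set.Icc (0 : ℝ) 1, ℝ) →ₗ[ℝ] ℝ :=
    { toFun := fun g => ∫ x in Set.Ioo (0 : ℝ) 1, ext g x * (sineMode 0 x * f x)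
      map_add' := fun g₁ g₂ => by
        rw [← integral_add (hint g₁) (hint g₂)]
        refine integral_congr_ae (Eventually.of_forall fun x => ?_)
        simp only [ext, Set.IccExtend, Function.comp, ContinuousMap.add_apply]
        ring
      map_smul' := fun c g => by
        rw [RingHom.id_apply, smul_eq_mul, ← integral_const_mul]
        refine integral_congr_ae (Eventually.of_forall fun x => ?_)
        simp only [ext, Set.IccExtend, Function.comp, ContinuousMap.smul_apply, smul_eq_mul]
        ring }
  have hφc : Continuous φ := by
    refine AddMonoidHomClass.continuous_of_bound φ
      (∫ x in Set.Ioo (0 : ℝ) 1, ‖sineMode 0 x * f x‖) fun g => ?_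
    rw [mul_comm, ← integral_const_mul]
    refine norm_integral_le_of_norm_le (hs.norm.const_mul _) ?_
    refine (ae_restrict_iff' measurableSet_Ioo).2 (Eventually.of_forall fun x hx => ?_)
    rw [norm_mul]
    exact mul_le_mul_of_nonneg_right (hbd g x hx) (norm_nonneg _)
  have hφ0 : ∀ g ∈ Algebra.adjoin ℝ {cosPi}, φ g = 0 := by
    intro g hg
    rw [Algebra.adjoin_singleton_eq_range_aeval] at hg
    obtain ⟨P, rfl⟩ := hg
    induction P using Polynomial.induction_on' with
    | add P Q hP hQ => rw [map_add, map_add, hP, hQ, add_zero]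
    | monomial n a =>
      have : (Polynomial.aeval cosPi) (Polynomial.monomial n a) = a • cosPi ^ n := by
        rw [Polynomial.aeval_monomial, Algebra.smul_def]
      have h2 : φ (a • cosPi ^ n) = 0 := by
        rw [map_smul]
        have : φ (cosPi ^ n) = 0 := by
          refine Eq.trans ?_ (integral_cos_pow_mul_sineMode f hf n 0)
          refine setIntegral_congr_fun measurableSet_Ioo fun x hx => ?_
          obtain ⟨hx', h⟩ := hextv (cosPi ^ n) x hx
          simp only [h]
          simp [cosPi, mul_assoc]
        rw [this, smul_zero]
      simpa [this] using h2
  have hφ : ∀ g, φ g = 0 := by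
    intro g
    have hg : g ∈ (Algebra.adjoin ℝ {cosPi}).topologicalClosure := by
      rw [cosPi_adjoin_dense]; trivial
    have hcl : IsClosed {g | φ g = 0} := isClosed_eq hφc continuous_const
    exact hcl.closure_subset_iff.2 (fun g hg => hφ0 g hg) hg
  have hz := eq_zero_of_integral_continuous_mul hs fun g hg => by
    refine Eq.trans ?_ (hφ ⟨fun x => g x, by fun_prop⟩)
    refine setIntegral_congr_fun measurableSet_Ioo fun x hx => ?_
    obtain ⟨hx', h⟩ := hextv ⟨fun x => g x, by fun_prop⟩ x hx
    simp only [h, ContinuousMap.coe_mk]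
  rw [Lp.eq_zero_iff_ae_eq_zero]
  filter_upwards [hz, ae_restrict_mem measurableSet_Ioo] with x hx hx'
  rcases mul_eq_zero.1 hx with h | h
  · exfalso
    simp only [sineMode, Nat.cast_zero, zero_add, one_mul, mul_eq_zero] at h
    rcases h with h | h
    · exact absurd h (by positivity)
    · refine absurd h (Real.sin_pos_of_pos_of_lt_pi (mul_pos Real.pi_pos hx'.1) ?_).ne'
      nlinarith [Real.pi_pos, hx'.2]
  · exact h

/-- The eigenfunctions of the Dirichlet Laplacian form a Hilbert basis. -/
def eigBasis : HilbertBasis ℕ ℝ H :=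
  HilbertBasis.mkOfOrthogonalEqBot orthonormal_eigvec (by
    rw [Submodule.eq_bot_iff]
    intro f hf
    refine eigvec_complete f fun p => ?_
    exact hf _ (Submodule.subset_span ⟨p, rfl⟩))

theorem eigBasis_apply (p : ℕ) : eigBasis p = eigvec p := by
  rw [eigBasis, HilbertBasis.coe_mkOfOrthogonalEqBot]

end

end Parareal

namespace Parareal

noncomputable section

/-! ### Diagonal operators, the semigroup and fractional norms -/

theorem one_le_eigval (p : ℕ) : 1 ≤ eigval p := by
  unfold eigval
  have h : (1 : ℝ) ≤ Real.pi * ((p : ℝ) + 1) := by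
    nlinarith [Real.pi_gt_three, (Nat.cast_nonneg p : (0 : ℝ) ≤ p)]
  nlinarith

theorem eigval_pos (p : ℕ) : 0 < eigval p := zero_lt_one.trans_le (one_le_eigval p)

theorem ext_inner_eigvec {u v : H}
    (h : ∀ p, inner ℝ (eigvec p) u = inner ℝ (eigvec p) v) : u = v := by
  rw [← sub_eq_zero]
  exact eigvec_complete _ fun p => by rw [inner_sub_right, h p, sub_self]

/-- The operator with eigenvalues `c p` along the modes `eigvec p`. -/
def diagOp (c : ℕ → ℝ) (u : H) : H := ∑' p : ℕ, (c p * inner ℝ (eigvec p) u) • eigvec p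

/-- A bounded multiplier keeps the coefficients in `ℓ²`, so the defining series converges and its
coordinates can be read off. Identities between diagonal operators then reduce to identities between
multipliers. -/
theorem inner_diagOp {c : ℕ → ℝ} {M : ℝ} (hc : ∀ p, |c p| ≤ M) (u : H) (p : ℕ) :
    inner ℝ (eigvec p) (diagOp c u) = c p * inner ℝ (eigvec p) u := by
  have hmem : Memℓp (fun p => c p * eigBasis.repr u p) 2 := by
    refine memℓp_gen ?_
    have hs := (lp.memℓp (eigBasis.repr u)).summable (by norm_num)
    refine (hs.mul_left (M ^ 2)).of_nonneg_of_le (fun p => by positivity) fun p => ?_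
    simp only [ENNReal.toReal_ofNat, Real.rpow_two, norm_mul, mul_pow]
    gcongr
    exact hc p
  have h := eigBasis.hasSum_repr_symm ⟨_, hmem⟩
  have h2 : diagOp c u = eigBasis.repr.symm ⟨_, hmem⟩ := by
    rw [← h.tsum_eq, diagOp]
    refine tsum_congr fun p => ?_
    rw [← eigBasis_apply, ← HilbertBasis.repr_apply_apply]
  rw [h2, ← eigBasis_apply, ← HilbertBasis.repr_apply_apply,
    LinearIsometryEquiv.apply_symm_apply, ← HilbertBasis.repr_apply_apply]

/-! #### Fractional norms -/

theorem ofReal_eigval_rpow (r : ℝ) (p : ℕ) (x : ℝ) :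
    ENNReal.ofReal (eigval p ^ (2 * r) * x ^ 2) =
      (ENNReal.ofReal (eigval p ^ r) * ‖x‖ₑ) ^ (2 : ℝ) := by
  rw [Real.enorm_eq_ofReal_abs, ← ENNReal.ofReal_mul (by have := eigval_pos p; positivity),
    ENNReal.rpow_two, ← ENNReal.ofReal_pow (by have := eigval_pos p; positivity), mul_pow, sq_abs,
    mul_comm 2 r, Real.rpow_mul (eigval_pos p).le, Real.rpow_two]

theorem fracNorm_eq (r : ℝ) (u : H) : fracNorm r u =
    (∑' p, (ENNReal.ofReal (eigval p ^ r) * ‖(inner ℝ (eigvec p) u : ℝ)‖ₑ) ^ (2 : ℝ))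
      ^ (1 / 2 : ℝ) := by
  simp_rw [fracNorm, ofReal_eigval_rpow]

theorem fracNorm_sq (r : ℝ) (u : H) : fracNorm r u ^ (2 : ℝ) =
    ∑' p, ENNReal.ofReal (eigval p ^ (2 * r) * (inner ℝ (eigvec p) u : ℝ) ^ 2) := by
  rw [fracNorm, ← ENNReal.rpow_mul]
  norm_num

theorem fracNorm_add_le (r : ℝ) (u v : H) : fracNorm r (u + v) ≤ fracNorm r u + fracNorm r v := by
  have h := ENNReal.lintegral_Lp_add_le (μ := Measure.count) (p := 2)
    (f := fun p : ℕ => ENNReal.ofReal (eigval p ^ r) * ‖(inner ℝ (eigvec p) u : ℝ)‖ₑ)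
    (g := fun p : ℕ => ENNReal.ofReal (eigval p ^ r) * ‖(inner ℝ (eigvec p) v : ℝ)‖ₑ)
    (measurable_of_countable _).aemeasurable (measurable_of_countable _).aemeasurable (by norm_num)
  simp_rw [lintegral_count, ← fracNorm_eq] at h
  refine le_trans ?_ h
  rw [fracNorm_eq]
  gcongr with p
  rw [Pi.add_apply, ← mul_add, inner_add_right]
  gcongr
  exact enorm_add_le _ _

/-- The single comparison principle behind monotonicity in `r`, parabolic smoothing and time
regularity: each is an inequality between multipliers, mode by mode. -/
theorem fracNorm_le_of_inner_le {r s C : ℝ} {u v : H} (hC : 0 ≤ C)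
    (h : ∀ p, |(inner ℝ (eigvec p) v : ℝ)| ≤ C * eigval p ^ s * |(inner ℝ (eigvec p) u : ℝ)|) :
    fracNorm r v ≤ ENNReal.ofReal C * fracNorm (r + s) u := by
  rw [fracNorm_eq, fracNorm_eq]
  have : ENNReal.ofReal C = (ENNReal.ofReal C ^ (2 : ℝ)) ^ (1 / 2 : ℝ) := by
    rw [← ENNReal.rpow_mul]; norm_num
  rw [this, ← ENNReal.mul_rpow_of_nonneg _ _ (by norm_num), ← ENNReal.tsum_mul_left]
  gcongr with p
  rw [← ENNReal.mul_rpow_of_nonneg _ _ (by norm_num)]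
  refine ENNReal.rpow_le_rpow ?_ (by norm_num)
  have hp := eigval_pos p
  rw [Real.enorm_eq_ofReal_abs, Real.enorm_eq_ofReal_abs, ← ENNReal.ofReal_mul (by positivity),
    ← ENNReal.ofReal_mul (by positivity), ← ENNReal.ofReal_mul (by positivity)]
  refine ENNReal.ofReal_le_ofReal ?_
  calc eigval p ^ r * |(inner ℝ (eigvec p) v : ℝ)|
      ≤ eigval p ^ r * (C * eigval p ^ s * |(inner ℝ (eigvec p) u : ℝ)|) := by
        gcongr
        exact h p
    _ = C * (eigval p ^ (r + s) * |(inner ℝ (eigvec p) u : ℝ)|) := by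
        rw [Real.rpow_add hp]; ring

theorem fracNorm_smul_le (r c : ℝ) (u : H) : fracNorm r (c • u) ≤ ‖c‖ₑ * fracNorm r u := by
  have := fracNorm_le_of_inner_le (r := r) (s := 0) (C := |c|) (u := u) (v := c • u)
    (abs_nonneg c) fun p => by rw [inner_smul_right, abs_mul]; simp
  rwa [add_zero, ← Real.enorm_eq_ofReal_abs] at this

theorem fracNorm_zero_right (r : ℝ) : fracNorm r (0 : H) = 0 := by
  simp [fracNorm]

theorem fracNorm_neg (r : ℝ) (u : H) : fracNorm r (-u) = fracNorm r u := by
  simp [fracNorm, inner_neg_right]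

theorem fracNorm_sub_le (r : ℝ) (u v : H) : fracNorm r (u - v) ≤ fracNorm r u + fracNorm r v := by
  rw [sub_eq_add_neg, ← fracNorm_neg r v]
  exact fracNorm_add_le r u (-v)

theorem fracNorm_sum_le {ι : Type*} (r : ℝ) (s : Finset ι) (f : ι → H) :
    fracNorm r (∑ i ∈ s, f i) ≤ ∑ i ∈ s, fracNorm r (f i) :=
  Finset.le_sum_of_subadditive _ (fracNorm_zero_right r).le (fracNorm_add_le r) s f

theorem fracNorm_mono {r s : ℝ} (h : r ≤ s) (u : H) : fracNorm r u ≤ fracNorm s u := by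
  have := fracNorm_le_of_inner_le (r := r) (s := s - r) (C := 1) (u := u) (v := u) zero_le_one
    fun p => by
      rw [one_mul]
      exact le_mul_of_one_le_left (abs_nonneg _)
        (Real.one_le_rpow (one_le_eigval p) (sub_nonneg.2 h))
  simpa using this

/-- Parseval's identity; the completeness of the sine system enters here. -/
theorem fracNorm_zero_left (u : H) : fracNorm 0 u = ‖u‖ₑ := by
  have h : HasSum (fun p => (inner ℝ (eigvec p) u : ℝ) ^ 2) (‖u‖ ^ 2) := by
    have := eigBasis.hasSum_inner_mul_inner u u
    rw [real_inner_self_eq_norm_sq] at this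
    have h2 : (fun p => (inner ℝ (eigvec p) u : ℝ) ^ 2) =
        fun p => inner ℝ u (eigBasis p) * inner ℝ (eigBasis p) u := funext fun p => by
      rw [eigBasis_apply, real_inner_comm u (eigvec p), sq]
    rwa [h2]
  have h2 : fracNorm 0 u = (ENNReal.ofReal (‖u‖ ^ 2)) ^ (1 / 2 : ℝ) := by
    rw [fracNorm, ← h.tsum_eq, ENNReal.ofReal_tsum_of_nonneg (fun p => sq_nonneg _) h.summable]
    simp
  rw [h2, ENNReal.ofReal_pow (norm_nonneg u), ofReal_norm, ← ENNReal.rpow_two,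
    ← ENNReal.rpow_mul]
  norm_num

theorem norm_le_of_inner_le {u v : H} (C : ℝ) (hC : 0 ≤ C)
    (h : ∀ p, |(inner ℝ (eigvec p) v : ℝ)| ≤ C * |(inner ℝ (eigvec p) u : ℝ)|) :
    ‖v‖ ≤ C * ‖u‖ := by
  have := fracNorm_le_of_inner_le (r := 0) (s := 0) (u := u) (v := v) hC (by simpa using h)
  rw [add_zero, fracNorm_zero_left, fracNorm_zero_left, ← ofReal_norm,
    ← ofReal_norm, ← ENNReal.ofReal_mul hC] at this
  exact (ENNReal.ofReal_le_ofReal_iff (by positivity)).1 this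

theorem measurable_fracNorm_comp {Ω : Type*} [MeasurableSpace Ω] (r : ℝ) {X : Ω → H}
    (hX : StronglyMeasurable X) : Measurable fun ω => fracNorm r (X ω) := by
  unfold fracNorm
  have h : ∀ p, Measurable fun ω => (inner ℝ (eigvec p) (X ω) : ℝ) := fun p =>
    (stronglyMeasurable_const.inner hX).measurable
  refine Measurable.pow_const (Measurable.tsum fun p => ?_) _
  exact (((h p).pow_const 2).const_mul _).ennreal_ofReal

/-! #### The semigroup -/

/-- Diagonal operators with bounded eigenvalues as continuous linear maps. -/
def diagCLM (c : ℕ → ℝ) (M : ℝ) (hM : 0 ≤ M) (hc : ∀ p, |c p| ≤ M) : H →L[ℝ] H :=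
  LinearMap.mkContinuous
    { toFun := diagOp c
      map_add' := fun u v => ext_inner_eigvec fun p => by
        rw [inner_add_right, inner_diagOp hc, inner_diagOp hc, inner_diagOp hc, inner_add_right,
          mul_add]
      map_smul' := fun a u => ext_inner_eigvec fun p => by
        rw [RingHom.id_apply, inner_smul_right, inner_diagOp hc, inner_diagOp hc, inner_smul_right]
        ring } M fun u => norm_le_of_inner_le M hM fun p => by
          simp only [LinearMap.coe_mk, AddHom.coe_mk, inner_diagOp hc, abs_mul]
          exact mul_le_mul_of_nonneg_right (hc p) (abs_nonneg _)

theorem diagCLM_apply (c : ℕ → ℝ) (M : ℝ) (hM : 0 ≤ M) (hc : ∀ p, |c p| ≤ M) (u : H) :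
    diagCLM c M hM hc u = diagOp c u := rfl

theorem abs_exp_eigval_le (t : ℝ≥0) (p : ℕ) : |Real.exp (-eigval p * t)| ≤ 1 := by
  rw [Real.abs_exp, Real.exp_le_one_iff]
  have := (eigval_pos p).le
  have : 0 ≤ eigval p * t := by positivity
  linarith

/-- The semigroup as a continuous linear map. -/
def heatL (t : ℝ≥0) : H →L[ℝ] H :=
  diagCLM (fun p => Real.exp (-eigval p * t)) 1 zero_le_one (abs_exp_eigval_le t)

theorem heat_eq (t : ℝ≥0) (u : H) : heat t u = heatL t u := rfl

theorem inner_heatL (t : ℝ≥0) (u : H) (p : ℕ) :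
    inner ℝ (eigvec p) (heatL t u) = Real.exp (-eigval p * t) * inner ℝ (eigvec p) u :=
  inner_diagOp (abs_exp_eigval_le t) u p

theorem heatL_zero (u : H) : heatL 0 u = u := ext_inner_eigvec fun p => by simp [inner_heatL]

theorem heatL_heatL (s t : ℝ≥0) (u : H) : heatL s (heatL t u) = heatL (s + t) u :=
  ext_inner_eigvec fun p => by
    rw [inner_heatL, inner_heatL, inner_heatL, ← mul_assoc, ← Real.exp_add]
    push_cast
    ring_nf

theorem norm_heatL_le (t : ℝ≥0) (u : H) : ‖heatL t u‖ ≤ ‖u‖ := by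
  have := norm_le_of_inner_le (u := u) (v := heatL t u) 1 zero_le_one fun p => by
    rw [inner_heatL, abs_mul]
    exact mul_le_mul_of_nonneg_right (abs_exp_eigval_le t p) (abs_nonneg _)
  rwa [one_mul] at this

theorem enorm_heatL_le (t : ℝ≥0) (u : H) : ‖heatL t u‖ₑ ≤ ‖u‖ₑ := by
  rw [← ofReal_norm, ← ofReal_norm]
  exact ENNReal.ofReal_le_ofReal (norm_heatL_le t u)

theorem rpow_mul_exp_neg_le {x b : ℝ} (hx : 0 ≤ x) (hb₀ : 0 ≤ b) (hb₁ : b ≤ 1) :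
    x ^ b * Real.exp (-x) ≤ 1 := by
  have h1 : x ^ b ≤ Real.exp x := by
    rcases le_total x 1 with h | h
    · exact (Real.rpow_le_one hx h hb₀).trans (Real.one_le_exp hx)
    · calc x ^ b ≤ x ^ (1 : ℝ) := Real.rpow_le_rpow_of_exponent_le h hb₁
        _ = x := Real.rpow_one x
        _ ≤ Real.exp x := by linarith [Real.add_one_le_exp x]
  calc x ^ b * Real.exp (-x) ≤ Real.exp x * Real.exp (-x) := by gcongr
    _ = 1 := by rw [← Real.exp_add]; simp

theorem one_sub_exp_neg_le_rpow {x b : ℝ} (hx : 0 ≤ x) (hb₀ : 0 ≤ b) (hb₁ : b ≤ 1) :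
    1 - Real.exp (-x) ≤ x ^ b := by
  rcases le_total x 1 with h | h
  · rcases hx.eq_or_lt with rfl | hx0
    · simpa using Real.rpow_nonneg le_rfl b
    calc 1 - Real.exp (-x) ≤ x := by linarith [Real.add_one_le_exp (-x)]
      _ = x ^ (1 : ℝ) := (Real.rpow_one x).symm
      _ ≤ x ^ b := Real.rpow_le_rpow_of_exponent_ge hx0 h hb₁
  · linarith [Real.one_le_rpow h hb₀, Real.exp_pos (-x)]

theorem exp_neg_mul_le_rpow {l t b : ℝ} (hl : 0 < l) (ht : 0 < t) (hb₀ : 0 ≤ b) (hb₁ : b ≤ 1) :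
    Real.exp (-l * t) ≤ t ^ (-b) * l ^ (-b) := by
  have h := rpow_mul_exp_neg_le (mul_pos hl ht).le hb₀ hb₁
  rw [Real.mul_rpow hl.le ht.le] at h
  rw [Real.rpow_neg ht.le, Real.rpow_neg hl.le, ← mul_inv, neg_mul, ← one_div, le_div_iff₀
    (by positivity)]
  linarith [mul_comm (t ^ b) (l ^ b)]

/-- Parabolic smoothing: `(λt)^b e^{-λt} ≤ 1` for `b ∈ [0,1]`, so `b` powers of `-A` cost `t^{-b}`.
-/
theorem fracNorm_heatL_le {b : ℝ} (hb₀ : 0 ≤ b) (hb₁ : b ≤ 1) {t : ℝ≥0} (ht : 0 < t) (r : ℝ)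
    (u : H) : fracNorm r (heatL t u) ≤ (t : ℝ≥0∞) ^ (-b) * fracNorm (r - b) u := by
  have ht' : (0 : ℝ) < t := ht
  have := fracNorm_le_of_inner_le (r := r) (s := -b) (C := (t : ℝ) ^ (-b)) (u := u)
    (v := heatL t u) (by positivity) fun p => by
      rw [inner_heatL, abs_mul, Real.abs_exp]
      exact mul_le_mul_of_nonneg_right (exp_neg_mul_le_rpow (eigval_pos p) ht' hb₀ hb₁)
        (abs_nonneg _)
  rwa [← ENNReal.ofReal_rpow_of_pos ht', ENNReal.ofReal_coe_nnreal, ← sub_eq_add_neg] at this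

theorem fracNorm_heatL_le_self (t : ℝ≥0) (r : ℝ) (u : H) :
    fracNorm r (heatL t u) ≤ fracNorm r u := by
  have := fracNorm_le_of_inner_le (r := r) (s := 0) (C := 1) (u := u)
    (v := heatL t u) zero_le_one fun p => by
      rw [inner_heatL, abs_mul, Real.rpow_zero, mul_one]
      exact mul_le_mul_of_nonneg_right (abs_exp_eigval_le t p) (abs_nonneg _)
  simpa using this

/-- Time regularity: `1 - e^{-λt} ≤ (λt)^b` for `b ∈ [0,1]`, so `b` powers of `-A` buy `t^b`. -/
theorem fracNorm_heatL_sub_le {b : ℝ} (hb₀ : 0 ≤ b) (hb₁ : b ≤ 1) (t : ℝ≥0) (r : ℝ)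
    (u : H) : fracNorm r (heatL t u - u) ≤ (t : ℝ≥0∞) ^ b * fracNorm (r + b) u := by
  have ht' : (0 : ℝ) ≤ t := t.2
  have := fracNorm_le_of_inner_le (r := r) (s := b) (C := (t : ℝ) ^ b) (u := u)
    (v := heatL t u - u) (by positivity) fun p => by
      have h1 := one_sub_exp_neg_le_rpow (mul_nonneg (eigval_pos p).le ht') hb₀ hb₁
      have h2 := abs_exp_eigval_le t p
      rw [Real.abs_exp] at h2
      rw [inner_sub_right, inner_heatL, ← sub_one_mul, abs_mul]
      refine mul_le_mul_of_nonneg_right ?_ (abs_nonneg _)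
      rw [abs_sub_comm, abs_of_nonneg (by linarith), neg_mul]
      rwa [Real.mul_rpow (eigval_pos p).le ht', mul_comm (eigval p ^ b)] at h1
  rwa [← ENNReal.ofReal_rpow_of_nonneg ht' hb₀, ENNReal.ofReal_coe_nnreal] at this

/-- The operator `(-A)^{-s}`, for `s ≥ 0`. -/
def negPow (s : ℝ) (hs : 0 ≤ s) : H →L[ℝ] H :=
  diagCLM (fun p => eigval p ^ (-s)) 1 zero_le_one fun p => by
    rw [abs_of_nonneg (Real.rpow_nonneg (eigval_pos p).le _)]
    exact Real.rpow_le_one_of_one_le_of_nonpos (one_le_eigval p) (neg_nonpos.2 hs)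

/-- Makes `|·|_{-s}` the norm of a bounded linear image, so that the mean value inequality in `H`
applies to it. -/
theorem enorm_negPow (s : ℝ) (hs : 0 ≤ s) (u : H) : ‖negPow s hs u‖ₑ = fracNorm (-s) u := by
  rw [← fracNorm_zero_left, fracNorm_eq, fracNorm_eq]
  congr 1
  refine tsum_congr fun p => ?_
  congr 1
  have hp := eigval_pos p
  rw [negPow, diagCLM_apply, inner_diagOp (M := 1), Real.rpow_zero, enorm_mul,
    Real.enorm_eq_ofReal (by positivity)]
  · simp
  · intro p
    rw [abs_of_nonneg (Real.rpow_nonneg (eigval_pos p).le _)]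
    exact Real.rpow_le_one_of_one_le_of_nonpos (one_le_eigval p) (neg_nonpos.2 hs)

end

end Parareal

namespace Parareal

noncomputable section

variable {Ω : Type*} [MeasurableSpace Ω]

/-! ### Moments of Gaussian sums -/

/-- A constant for moment bounds of sub-Gaussian variables. -/
def momentConst (n : ℕ) : ℝ≥0∞ :=
  ENNReal.ofReal (n.factorial * (2 * Real.exp (1 / 2))) ^ (1 / (n : ℝ))

theorem momentConst_ne_top (n : ℕ) : momentConst n ≠ ∞ :=
  ENNReal.rpow_ne_top_of_nonneg (by positivity) ENNReal.ofReal_ne_top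

/-- With `s = √c`, the exponential series gives `|Y/s|^n ≤ n! (e^{Y/s} + e^{-Y/s})`, and the moment
generating function at `±1/s` is at most `e^{1/2}`. A zero variance proxy makes `Y` vanish almost
surely and is treated apart. -/
theorem eLpNorm_le_of_hasSubgaussianMGF {P : Measure Ω} [IsProbabilityMeasure P] {Y : Ω → ℝ}
    {c : ℝ≥0} (h : HasSubgaussianMGF Y c P) {n : ℕ} (hn : n ≠ 0) :
    eLpNorm Y n P ≤ momentConst n * (c : ℝ≥0∞) ^ (1 / 2 : ℝ) := by
  rcases eq_or_ne c 0 with rfl | hc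
  · rw [eLpNorm_congr_ae h.ae_eq_zero_of_hasSubgaussianMGF_zero]
    simp
  have hc' : 0 < (c : ℝ) := by positivity
  set s := √(c : ℝ) with hs
  have hs0 : 0 < s := Real.sqrt_pos.2 hc'
  have hs2 : s ^ 2 = c := Real.sq_sqrt hc'.le
  have hsE : (c : ℝ≥0∞) ^ (1 / 2 : ℝ) = ENNReal.ofReal s := by
    rw [hs, Real.sqrt_eq_rpow, ← ENNReal.ofReal_rpow_of_pos hc', ENNReal.ofReal_coe_nnreal]
  have hpt : ∀ ω, ‖Y ω‖ₑ ^ n ≤ ENNReal.ofReal (s ^ n * n.factorial *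
      (Real.exp (s⁻¹ * Y ω) + Real.exp (-s⁻¹ * Y ω))) := by
    intro ω
    rw [Real.enorm_eq_ofReal_abs, ← ENNReal.ofReal_pow (abs_nonneg _)]
    refine ENNReal.ofReal_le_ofReal ?_
    have h1 := Real.pow_div_factorial_le_exp (|s⁻¹ * Y ω|) (abs_nonneg _) n
    rw [div_le_iff₀ (by positivity)] at h1
    have h2 : Real.exp |s⁻¹ * Y ω| ≤ Real.exp (s⁻¹ * Y ω) + Real.exp (-s⁻¹ * Y ω) := by
      rw [neg_mul]
      rcases abs_choice (s⁻¹ * Y ω) with h | h <;> rw [h] <;>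
        linarith [Real.exp_pos (s⁻¹ * Y ω), Real.exp_pos (-(s⁻¹ * Y ω))]
    have h3 : |Y ω| ^ n = s ^ n * |s⁻¹ * Y ω| ^ n := by
      rw [abs_mul, abs_of_pos (inv_pos.2 hs0), mul_pow, ← mul_assoc, ← mul_pow,
        mul_inv_cancel₀ hs0.ne', one_pow, one_mul]
    rw [h3, mul_assoc]
    refine mul_le_mul_of_nonneg_left (h1.trans ?_) (by positivity)
    rw [mul_comm]
    exact mul_le_mul_of_nonneg_left h2 (by positivity)
  have hint := ((h.integrable_exp_mul s⁻¹).add (h.integrable_exp_mul (-s⁻¹))).const_mul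
    (s ^ n * n.factorial)
  have hval : ∫ ω, s ^ n * n.factorial * (Real.exp (s⁻¹ * Y ω) + Real.exp (-s⁻¹ * Y ω)) ∂P
      ≤ s ^ n * (n.factorial * (2 * Real.exp (1 / 2))) := by
    rw [integral_const_mul, integral_add (h.integrable_exp_mul _) (h.integrable_exp_mul _),
      mul_assoc]
    have e1 := h.mgf_le s⁻¹
    have e2 := h.mgf_le (-s⁻¹)
    have e3 : (c : ℝ) * s⁻¹ ^ 2 / 2 = 1 / 2 := by
      rw [← hs2]; field_simp
    rw [neg_sq, e3] at e2
    rw [e3] at e1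
    simp only [mgf] at e1 e2
    gcongr
    linarith
  rw [eLpNorm_eq_lintegral_rpow_enorm_toReal (by simpa using hn) (by simp)]
  simp only [ENNReal.toReal_natCast, ENNReal.rpow_natCast]
  calc (∫⁻ ω, ‖Y ω‖ₑ ^ n ∂P) ^ (1 / (n : ℝ))
      ≤ (ENNReal.ofReal (s ^ n * (n.factorial * (2 * Real.exp (1 / 2))))) ^ (1 / (n : ℝ)) := by
        gcongr
        refine (lintegral_mono hpt).trans ?_
        have h4 := ofReal_integral_eq_lintegral_ofReal hint
          (Eventually.of_forall fun ω => by simp only [Pi.add_apply, Pi.zero_apply]; positivity)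
        simp only [Pi.add_apply] at h4
        rw [← h4]
        exact ENNReal.ofReal_le_ofReal hval
    _ = momentConst n * (c : ℝ≥0∞) ^ (1 / 2 : ℝ) := by
        rw [hsE, momentConst, ENNReal.ofReal_mul (by positivity),
          ENNReal.mul_rpow_of_nonneg _ _ (by positivity), ENNReal.ofReal_pow hs0.le,
          ← ENNReal.rpow_natCast, ← ENNReal.rpow_mul, mul_one_div_cancel (by positivity),
          ENNReal.rpow_one, mul_comm]

theorem hasSubgaussianMGF_brownian_sub {P : Measure Ω} {B : ℝ≥0 → Ω → ℝ}
    (hB : IsPreBrownianReal B P) (s h : ℝ≥0) :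
    HasSubgaussianMGF (fun ω => B (s + h) ω - B s ω) h P := by
  have hl := hB.hasLaw_sub (s + h) s
  have hv : nndist (s + h).1 s.1 = h := by
    ext
    simp
  rw [hv] at hl
  refine ⟨fun t => ?_, fun t => ?_⟩
  · have := integrable_exp_mul_gaussianReal (μ := 0) (v := h) t
    rw [← hl.map_eq, integrable_map_measure (by fun_prop) hl.aemeasurable] at this
    exact this
  · refine (mgf_gaussianReal (p := P) (X := fun ω => B (s + h) ω - B s ω) hl.map_eq t).le.trans ?_
    simp

/-- Independence is used twice: between the increments of one path, and between the paths. Both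
times the variance proxies add up. -/
theorem hasSubgaussianMGF_sum_increments {P : Measure Ω} {β : ℕ → ℝ≥0 → Ω → ℝ}
    (hβ : IsIndepWiener P β) (s h : ℝ≥0) (K : ℕ) (S : Finset ℕ) (a d : ℕ → ℝ) :
    HasSubgaussianMGF (fun ω => ∑ i ∈ S, a i * ∑ k ∈ Finset.range K,
        d k * (β i (s + k * h + h) ω - β i (s + k * h) ω))
      ((∑ i ∈ S, ‖a i‖₊ ^ 2) * ∑ k ∈ Finset.range K, ‖d k‖₊ ^ 2 * h) P := by
  have hmul : ∀ (x : ℝ) (c : ℝ≥0) (X : Ω → ℝ), HasSubgaussianMGF X c P →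
      HasSubgaussianMGF (fun ω => x * X ω) (‖x‖₊ ^ 2 * c) P := fun x c X hX => by
    have he : ∀ t, (fun ω => Real.exp (t * (x * X ω))) = fun ω => Real.exp (t * x * X ω) :=
      fun t => by simp_rw [mul_assoc]
    refine ⟨fun t => ?_, fun t => ?_⟩
    · rw [he]
      exact hX.integrable_exp_mul _
    · have h := hX.mgf_le (t * x)
      rw [mgf, ← he] at h
      refine h.trans (Real.exp_le_exp.2 (le_of_eq ?_))
      rw [NNReal.coe_mul, NNReal.coe_pow, coe_nnnorm, Real.norm_eq_abs, sq_abs]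
      ring
  have htime : ∀ k : ℕ, s + ((k + 1 : ℕ) : ℝ≥0) * h = s + k * h + h := fun k => by
    push_cast
    ring
  have h1 : ∀ i, HasSubgaussianMGF (fun ω => a i * ∑ k ∈ Finset.range K,
        d k * (β i (s + k * h + h) ω - β i (s + k * h) ω))
      (‖a i‖₊ ^ 2 * ∑ k ∈ Finset.range K, ‖d k‖₊ ^ 2 * h) P := by
    intro i
    refine hmul _ _ _ ?_
    have hi := (hβ.brownian i).toIsPreBrownianReal.hasIndepIncrements.nat
      (t := fun k : ℕ => s + k * h) (fun k l hkl => by dsimp only; gcongr)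
    have hi2 := hi.comp (fun k x => d k * x) (fun k => by fun_prop)
    refine HasSubgaussianMGF.congr (X := fun ω => ∑ k ∈ Finset.range K,
      ((fun x => d k * x) ∘ fun ω => β i (s + (k + 1 : ℕ) * h) ω - β i (s + k * h) ω) ω)
      (HasSubgaussianMGF.sum_of_iIndepFun hi2 fun k _ => ?_) (ae_of_all _ fun ω => ?_)
    · refine hmul _ _ _ ?_
      have := hasSubgaussianMGF_brownian_sub (hβ.brownian i).toIsPreBrownianReal (s + k * h) h
      rwa [← htime] at this
    · refine Finset.sum_congr rfl fun k _ => ?_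
      simp only [Function.comp, htime]
  have hi := hβ.indep.comp (fun i (b : ℝ≥0 → ℝ) => a i * ∑ k ∈ Finset.range K,
        d k * (b (s + k * h + h) - b (s + k * h))) (fun i => by fun_prop)
  rw [Finset.sum_mul]
  exact HasSubgaussianMGF.sum_of_iIndepFun hi fun i _ => h1 i

/-! ### Minkowski's inequality for fractional norms of random vectors -/

/-- The finite Minkowski inequality passes to the limit by Fatou's lemma. -/
theorem eLpNorm_tsum_le {P : Measure Ω} {n : ℕ} (hn : n ≠ 0) {f : ℕ → Ω → ℝ≥0∞}
    (hf : ∀ p, Measurable (f p)) :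
    eLpNorm (fun ω => ∑' p, f p ω) n P ≤ ∑' p, eLpNorm (f p) n P := by
  have hn0 : (n : ℝ≥0∞) ≠ 0 := by simpa using hn
  have hn1 : (1 : ℝ≥0∞) ≤ n := by exact_mod_cast Nat.one_le_iff_ne_zero.2 hn
  have hfin : ∀ N, eLpNorm (fun ω => ∑ p ∈ Finset.range N, f p ω) n P ≤
      ∑' p, eLpNorm (f p) n P := fun N => by
    have h1 := eLpNorm_sum_le (μ := P) (p := n) (s := Finset.range N) (f := f)
      (fun p _ => (hf p).aestronglyMeasurable) hn1
    have h2 : (∑ p ∈ Finset.range N, f p) = fun ω => ∑ p ∈ Finset.range N, f p ω := by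
      ext ω; simp
    rw [h2] at h1
    exact h1.trans (ENNReal.sum_le_tsum _)
  rw [eLpNorm_eq_lintegral_rpow_enorm_toReal hn0 (by simp)]
  simp only [ENNReal.toReal_natCast, enorm_eq_self]
  have hnpos : (0 : ℝ) < n := by positivity
  rw [one_div, ENNReal.rpow_inv_le_iff hnpos]
  have hlim : ∀ ω, (∑' p, f p ω) ^ (n : ℝ) =
      liminf (fun N => (∑ p ∈ Finset.range N, f p ω) ^ (n : ℝ)) atTop := fun ω =>
    (((ENNReal.continuous_rpow_const (y := (n : ℝ))).tendsto _).comp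
      (ENNReal.tendsto_nat_tsum fun p => f p ω)).liminf_eq.symm
  simp_rw [hlim]
  refine (lintegral_liminf_le fun N => by fun_prop).trans ?_
  refine liminf_le_of_le (by isBoundedDefault) fun b hb => ?_
  obtain ⟨N, hN⟩ := hb.exists
  refine hN.trans ?_
  have := hfin N
  rw [eLpNorm_eq_lintegral_rpow_enorm_toReal hn0 (by simp)] at this
  simpa only [ENNReal.toReal_natCast, enorm_eq_self, one_div, ENNReal.rpow_inv_le_iff hnpos]
    using this

/-- Minkowski's inequality in `L^n` is applied to the series `|Y|_r² = ∑_p λ_p^{2r} ⟨Y, e_p⟩²`,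
since the `L^n` norm of a square is the squared `L^{2n}` norm. Hence the even exponent. -/
theorem eLpNorm_fracNorm_le {P : Measure Ω} {n : ℕ} (hn : n ≠ 0) (r : ℝ) {Y : Ω → H}
    (hY : StronglyMeasurable Y) {C : ℝ≥0∞} {v : ℕ → ℝ≥0∞}
    (h : ∀ p, eLpNorm (fun ω => (inner ℝ (eigvec p) (Y ω) : ℝ)) ((2 * n : ℕ) : ℝ≥0∞) P
      ≤ C * v p ^ (1 / 2 : ℝ)) :
    eLpNorm (fun ω => fracNorm r (Y ω)) ((2 * n : ℕ) : ℝ≥0∞) P ≤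
      C * (∑' p, ENNReal.ofReal (eigval p ^ (2 * r)) * v p) ^ (1 / 2 : ℝ) := by
  have hcoef : ∀ p, Measurable fun ω => (inner ℝ (eigvec p) (Y ω) : ℝ) := fun p =>
    (stronglyMeasurable_const.inner hY).measurable
  have h2n : ((2 * n : ℕ) : ℝ≥0∞) = n * ENNReal.ofReal 2 := by
    push_cast
    rw [mul_comm]
    norm_num
  have hsq : ∀ x : ℝ≥0∞, x = (x ^ (2 : ℝ)) ^ (1 / 2 : ℝ) := fun x => by
    rw [← ENNReal.rpow_mul]; norm_num
  rw [hsq (eLpNorm _ _ _), hsq C, ← ENNReal.mul_rpow_of_nonneg _ _ (by norm_num), h2n,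
    ← eLpNorm_enorm_rpow _ zero_lt_two]
  refine ENNReal.rpow_le_rpow ?_ (by norm_num)
  simp only [enorm_eq_self, fracNorm_sq]
  refine (eLpNorm_tsum_le hn fun p =>
    (((hcoef p).pow_const 2).const_mul _).ennreal_ofReal).trans ?_
  rw [← ENNReal.tsum_mul_left]
  refine ENNReal.tsum_le_tsum fun p => ?_
  have hp := eigval_pos p
  have h1 : ∀ ω, ENNReal.ofReal (eigval p ^ (2 * r) * (inner ℝ (eigvec p) (Y ω) : ℝ) ^ 2) =
      ((ENNReal.ofReal (eigval p ^ (2 * r))).toNNReal : ℝ≥0) •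
        (‖(inner ℝ (eigvec p) (Y ω) : ℝ)‖ₑ ^ (2 : ℝ)) := fun ω => by
    rw [ENNReal.ofReal_mul (by positivity), ENNReal.smul_def, smul_eq_mul,
      ENNReal.coe_toNNReal ENNReal.ofReal_ne_top, Real.enorm_eq_ofReal_abs, ENNReal.rpow_two,
      ← ENNReal.ofReal_pow (abs_nonneg _), sq_abs]
  simp_rw [h1]
  have h3 : eLpNorm (fun ω => ‖(inner ℝ (eigvec p) (Y ω) : ℝ)‖ₑ ^ (2 : ℝ)) n P ≤
      C ^ (2 : ℝ) * v p := by
    rw [eLpNorm_enorm_rpow _ zero_lt_two, ← h2n]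
    calc _ ≤ (C * v p ^ (1 / 2 : ℝ)) ^ (2 : ℝ) := ENNReal.rpow_le_rpow (h p) (by norm_num)
      _ = C ^ (2 : ℝ) * v p := by
        rw [ENNReal.mul_rpow_of_nonneg _ _ (by norm_num), ← ENNReal.rpow_mul]
        norm_num
  refine (eLpNorm_le_nnreal_smul_eLpNorm_of_ae_le_mul' (p := n)
    (c := (ENNReal.ofReal (eigval p ^ (2 * r))).toNNReal)
    (g := fun ω => ‖(inner ℝ (eigvec p) (Y ω) : ℝ)‖ₑ ^ (2 : ℝ)) (ae_of_all _ fun ω => ?_)).trans ?_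
  · simp [ENNReal.smul_def]
  · rw [ENNReal.smul_def, smul_eq_mul, ENNReal.coe_toNNReal ENNReal.ofReal_ne_top]
    calc _ ≤ ENNReal.ofReal (eigval p ^ (2 * r)) * (C ^ (2 : ℝ) * v p) := by gcongr
      _ = _ := by ring

end

end Parareal

namespace Parareal

noncomputable section

variable {Ω : Type*} [MeasurableSpace Ω]

/-! ### The covariance operator in coordinates -/

/-- The variance of the noise along the mode `p`. -/
def noiseVar (γ : ℕ → ℝ) (ε : HilbertBasis ℕ ℝ H) (p : ℕ) : ℝ≥0∞ :=
  ∑' i, ENNReal.ofReal (γ i * (inner ℝ (eigvec p) (ε i) : ℝ) ^ 2)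

theorem sqrtQ_apply_basis (γ : ℕ → ℝ) (ε : HilbertBasis ℕ ℝ H) (i : ℕ) :
    sqrtQ γ ε (ε i) = √(γ i) • ε i := by
  rw [sqrtQ, tsum_eq_single i]
  · simp [ε.orthonormal.norm_eq_one]
  · intro j hj
    rw [ε.orthonormal.inner_eq_zero hj]
    simp

theorem hsNormSq_eq (r : ℝ) {γ : ℕ → ℝ} (hγ : ∀ p, 0 ≤ γ p) (ε : HilbertBasis ℕ ℝ H) :
    hsNormSq r γ ε = ∑' p, ENNReal.ofReal (eigval p ^ (2 * r)) * noiseVar γ ε p := by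
  simp_rw [hsNormSq, ← ENNReal.rpow_two, fracNorm_sq, sqrtQ_apply_basis, noiseVar,
    ← ENNReal.tsum_mul_left]
  rw [ENNReal.tsum_comm]
  refine tsum_congr fun p => tsum_congr fun i => ?_
  have hp := eigval_pos p
  rw [inner_smul_right, mul_pow, Real.sq_sqrt (hγ i), ENNReal.ofReal_mul (by positivity)]

theorem hsNormSq_mono {r s : ℝ} (h : r ≤ s) (γ : ℕ → ℝ) (ε : HilbertBasis ℕ ℝ H) :
    hsNormSq r γ ε ≤ hsNormSq s γ ε := by
  unfold hsNormSq
  gcongr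
  exact fracNorm_mono h _

/-! ### Sums of a singular kernel -/

/-- Concavity of `y ↦ y^{1-b}`: the graph lies below its tangent at `x + h`, which is Bernoulli's
inequality. -/
theorem rpow_add_mul_le_rpow {x h b : ℝ} (hx : 0 ≤ x) (hh : 0 < h) (hb₀ : 0 ≤ b) (hb₁ : b < 1) :
    x ^ (1 - b) + (1 - b) * ((x + h) ^ (-b) * h) ≤ (x + h) ^ (1 - b) := by
  set y := x + h with hy
  have hy0 : 0 < y := by positivity
  have h1 := rpow_one_add_le_one_add_mul_self (s := x / y - 1)
    (by have : 0 ≤ x / y := by positivity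
        linarith) (p := 1 - b) (by linarith) (by linarith)
  rw [add_sub_cancel, Real.div_rpow hx hy0.le, div_le_iff₀ (by positivity)] at h1
  have h2 : y ^ (1 - b) = y * y ^ (-b) := by
    rw [sub_eq_add_neg, Real.rpow_add hy0, Real.rpow_one]
  have h3 : (x / y - 1) * y ^ (1 - b) = -(y ^ (-b) * h) := by
    rw [h2]
    field_simp
    rw [hy]
    ring
  nlinarith [h1, h3]

/-- The right-endpoint Riemann sum of the decreasing function `t^{-b}` lies below its integral. The
node `t = 0` never occurs, as every step of the scheme applies the semigroup at least once. -/
theorem sum_rpow_neg_mul_le {h b : ℝ} (hh : 0 < h) (hb₀ : 0 ≤ b) (hb₁ : b < 1) (K : ℕ) :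
    ∑ k ∈ Finset.range K, (((K - k : ℕ) : ℝ) * h) ^ (-b) * h ≤ ((K : ℝ) * h) ^ (1 - b) / (1 - b) := by
  have hb : 0 < 1 - b := by linarith
  have h1 : ∑ k ∈ Finset.range K, (((k + 1 : ℕ) : ℝ) * h) ^ (-b) * h ≤
      ((K : ℝ) * h) ^ (1 - b) / (1 - b) := by
    induction K with
    | zero => simp [Real.zero_rpow hb.ne']
    | succ K ih =>
      rw [Finset.sum_range_succ]
      rw [le_div_iff₀ hb] at ih ⊢
      have := rpow_add_mul_le_rpow (x := K * h) (by positivity) hh hb₀ hb₁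
      have e : (K : ℝ) * h + h = ((K + 1 : ℕ) : ℝ) * h := by push_cast; ring
      rw [e] at this
      linarith
  refine le_of_eq_of_le ?_ h1
  rw [← Finset.sum_range_reflect]
  refine Finset.sum_congr rfl fun k hk => ?_
  have : K - (K - 1 - k) = k + 1 := by
    have := Finset.mem_range.1 hk
    omega
  rw [this]

/-! ### Convergence of the noise series -/

/-- The truncated noise increment smoothed by `e^{hA}`. -/
def truncIncr (γ : ℕ → ℝ) (ε : HilbertBasis ℕ ℝ H) (β : ℕ → ℝ≥0 → Ω → ℝ) (m : ℕ) (h s t : ℝ≥0)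
    (ω : Ω) : H :=
  ∑ i ∈ Finset.range m, (√(γ i) * (β i t ω - β i s ω)) • heat h (ε i)

variable {P : Measure Ω} [IsProbabilityMeasure P] {γ : ℕ → ℝ} {ε : HilbertBasis ℕ ℝ H}
  {β : ℕ → ℝ≥0 → Ω → ℝ}

theorem stronglyMeasurable_sum_smul {P : Measure Ω} (hβ : IsIndepWiener P β) (S : Finset ℕ) (h s t : ℝ≥0) :
    StronglyMeasurable fun ω => ∑ i ∈ S, (√(γ i) * (β i t ω - β i s ω)) • heat h (ε i) := by
  refine Finset.stronglyMeasurable_fun_sum _ fun i _ => ?_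
  exact StronglyMeasurable.smul_const
    (((hβ.measurable i t).sub (hβ.measurable i s)).const_mul _).stronglyMeasurable _

theorem eLpNorm_inner_sum_increments_le (hβ : IsIndepWiener P β) (hγ : ∀ p, 0 ≤ γ p) {n : ℕ}
    (hn : n ≠ 0) (p : ℕ) (S : Finset ℕ) (s h : ℝ≥0) (K : ℕ) (d : ℕ → ℝ) :
    eLpNorm (fun ω => ∑ i ∈ S, √(γ i) * (inner ℝ (eigvec p) (ε i) : ℝ) *
        ∑ k ∈ Finset.range K, d k * (β i (s + k * h + h) ω - β i (s + k * h) ω)) n P ≤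
      momentConst n * ((∑ i ∈ S, ENNReal.ofReal (γ i * (inner ℝ (eigvec p) (ε i) : ℝ) ^ 2)) *
        ∑ k ∈ Finset.range K, ENNReal.ofReal (d k ^ 2 * h)) ^ (1 / 2 : ℝ) := by
  refine (eLpNorm_le_of_hasSubgaussianMGF (hasSubgaussianMGF_sum_increments hβ s h K S _ d)
    hn).trans (le_of_eq ?_)
  have hsq : ∀ x : ℝ, ((‖x‖₊ : ℝ≥0∞)) ^ 2 = ENNReal.ofReal (x ^ 2) := fun x => by
    rw [← enorm_eq_nnnorm, Real.enorm_eq_ofReal_abs, ← ENNReal.ofReal_pow (abs_nonneg _), sq_abs]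
  congr 2
  push_cast
  simp_rw [hsq]
  congr 1
  · refine Finset.sum_congr rfl fun i _ => ?_
    rw [mul_pow, Real.sq_sqrt (hγ i)]
  · refine Finset.sum_congr rfl fun i _ => ?_
    rw [ENNReal.ofReal_mul (sq_nonneg _), ENNReal.ofReal_coe_nnreal]

theorem inner_sum_smul_heat {Ω : Type*} {β : ℕ → ℝ≥0 → Ω → ℝ} (S : Finset ℕ) (h s : ℝ≥0) (p : ℕ) (ω : Ω) :
    (inner ℝ (eigvec p) (∑ i ∈ S, (√(γ i) * (β i (s + h) ω - β i s ω)) • heat h (ε i)) : ℝ) =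
      ∑ i ∈ S, √(γ i) * (inner ℝ (eigvec p) (ε i) : ℝ) * ∑ k ∈ Finset.range 1,
        Real.exp (-eigval p * h) * (β i (s + k * h + h) ω - β i (s + k * h) ω) := by
  rw [inner_sum]
  refine Finset.sum_congr rfl fun i _ => ?_
  rw [inner_smul_right, heat_eq, inner_heatL]
  simp
  ring

/-- Second moments of the smoothed noise series. -/
def smoothedTerm (γ : ℕ → ℝ) (ε : HilbertBasis ℕ ℝ H) (h : ℝ≥0) (i : ℕ) : ℝ≥0∞ :=
  ∑' p, ENNReal.ofReal (γ i * (inner ℝ (eigvec p) (ε i) : ℝ) ^ 2) *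
    ENNReal.ofReal (Real.exp (-eigval p * h) ^ 2 * h)

theorem eLpNorm_sum_smul_heat_le (hβ : IsIndepWiener P β) (hγ : ∀ p, 0 ≤ γ p) (S : Finset ℕ)
    (s h : ℝ≥0) :
    eLpNorm (fun ω => ∑ i ∈ S, (√(γ i) * (β i (s + h) ω - β i s ω)) • heat h (ε i)) 2 P ≤
      momentConst 2 * (∑ i ∈ S, smoothedTerm γ ε h i) ^ (1 / 2 : ℝ) := by
  have := eLpNorm_fracNorm_le (P := P) one_ne_zero 0
    (stronglyMeasurable_sum_smul (γ := γ) (ε := ε) hβ S h s (s + h))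
    (C := momentConst 2) (v := fun p =>
      (∑ i ∈ S, ENNReal.ofReal (γ i * (inner ℝ (eigvec p) (ε i) : ℝ) ^ 2)) *
        ENNReal.ofReal (Real.exp (-eigval p * h) ^ 2 * h)) fun p => by
      simp_rw [inner_sum_smul_heat]
      have := eLpNorm_inner_sum_increments_le (P := P) (ε := ε) hβ hγ two_ne_zero p S s h 1
        (fun _ => Real.exp (-eigval p * h))
      simpa using this
  simp only [fracNorm_zero_left, eLpNorm_enorm] at this
  refine le_of_le_of_eq (by simpa using this) ?_
  congr 2
  · simp_rw [smoothedTerm]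
    rw [← Summable.tsum_finsetSum fun _ _ => ENNReal.summable]
    simp [Finset.sum_mul]
  · norm_num

/-- The factor `e^{-2λh}` is at most `(2h)^{-(1-2a)} λ^{2(a-1/2)}`, which is the weight in the
Hilbert–Schmidt norm. -/
theorem tsum_smoothedTerm_lt_top (hγ : ∀ p, 0 ≤ γ p) {a : ℝ} (ha₀ : 0 < a) (ha₁ : a ≤ 1 / 2)
    (hQ : hsNormSq (a - 1 / 2) γ ε < ∞) {h : ℝ≥0} (hh : 0 < h) :
    ∑' i, smoothedTerm γ ε h i < ∞ := by
  have hh' : (0 : ℝ) < h := hh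
  have h1 : ∑' i, smoothedTerm γ ε h i ≤
      ENNReal.ofReal ((2 * h) ^ (-(1 - 2 * a)) * h) * hsNormSq (a - 1 / 2) γ ε := by
    rw [hsNormSq_eq _ hγ, ← ENNReal.tsum_mul_left]
    simp_rw [smoothedTerm]
    rw [ENNReal.tsum_comm]
    refine ENNReal.tsum_le_tsum fun p => ?_
    rw [ENNReal.tsum_mul_right, mul_comm, ← noiseVar, ← mul_assoc]
    refine mul_le_mul_left ?_ _
    have hp := eigval_pos p
    rw [← ENNReal.ofReal_mul (by positivity)]
    refine ENNReal.ofReal_le_ofReal ?_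
    have := exp_neg_mul_le_rpow (b := 1 - 2 * a) hp (mul_pos two_pos hh') (by linarith)
      (by linarith)
    have e1 : Real.exp (-eigval p * h) ^ 2 = Real.exp (-eigval p * (2 * h)) := by
      rw [← Real.exp_nat_mul]; push_cast; ring_nf
    have e2 : (2 : ℝ) * (a - 1 / 2) = -(1 - 2 * a) := by ring
    rw [e1, e2]
    nlinarith
  exact h1.trans_lt (ENNReal.mul_lt_top ENNReal.ofReal_lt_top hQ)

/-- The partial sums are Cauchy in `L²(Ω;H)`, controlled by the tails of a convergent series of
variances. Consequently `smoothedIncrement` is the true limit and not its default value `0`. -/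
theorem exists_smoothedIncrement (hβ : IsIndepWiener P β) (hγ : ∀ p, 0 ≤ γ p) {a : ℝ}
    (ha₀ : 0 < a) (ha₁ : a ≤ 1 / 2) (hQ : hsNormSq (a - 1 / 2) γ ε < ∞) {h : ℝ≥0} (hh : 0 < h)
    (s : ℝ≥0) :
    ∃ X : Ω → H, StronglyMeasurable X ∧
      Tendsto (fun m : ℕ => eLpNorm (fun ω => ∑ p ∈ Finset.range m,
        (√(γ p) * (β p (s + h) ω - β p s ω)) • heat h (ε p) - X ω) 2 P) atTop (𝓝 0) := by
  have htop := tsum_smoothedTerm_lt_top hγ ha₀ ha₁ hQ hh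
  have hmem : ∀ m, MemLp (truncIncr γ ε β m h s (s + h)) 2 P := fun m =>
    ⟨(stronglyMeasurable_sum_smul hβ _ h s (s + h)).aestronglyMeasurable,
      (eLpNorm_sum_smul_heat_le hβ hγ _ s h).trans_lt (ENNReal.mul_lt_top
        (momentConst_ne_top 2).lt_top (ENNReal.rpow_lt_top_of_nonneg (by norm_num)
          ((ENNReal.sum_le_tsum _).trans_lt htop).ne))⟩
  have hle : ∀ N n m : ℕ, N ≤ n → n ≤ m → eLpNorm (truncIncr γ ε β m h s (s + h) -
      truncIncr γ ε β n h s (s + h)) 2 P ≤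
      momentConst 2 * (∑' i, smoothedTerm γ ε h (i + N)) ^ (1 / 2 : ℝ) := by
    intro N n m hN hnm
    have he : truncIncr γ ε β m h s (s + h) - truncIncr γ ε β n h s (s + h) =
        fun ω => ∑ i ∈ Finset.Ico n m, (√(γ i) * (β i (s + h) ω - β i s ω)) • heat h (ε i) := by
      ext1 ω
      rw [Pi.sub_apply, truncIncr, truncIncr, Finset.sum_Ico_eq_sub _ hnm]
    rw [he]
    refine (eLpNorm_sum_smul_heat_le hβ hγ _ s h).trans ?_
    gcongr
    have h1 : ∑ i ∈ Finset.Ico n m, smoothedTerm γ ε h i ≤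
        ∑ i ∈ Finset.Ico N m, smoothedTerm γ ε h i :=
      Finset.sum_le_sum_of_subset (Finset.Ico_subset_Ico_left hN)
    refine h1.trans ?_
    rw [Finset.sum_Ico_eq_sum_range]
    simp_rw [add_comm N]
    exact ENNReal.sum_le_tsum _
  have hc : CauchySeq fun m => (hmem m).toLp := by
    rw [EMetric.cauchySeq_iff_le_tendsto_0]
    refine ⟨fun N => momentConst 2 * (∑' i, smoothedTerm γ ε h (i + N)) ^ (1 / 2 : ℝ), ?_, ?_⟩
    · intro n m N hn hm
      rcases le_total n m with h | h
      · rw [edist_comm, Lp.edist_toLp_toLp]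
        exact hle N n m hn h
      · rw [Lp.edist_toLp_toLp]
        exact hle N m n hm h
    · have h1 := ENNReal.tendsto_sum_nat_add _ htop.ne
      have h2 := (ENNReal.continuous_rpow_const (y := (1 / 2 : ℝ))).tendsto 0
      rw [ENNReal.zero_rpow_of_pos (by norm_num)] at h2
      have h3 := ENNReal.Tendsto.const_mul (h2.comp h1) (Or.inr (momentConst_ne_top 2))
      rwa [mul_zero] at h3
  obtain ⟨g, hg⟩ := cauchySeq_tendsto_of_complete hc
  refine ⟨g, Lp.stronglyMeasurable g, ?_⟩
  rw [tendsto_iff_edist_tendsto_0] at hg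
  refine hg.congr fun m => ?_
  rw [Lp.edist_def]
  refine eLpNorm_congr_ae ?_
  filter_upwards [(hmem m).coeFn_toLp] with ω hω
  rw [Pi.sub_apply, hω, truncIncr]

theorem stronglyMeasurable_smoothedIncrement (P : Measure Ω) (γ : ℕ → ℝ) (ε : HilbertBasis ℕ ℝ H)
    (β : ℕ → ℝ≥0 → Ω → ℝ) (h s t : ℝ≥0) :
    StronglyMeasurable (smoothedIncrement P γ ε β h s t) := by
  unfold smoothedIncrement
  split_ifs with hX
  · exact hX.choose_spec.1
  · exact stronglyMeasurable_zero

theorem tendsto_smoothedIncrement (hβ : IsIndepWiener P β) (hγ : ∀ p, 0 ≤ γ p) {a : ℝ}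
    (ha₀ : 0 < a) (ha₁ : a ≤ 1 / 2) (hQ : hsNormSq (a - 1 / 2) γ ε < ∞) {h : ℝ≥0} (hh : 0 < h)
    (s : ℝ≥0) :
    Tendsto (fun m : ℕ => eLpNorm (truncIncr γ ε β m h s (s + h) -
      smoothedIncrement P γ ε β h s (s + h)) 2 P) atTop (𝓝 0) := by
  have hX := exists_smoothedIncrement hβ hγ ha₀ ha₁ hQ hh s
  have : smoothedIncrement P γ ε β h s (s + h) = hX.choose := by
    rw [smoothedIncrement, dif_pos hX]
  rw [this]
  exact hX.choose_spec.2

end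

end Parareal

namespace Parareal

noncomputable section

variable {Ω : Type*} [MeasurableSpace Ω]

/-! ### Discrete stochastic convolutions -/

/-- The stochastic convolution of the exponential Euler scheme of step `h` started at time `s`. -/
def stochConv (P : Measure Ω) (γ : ℕ → ℝ) (ε : HilbertBasis ℕ ℝ H) (β : ℕ → ℝ≥0 → Ω → ℝ)
    (h s : ℝ≥0) : ℕ → Ω → H
  | 0 => 0
  | j + 1 => fun ω => heatL h (stochConv P γ ε β h s j ω) +
      smoothedIncrement P γ ε β h (s + j * h) (s + j * h + h) ω

/-- The stochastic convolution driven by the truncated noise. -/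
def truncConv (γ : ℕ → ℝ) (ε : HilbertBasis ℕ ℝ H) (β : ℕ → ℝ≥0 → Ω → ℝ) (m : ℕ)
    (h s : ℝ≥0) : ℕ → Ω → H
  | 0 => 0
  | j + 1 => fun ω => heatL h (truncConv γ ε β m h s j ω) +
      truncIncr γ ε β m h (s + j * h) (s + j * h + h) ω

theorem stronglyMeasurable_stochConv (P : Measure Ω) (γ : ℕ → ℝ) (ε : HilbertBasis ℕ ℝ H)
    (β : ℕ → ℝ≥0 → Ω → ℝ) (h s : ℝ≥0) (j : ℕ) : StronglyMeasurable (stochConv P γ ε β h s j) := by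
  induction j with
  | zero => exact stronglyMeasurable_zero
  | succ j ih =>
    exact ((heatL h).continuous.comp_stronglyMeasurable ih).add
      (stronglyMeasurable_smoothedIncrement P γ ε β _ _ _)

variable {P : Measure Ω} {γ : ℕ → ℝ} {ε : HilbertBasis ℕ ℝ H} {β : ℕ → ℝ≥0 → Ω → ℝ}

theorem stronglyMeasurable_truncConv (hβ : IsIndepWiener P β) (m : ℕ) (h s : ℝ≥0) (j : ℕ) :
    StronglyMeasurable (truncConv γ ε β m h s j) := by
  induction j with
  | zero => exact stronglyMeasurable_zero
  | succ j ih =>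
    exact ((heatL h).continuous.comp_stronglyMeasurable ih).add
      (stronglyMeasurable_sum_smul hβ _ _ _ _)

/-- The cocycle property, which relates the noise inside one coarse interval to a single convolution
started at time `0`. -/
theorem stochConv_add (h s : ℝ≥0) (i j : ℕ) (ω : Ω) :
    stochConv P γ ε β h s (i + j) ω = heatL (j * h) (stochConv P γ ε β h s i ω) +
      stochConv P γ ε β h (s + i * h) j ω := by
  induction j with
  | zero => simp [stochConv, heatL_zero]
  | succ j ih =>
    have e1 : s + ((i + j : ℕ) : ℝ≥0) * h = s + i * h + j * h := by push_cast; ring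
    have e2 : ((j + 1 : ℕ) : ℝ≥0) * h = h + j * h := by push_cast; ring
    rw [← add_assoc, stochConv, stochConv]
    beta_reduce
    rw [ih, e1, map_add, heatL_heatL, e2, add_assoc]

theorem tendsto_stochConv [IsProbabilityMeasure P] (hβ : IsIndepWiener P β) (hγ : ∀ p, 0 ≤ γ p)
    {a : ℝ} (ha₀ : 0 < a) (ha₁ : a ≤ 1 / 2) (hQ : hsNormSq (a - 1 / 2) γ ε < ∞) {h : ℝ≥0}
    (hh : 0 < h) (s : ℝ≥0) (j : ℕ) :
    Tendsto (fun m : ℕ => eLpNorm (truncConv γ ε β m h s j - stochConv P γ ε β h s j) 2 P)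
      atTop (𝓝 0) := by
  induction j with
  | zero => simp [truncConv, stochConv]
  | succ j ih =>
    have h2 := ih.add (tendsto_smoothedIncrement hβ hγ ha₀ ha₁ hQ hh (s + j * h))
    rw [add_zero] at h2
    refine tendsto_of_tendsto_of_tendsto_of_le_of_le tendsto_const_nhds h2 (fun _ => zero_le)
      fun m => ?_
    have hm1 := ((heatL h).continuous.comp_stronglyMeasurable
      ((stronglyMeasurable_truncConv (γ := γ) (ε := ε) hβ m h s j).sub
        (stronglyMeasurable_stochConv P γ ε β h s j)))
    have hm2 := (stronglyMeasurable_sum_smul (γ := γ) (ε := ε) hβ (Finset.range m) h (s + j * h)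
      (s + j * h + h)).sub
      (stronglyMeasurable_smoothedIncrement P γ ε β h (s + j * h) (s + j * h + h))
    have he : truncConv γ ε β m h s (j + 1) - stochConv P γ ε β h s (j + 1) =
        (fun ω => heatL h ((truncConv γ ε β m h s j - stochConv P γ ε β h s j) ω)) +
        (truncIncr γ ε β m h (s + j * h) (s + j * h + h) -
          smoothedIncrement P γ ε β h (s + j * h) (s + j * h + h)) := by
      ext1 ω
      simp only [truncConv, stochConv, Pi.sub_apply, Pi.add_apply, map_sub]
      abel
    rw [he]
    refine (eLpNorm_add_le hm1.aestronglyMeasurable hm2.aestronglyMeasurable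
      one_le_two).trans ?_
    exact add_le_add (eLpNorm_mono_enorm fun ω => enorm_heatL_le h _) le_rfl

theorem inner_truncIncr {Ω : Type*} {β : ℕ → ℝ≥0 → Ω → ℝ} (m : ℕ) (h s t : ℝ≥0) (p : ℕ) (ω : Ω) :
    (inner ℝ (eigvec p) (truncIncr γ ε β m h s t ω) : ℝ) =
      ∑ i ∈ Finset.range m, √(γ i) * (inner ℝ (eigvec p) (ε i) : ℝ) *
        (Real.exp (-eigval p * h) * (β i t ω - β i s ω)) := by
  rw [truncIncr, inner_sum]
  refine Finset.sum_congr rfl fun i _ => ?_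
  rw [inner_smul_right, heat_eq, inner_heatL]
  ring

theorem inner_truncConv {Ω : Type*} {β : ℕ → ℝ≥0 → Ω → ℝ} (m : ℕ) (h s : ℝ≥0) (j p : ℕ) (ω : Ω) :
    (inner ℝ (eigvec p) (truncConv γ ε β m h s j ω) : ℝ) =
      ∑ i ∈ Finset.range m, √(γ i) * (inner ℝ (eigvec p) (ε i) : ℝ) * ∑ k ∈ Finset.range j,
        Real.exp (-eigval p * ((j - k : ℕ) * h)) *
          (β i (s + k * h + h) ω - β i (s + k * h) ω) := by
  induction j with
  | zero => simp [truncConv]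
  | succ j ih =>
    rw [truncConv, inner_add_right, inner_heatL, ih, inner_truncIncr, Finset.mul_sum,
      ← Finset.sum_add_distrib]
    refine Finset.sum_congr rfl fun i _ => ?_
    rw [Finset.sum_range_succ, mul_add]
    congr 1
    · rw [mul_left_comm, Finset.mul_sum]
      congr 1
      refine Finset.sum_congr rfl fun k hk => ?_
      have : j + 1 - k = (j - k) + 1 := by
        have := Finset.mem_range.1 hk
        omega
      rw [this, ← mul_assoc, ← Real.exp_add]
      push_cast
      ring_nf
    · simp

/-- Splits each coarse increment into `J` fine ones with a common weight, so that coarse and fine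
convolutions become sums over the same independent increments. -/
theorem sum_range_mul_telescope (b : ℝ≥0 → ℝ) (c : ℕ → ℝ) (δ : ℝ≥0) {J : ℕ} (hJ : J ≠ 0) (N : ℕ) :
    ∑ n ∈ Finset.range N, c n * (b (0 + n * (J * δ) + J * δ) - b (0 + n * (J * δ))) =
      ∑ k ∈ Finset.range (N * J), c (k / J) * (b (0 + k * δ + δ) - b (0 + k * δ)) := by
  induction N with
  | zero => simp
  | succ N ih =>
    rw [Finset.sum_range_succ, ih, Nat.succ_mul, Finset.sum_range_add]
    congr 1
    have h1 : ∀ j ∈ Finset.range J, c ((N * J + j) / J) *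
        (b (0 + ((N * J + j : ℕ) : ℝ≥0) * δ + δ) - b (0 + ((N * J + j : ℕ) : ℝ≥0) * δ)) =
        c N * (b (N * (J * δ) + ((j + 1 : ℕ) : ℝ≥0) * δ) - b (N * (J * δ) + j * δ)) := by
      intro j hj
      have e : (N * J + j) / J = N := by
        rw [mul_comm, Nat.mul_add_div (Nat.pos_of_ne_zero hJ),
          Nat.div_eq_of_lt (Finset.mem_range.1 hj), add_zero]
      rw [e]
      congr 3 <;> push_cast <;> ring
    rw [Finset.sum_congr rfl h1, ← Finset.mul_sum,
      Finset.sum_range_sub (fun j : ℕ => b (N * (J * δ) + (j : ℝ≥0) * δ))]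
    simp

/-- A subsequence converges almost surely, and Fatou's lemma carries the bound to the limit. -/
theorem eLpNorm_inner_le_of_tendsto {n : ℕ} {Y : Ω → H} {Ym : ℕ → Ω → H}
    (hY : StronglyMeasurable Y) (hYm : ∀ m, StronglyMeasurable (Ym m))
    (hlim : Tendsto (fun m : ℕ => eLpNorm (Ym m - Y) 2 P) atTop (𝓝 0)) (e : H) {C : ℝ≥0∞}
    (hC : ∀ m, eLpNorm (fun ω => (inner ℝ e (Ym m ω) : ℝ)) n P ≤ C) :
    eLpNorm (fun ω => (inner ℝ e (Y ω) : ℝ)) n P ≤ C := by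
  obtain ⟨ns, -, hns⟩ := (tendstoInMeasure_of_tendsto_eLpNorm two_ne_zero
    (fun m => (hYm m).aestronglyMeasurable) hY.aestronglyMeasurable hlim).exists_seq_tendsto_ae
  refine Lp.eLpNorm_le_of_ae_tendsto (u := atTop)
    (f := fun k ω => (inner ℝ e (Ym (ns k) ω) : ℝ)) (Eventually.of_forall fun k => hC _)
    (fun k => (stronglyMeasurable_const.inner (hYm _)).aestronglyMeasurable) ?_
  filter_upwards [hns] with ω hω
  exact tendsto_const_nhds.inner hω

/-- The moment bound for stochastic convolutions, given their coefficients in the eigenbasis. -/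
theorem eLpNorm_fracNorm_convolution_le [IsProbabilityMeasure P] (hβ : IsIndepWiener P β)
    (hγ : ∀ p, 0 ≤ γ p) {n : ℕ} (hn : n ≠ 0) {Y : Ω → H} {Ym : ℕ → Ω → H}
    (hY : StronglyMeasurable Y) (hYm : ∀ m, StronglyMeasurable (Ym m))
    (hlim : Tendsto (fun m : ℕ => eLpNorm (Ym m - Y) 2 P) atTop (𝓝 0)) {s h : ℝ≥0} (hh : 0 < h)
    {K : ℕ} {d : ℕ → ℕ → ℝ}
    (hcoef : ∀ m p ω, (inner ℝ (eigvec p) (Ym m ω) : ℝ) =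
      ∑ i ∈ Finset.range m, √(γ i) * (inner ℝ (eigvec p) (ε i) : ℝ) * ∑ k ∈ Finset.range K,
        d p k * (β i (s + k * h + h) ω - β i (s + k * h) ω))
    {M ρ a r : ℝ}
    (hd : ∀ p, ∀ k < K, |d p k| ≤ M * eigval p ^ ρ * Real.exp (-eigval p * ((K - k : ℕ) * h)))
    (hη₀ : 0 < a - r - ρ) (hη₁ : a - r - ρ ≤ 1 / 2) :
    eLpNorm (fun ω => fracNorm r (Y ω)) ((2 * n : ℕ) : ℝ≥0∞) P ≤ momentConst (2 * n) *
      (ENNReal.ofReal (M ^ 2 * (((K : ℝ) * h) ^ (2 * (a - r - ρ)) / (2 * (a - r - ρ)))) *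
        hsNormSq (a - 1 / 2) γ ε) ^ (1 / 2 : ℝ) := by
  have hh' : (0 : ℝ) < h := hh
  set η := a - r - ρ with hη
  have h1 : ∀ p, eLpNorm (fun ω => (inner ℝ (eigvec p) (Y ω) : ℝ)) ((2 * n : ℕ) : ℝ≥0∞) P ≤
      momentConst (2 * n) * (noiseVar γ ε p *
        ∑ k ∈ Finset.range K, ENNReal.ofReal (d p k ^ 2 * h)) ^ (1 / 2 : ℝ) := fun p => by
    refine eLpNorm_inner_le_of_tendsto hY hYm hlim _ fun m => ?_
    simp_rw [hcoef]
    refine (eLpNorm_inner_sum_increments_le hβ hγ (by omega) p _ s h K (d p)).trans ?_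
    gcongr
    exact ENNReal.sum_le_tsum _
  refine (eLpNorm_fracNorm_le hn r hY h1).trans ?_
  gcongr
  rw [hsNormSq_eq _ hγ, ← ENNReal.tsum_mul_left]
  refine ENNReal.tsum_le_tsum fun p => ?_
  have hp := eigval_pos p
  -- Of the two factors `e^{-λt}` in the square, one is traded for `(tλ)^{-(1-2η)}` and the other is
  -- discarded. The exponent is chosen so that, with the weight `λ^{2r}`, the total power of `λ` is
  -- `2(a - 1/2)`.
  have hsum : ∑ k ∈ Finset.range K, d p k ^ 2 * h ≤
      M ^ 2 * eigval p ^ (2 * ρ - (1 - 2 * η)) * (((K : ℝ) * h) ^ (2 * η) / (2 * η)) := by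
    have hk := sum_rpow_neg_mul_le hh' (b := 1 - 2 * η) (by linarith) (by linarith) K
    have e1 : 1 - (1 - 2 * η) = 2 * η := by ring
    rw [e1] at hk
    refine le_trans ?_ (mul_le_mul_of_nonneg_left hk (by positivity))
    rw [Finset.mul_sum]
    refine Finset.sum_le_sum fun k hk => ?_
    have hkK := Finset.mem_range.1 hk
    have ht : (0 : ℝ) < ((K - k : ℕ) : ℝ) * h :=
      mul_pos (by exact_mod_cast Nat.sub_pos_of_lt hkK) hh'
    set t := ((K - k : ℕ) : ℝ) * h
    rw [← mul_assoc]
    refine mul_le_mul_of_nonneg_right ?_ hh'.le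
    calc d p k ^ 2 ≤ (M * eigval p ^ ρ * Real.exp (-eigval p * t)) ^ 2 := by
          rw [← sq_abs]
          exact pow_le_pow_left₀ (abs_nonneg _) (hd p k hkK) 2
      _ = M ^ 2 * eigval p ^ (2 * ρ) * (Real.exp (-eigval p * t) * Real.exp (-eigval p * t)) := by
          rw [mul_comm 2 ρ, Real.rpow_mul hp.le, Real.rpow_two]; ring
      _ ≤ M ^ 2 * eigval p ^ (2 * ρ) * ((t ^ (-(1 - 2 * η)) * eigval p ^ (-(1 - 2 * η))) * 1) := by
          gcongr
          · exact exp_neg_mul_le_rpow hp ht (by linarith) (by linarith)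
          · rw [Real.exp_le_one_iff]
            have : 0 < eigval p * t := by positivity
            linarith
      _ = _ := by
          rw [sub_eq_add_neg (2 * ρ), Real.rpow_add hp]
          ring
  rw [← ENNReal.ofReal_sum_of_nonneg fun k _ => by positivity]
  calc _ ≤ ENNReal.ofReal (eigval p ^ (2 * r)) * (noiseVar γ ε p * ENNReal.ofReal (M ^ 2 *
        eigval p ^ (2 * ρ - (1 - 2 * η)) * (((K : ℝ) * h) ^ (2 * η) / (2 * η)))) := by
        gcongr
    _ = (ENNReal.ofReal (eigval p ^ (2 * r)) * ENNReal.ofReal (M ^ 2 *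
        eigval p ^ (2 * ρ - (1 - 2 * η)) * (((K : ℝ) * h) ^ (2 * η) / (2 * η)))) *
          noiseVar γ ε p := by ring
    _ = (ENNReal.ofReal (M ^ 2 * (((K : ℝ) * h) ^ (2 * η) / (2 * η))) *
        ENNReal.ofReal (eigval p ^ (2 * (a - 1 / 2)))) * noiseVar γ ε p := by
        rw [← ENNReal.ofReal_mul (by positivity), ← ENNReal.ofReal_mul (by positivity)]
        congr 2
        have : eigval p ^ (2 * (a - 1 / 2)) =
            eigval p ^ (2 * r) * eigval p ^ (2 * ρ - (1 - 2 * η)) := by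
          rw [← Real.rpow_add hp]
          congr 1
          rw [hη]
          ring
        rw [this]
        ring
    _ = _ := by ring

theorem eLpNorm_fracNorm_stochConv_le [IsProbabilityMeasure P] (hβ : IsIndepWiener P β)
    (hγ : ∀ p, 0 ≤ γ p) {n : ℕ} (hn : n ≠ 0) {a r : ℝ} (ha₁ : a ≤ 1 / 2)
    (hQ : hsNormSq (a - 1 / 2) γ ε < ∞) (hr : 0 ≤ r) (hra : r < a) {h : ℝ≥0}
    (hh : 0 < h) (s : ℝ≥0) (K : ℕ) :
    eLpNorm (fun ω => fracNorm r (stochConv P γ ε β h s K ω)) ((2 * n : ℕ) : ℝ≥0∞) P ≤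
      momentConst (2 * n) * (ENNReal.ofReal (((K : ℝ) * h) ^ (2 * (a - r)) / (2 * (a - r))) *
        hsNormSq (a - 1 / 2) γ ε) ^ (1 / 2 : ℝ) := by
  have := eLpNorm_fracNorm_convolution_le (P := P) (γ := γ) (ε := ε) (M := 1) (ρ := 0) (a := a)
    (r := r) hβ hγ hn
    (stronglyMeasurable_stochConv P γ ε β h s K) (fun m => stronglyMeasurable_truncConv hβ m h s K)
    (tendsto_stochConv hβ hγ (hr.trans_lt hra) ha₁ hQ hh s K) hh
    (fun m p ω => inner_truncConv m h s K p ω)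
    (fun p k _ => by rw [Real.abs_exp]; simp) (by linarith) (by linarith)
  simpa using this

/-- On the common fine grid the coarse weight of increment `k` is the fine weight times `e^{-λu}`
with `u = (k mod J)δ < Jδ`. Since `1 - e^{-λu} ≤ (λJδ)^α`, the difference is a convolution with
prefactor `(Jδ)^α` and `α` extra powers of `λ`, and `α < a` pays for them. -/
theorem eLpNorm_stochConv_sub_le [IsProbabilityMeasure P] (hβ : IsIndepWiener P β)
    (hγ : ∀ p, 0 ≤ γ p) {n : ℕ} (hn : n ≠ 0) {a α : ℝ} (ha₁ : a ≤ 1 / 2)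
    (hQ : hsNormSq (a - 1 / 2) γ ε < ∞) (hα : 0 ≤ α) (hαa : α < a) {δ : ℝ≥0}
    (hδ : 0 < δ) {J : ℕ} (hJ : J ≠ 0) (N : ℕ) :
    eLpNorm (fun ω => stochConv P γ ε β (J * δ) 0 N ω - stochConv P γ ε β δ 0 (N * J) ω)
        ((2 * n : ℕ) : ℝ≥0∞) P ≤
      momentConst (2 * n) * (ENNReal.ofReal ((((J : ℝ) * δ) ^ α) ^ 2 *
        ((((N * J : ℕ) : ℝ) * δ) ^ (2 * (a - α)) / (2 * (a - α)))) *
        hsNormSq (a - 1 / 2) γ ε) ^ (1 / 2 : ℝ) := by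
  have hJδ : 0 < (J : ℝ≥0) * δ := mul_pos (by exact_mod_cast Nat.pos_of_ne_zero hJ) hδ
  have hδ' : (0 : ℝ) < δ := hδ
  have h1 := tendsto_stochConv (P := P) hβ hγ (hα.trans_lt hαa) ha₁ hQ hJδ 0 N
  have h2 := tendsto_stochConv (P := P) hβ hγ (hα.trans_lt hαa) ha₁ hQ hδ 0 (N * J)
  have m1 := fun m => stronglyMeasurable_truncConv (γ := γ) (ε := ε) hβ m (J * δ) 0 N
  have m2 := fun m => stronglyMeasurable_truncConv (γ := γ) (ε := ε) hβ m δ 0 (N * J)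
  have m3 := stronglyMeasurable_stochConv P γ ε β (J * δ) 0 N
  have m4 := stronglyMeasurable_stochConv P γ ε β δ 0 (N * J)
  have := eLpNorm_fracNorm_convolution_le (P := P) (γ := γ) (ε := ε) (M := ((J : ℝ) * δ) ^ α)
    (ρ := α) (a := a) (r := 0) (s := 0) (h := δ) (K := N * J)
    (Y := stochConv P γ ε β (J * δ) 0 N - stochConv P γ ε β δ 0 (N * J))
    (Ym := fun m => truncConv γ ε β m (J * δ) 0 N - truncConv γ ε β m δ 0 (N * J))
    (d := fun p k => Real.exp (-eigval p * ((N - k / J : ℕ) * (J * δ))) -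
      Real.exp (-eigval p * ((N * J - k : ℕ) * δ)))
    hβ hγ hn (m3.sub m4) (fun m => (m1 m).sub (m2 m)) ?_ hδ ?_ ?_ (by linarith) (by linarith)
  · simpa only [fracNorm_zero_left, eLpNorm_enorm, sub_zero, Pi.sub_apply] using this
  · have h3 := h1.add h2
    rw [add_zero] at h3
    refine tendsto_of_tendsto_of_tendsto_of_le_of_le tendsto_const_nhds h3 (fun _ => zero_le)
      fun m => ?_
    have he : truncConv γ ε β m (J * δ) 0 N - truncConv γ ε β m δ 0 (N * J) -
        (stochConv P γ ε β (J * δ) 0 N - stochConv P γ ε β δ 0 (N * J)) =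
        (truncConv γ ε β m (J * δ) 0 N - stochConv P γ ε β (J * δ) 0 N) -
        (truncConv γ ε β m δ 0 (N * J) - stochConv P γ ε β δ 0 (N * J)) := by abel
    rw [he]
    exact eLpNorm_sub_le ((m1 m).sub m3).aestronglyMeasurable ((m2 m).sub m4).aestronglyMeasurable
      one_le_two
  · intro m p ω
    rw [Pi.sub_apply, inner_sub_right, inner_truncConv, inner_truncConv, ← Finset.sum_sub_distrib]
    refine Finset.sum_congr rfl fun i _ => ?_
    rw [← mul_sub]
    congr 1
    have := sum_range_mul_telescope (fun t => β i t ω)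
      (fun n => Real.exp (-eigval p * ((N - n : ℕ) * (J * δ)))) δ hJ N
    push_cast
    rw [this, ← Finset.sum_sub_distrib]
    refine Finset.sum_congr rfl fun k _ => ?_
    ring
  · intro p k hk
    have hp := eigval_pos p
    have hkJ : k / J < N := Nat.div_lt_of_lt_mul (by rwa [mul_comm] at hk)
    have hmod : k % J < J := Nat.mod_lt _ (Nat.pos_of_ne_zero hJ)
    have htime : ((N - k / J : ℕ) : ℝ) * (J * δ) =
        ((N * J - k : ℕ) : ℝ) * δ + ((k % J : ℕ) : ℝ) * δ := by
      rw [Nat.cast_sub hkJ.le, Nat.cast_sub hk.le]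
      have := Nat.div_add_mod k J
      have h4 : (k : ℝ) = J * ((k / J : ℕ) : ℝ) + ((k % J : ℕ) : ℝ) := by exact_mod_cast this.symm
      push_cast
      linear_combination (δ : ℝ) * h4
    rw [htime, mul_add, Real.exp_add, ← mul_sub_one, abs_mul, Real.abs_exp, mul_comm]
    refine mul_le_mul_of_nonneg_right ?_ (Real.exp_pos _).le
    have hu : (0 : ℝ) ≤ ((k % J : ℕ) : ℝ) * δ := by positivity
    have h5 := one_sub_exp_neg_le_rpow (mul_nonneg hp.le hu) hα (by linarith)
    have h6 : Real.exp (-eigval p * (((k % J : ℕ) : ℝ) * δ)) ≤ 1 := by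
      rw [Real.exp_le_one_iff]
      have : 0 ≤ eigval p * (((k % J : ℕ) : ℝ) * δ) := by positivity
      linarith
    rw [abs_sub_comm, abs_of_nonneg (by linarith), neg_mul]
    refine h5.trans ?_
    rw [Real.mul_rpow hp.le hu, mul_comm]
    gcongr

end

end Parareal

namespace Parareal

noncomputable section

/-! ### Mild form of recursions -/

/-- The discrete convolution `∑_{n<N} ∑_{j<J} δ e^{(NJ-nJ-j)δA} g_{n,j}`. -/
def convSum (δ : ℝ≥0) (J N : ℕ) (g : ℕ → ℕ → H) : H :=
  ∑ n ∈ Finset.range N, ∑ j ∈ Finset.range J,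
    (δ : ℝ) • heatL ((N * J - (n * J + j) : ℕ) * δ) (g n j)

/-- `X` solves the recursion with step `Jδ`, drift `g` and noise accumulated in `Z`. -/
structure IsMild (δ : ℝ≥0) (J : ℕ) (X : ℕ → H) (g : ℕ → ℕ → H) (Z : ℕ → H) : Prop where
  zero : Z 0 = 0
  step : ∀ n, X (n + 1) = heatL (J * δ) (X n) +
    ∑ j ∈ Finset.range J, (δ : ℝ) • heatL ((J - j : ℕ) * δ) (g n j) +
    (Z (n + 1) - heatL (J * δ) (Z n))

theorem IsMild.sub {δ : ℝ≥0} {J : ℕ} {X Y : ℕ → H} {g k : ℕ → ℕ → H} {Z W : ℕ → H}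
    (hX : IsMild δ J X g Z) (hY : IsMild δ J Y k W) :
    IsMild δ J (fun n => X n - Y n) (fun n j => g n j - k n j) (fun n => Z n - W n) where
  zero := by rw [hX.zero, hY.zero, sub_zero]
  step n := by
    rw [hX.step, hY.step]
    simp only [map_sub, smul_sub, Finset.sum_sub_distrib]
    abel

theorem heatL_convSum (δ : ℝ≥0) (J N : ℕ) (g : ℕ → ℕ → H) :
    convSum δ J (N + 1) g = heatL (J * δ) (convSum δ J N g) +
      ∑ j ∈ Finset.range J, (δ : ℝ) • heatL ((J - j : ℕ) * δ) (g N j) := by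
  rw [convSum, Finset.sum_range_succ, convSum, map_sum]
  congr 1
  · refine Finset.sum_congr rfl fun n hn => ?_
    rw [map_sum]
    refine Finset.sum_congr rfl fun j hj => ?_
    have hn := Finset.mem_range.1 hn
    have hj := Finset.mem_range.1 hj
    have h1 : (n + 1) * J ≤ N * J := Nat.mul_le_mul_right J hn
    have h2 : (N + 1) * J - (n * J + j) = J + (N * J - (n * J + j)) := by
      rw [Nat.succ_mul] at h1 ⊢
      omega
    rw [map_smul, heatL_heatL, h2]
    push_cast
    rw [add_mul]
  · refine Finset.sum_congr rfl fun j _ => ?_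
    have h2 : (N + 1) * J - (N * J + j) = J - j := by
      rw [Nat.succ_mul]
      omega
    rw [h2]

/-- The noise increments telescope under the semigroup and leave the purely additive term `Z N`. Two
recursions with the same `Z` therefore have a noise-free difference. -/
theorem IsMild.eq {δ : ℝ≥0} {J : ℕ} {X : ℕ → H} {g : ℕ → ℕ → H} {Z : ℕ → H}
    (hX : IsMild δ J X g Z) (N : ℕ) :
    X N = heatL (N * (J * δ)) (X 0) + convSum δ J N g + Z N := by
  induction N with
  | zero => simp [convSum, heatL_zero, hX.zero]
  | succ N ih =>
    have e : ((N + 1 : ℕ) : ℝ≥0) * (J * δ) = J * δ + N * (J * δ) := by push_cast; ring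
    rw [hX.step, ih, heatL_convSum, e, map_add, map_add, heatL_heatL]
    abel

theorem sum_range_sum_range_mul {M : Type*} [AddCommMonoid M] (f : ℕ → M) (N J : ℕ) :
    ∑ n ∈ Finset.range N, ∑ j ∈ Finset.range J, f (n * J + j) =
      ∑ k ∈ Finset.range (N * J), f k := by
  induction N with
  | zero => simp
  | succ N ih => rw [Finset.sum_range_succ, ih, Nat.succ_mul, Finset.sum_range_add]

/-- The bound for the sum of the kernel `t^{-b}`. -/
def kernelConst (T b : ℝ) : ℝ≥0∞ := ENNReal.ofReal (T ^ (1 - b) / (1 - b))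

theorem kernelConst_ne_top (T b : ℝ) : kernelConst T b ≠ ∞ := ENNReal.ofReal_ne_top

theorem sum_kernel_le {δ : ℝ≥0} (hδ : 0 < δ) {b : ℝ} (hb₀ : 0 ≤ b) (hb₁ : b < 1) {N J : ℕ} {T : ℝ}
    (hT : (N : ℝ) * (J * δ) ≤ T) :
    ∑ n ∈ Finset.range N, ∑ j ∈ Finset.range J,
      (δ : ℝ≥0∞) * ((((N * J - (n * J + j) : ℕ) * δ : ℝ≥0)) : ℝ≥0∞) ^ (-b) ≤ kernelConst T b := by
  have hδ' : (0 : ℝ) < δ := hδ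
  rw [sum_range_sum_range_mul
    (fun k => (δ : ℝ≥0∞) * ((((N * J - k : ℕ) * δ : ℝ≥0)) : ℝ≥0∞) ^ (-b))]
  have h := sum_rpow_neg_mul_le hδ' hb₀ hb₁ (N * J)
  have h1 : ∀ k ∈ Finset.range (N * J),
      (δ : ℝ≥0∞) * ((((N * J - k : ℕ) * δ : ℝ≥0)) : ℝ≥0∞) ^ (-b) =
      ENNReal.ofReal ((((N * J - k : ℕ) : ℝ) * δ) ^ (-b) * δ) := by
    intro k hk
    have ht : (0 : ℝ) < ((N * J - k : ℕ) : ℝ) * δ :=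
      mul_pos (by exact_mod_cast Nat.sub_pos_of_lt (Finset.mem_range.1 hk)) hδ'
    rw [ENNReal.ofReal_mul (by positivity), ENNReal.ofReal_coe_nnreal,
      ← ENNReal.ofReal_rpow_of_pos ht, mul_comm]
    congr 2
    rw [← ENNReal.ofReal_coe_nnreal, NNReal.coe_mul, NNReal.coe_natCast]
  rw [Finset.sum_congr rfl h1, ← ENNReal.ofReal_sum_of_nonneg fun k _ => by positivity]
  refine ENNReal.ofReal_le_ofReal (h.trans ?_)
  have hb : 0 < 1 - b := by linarith
  gcongr
  push_cast
  rwa [mul_assoc]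

theorem sum_delta_le {δ : ℝ≥0} {N J : ℕ} {T : ℝ} (hT : (N : ℝ) * (J * δ) ≤ T) :
    ∑ _n ∈ Finset.range N, ∑ _j ∈ Finset.range J, (δ : ℝ≥0∞) ≤ ENNReal.ofReal T := by
  simp only [Finset.sum_const, Finset.card_range, nsmul_eq_mul]
  refine le_trans (le_of_eq ?_) (ENNReal.ofReal_le_ofReal hT)
  rw [ENNReal.ofReal_mul (by positivity), ENNReal.ofReal_mul (by positivity)]
  simp

/-- Discrete Gronwall inequality. -/
theorem gronwall_sum {x : ℕ → ℝ≥0∞} {K c : ℝ≥0∞} {N : ℕ}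
    (h : ∀ n ≤ N, x n ≤ K + c * ∑ i ∈ Finset.range n, x i) : ∀ n ≤ N, x n ≤ K * (1 + c) ^ n := by
  -- The claimed bound solves the recursion with equality.
  have hg : ∀ n, K + c * ∑ i ∈ Finset.range n, K * (1 + c) ^ i = K * (1 + c) ^ n := by
    intro n
    induction n with
    | zero => simp
    | succ n ih =>
      rw [Finset.sum_range_succ, mul_add, ← add_assoc, ih]
      ring
  intro n
  induction n using Nat.strong_induction_on with
  | _ n ih =>
    intro hn
    refine (h n hn).trans ?_
    rw [← hg n]
    gcongr with i hi
    have := Finset.mem_range.1 hi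
    exact ih i this (by omega)

theorem one_add_pow_le_exp {L : ℝ≥0} {δ : ℝ≥0} {n : ℕ} {T : ℝ} (h : (n : ℝ) * δ ≤ T) :
    (1 + (L : ℝ≥0∞) * δ) ^ n ≤ ENNReal.ofReal (Real.exp (L * T)) := by
  have h1 : (1 + (L : ℝ≥0∞) * δ) = ENNReal.ofReal (1 + (L : ℝ) * δ) := by
    rw [ENNReal.ofReal_add zero_le_one (by positivity), ENNReal.ofReal_mul (by positivity)]
    simp
  rw [h1, ← ENNReal.ofReal_pow (by positivity)]
  refine ENNReal.ofReal_le_ofReal ?_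
  calc (1 + (L : ℝ) * δ) ^ n ≤ (Real.exp (L * δ)) ^ n := by
        gcongr
        linarith [Real.add_one_le_exp ((L : ℝ) * δ)]
    _ = Real.exp (L * (n * δ)) := by rw [← Real.exp_nat_mul]; ring_nf
    _ ≤ Real.exp (L * T) := by gcongr

/-! ### The parareal scheme in mild form -/

variable {Ω : Type*} [MeasurableSpace Ω]

section mild

variable (P : Measure Ω) (γ : ℕ → ℝ) (ε : HilbertBasis ℕ ℝ H) (β : ℕ → ℝ≥0 → Ω → ℝ) (F : H → H)

/-- The discrete variation-of-constants formula. The noise does not depend on `u`, so it cancels in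
differences of two fine trajectories. -/
theorem fineSteps_eq (ΔT : ℝ≥0) (J n : ℕ) (ω : Ω) (u : H) (j : ℕ) :
    fineSteps P γ ε β F ΔT J n ω u j = heatL (j * (ΔT / J)) u +
      ∑ i ∈ Finset.range j, ((ΔT / J : ℝ≥0) : ℝ) • heatL ((j - i : ℕ) * (ΔT / J))
        (F (fineSteps P γ ε β F ΔT J n ω u i)) +
      stochConv P γ ε β (ΔT / J) (n * ΔT) j ω := by
  induction j with
  | zero => simp [fineSteps, stochConv, heatL_zero]
  | succ j ih =>
    rw [fineSteps, expEuler, heat_eq, heat_eq, Finset.sum_range_succ, stochConv]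
    beta_reduce
    nth_rewrite 1 [ih]
    have e : ((j + 1 : ℕ) : ℝ≥0) * (ΔT / J) = ΔT / J + j * (ΔT / J) := by push_cast; ring
    rw [map_add, map_add, heatL_heatL, e, map_sum]
    have h1 : ∀ i ∈ Finset.range j, heatL (ΔT / J) (((ΔT / J : ℝ≥0) : ℝ) •
        heatL ((j - i : ℕ) * (ΔT / J)) (F (fineSteps P γ ε β F ΔT J n ω u i))) =
        ((ΔT / J : ℝ≥0) : ℝ) • heatL ((j + 1 - i : ℕ) * (ΔT / J))
          (F (fineSteps P γ ε β F ΔT J n ω u i)) := by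
      intro i hi
      have : j + 1 - i = (j - i) + 1 := by
        have := Finset.mem_range.1 hi
        omega
      rw [map_smul, heatL_heatL, this]
      congr 3
      push_cast
      ring
    rw [Finset.sum_congr rfl h1]
    simp only [Nat.add_sub_cancel_left, Nat.cast_one, one_mul]
    abel

variable {ΔT : ℝ≥0} {J : ℕ}

theorem stochConv_fine (hJ : J ≠ 0) (n : ℕ) (ω : Ω) :
    stochConv P γ ε β (ΔT / J) (n * ΔT) J ω = stochConv P γ ε β (ΔT / J) 0 ((n + 1) * J) ω -
      heatL (J * (ΔT / J)) (stochConv P γ ε β (ΔT / J) 0 (n * J) ω) := by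
  have hJ' : (J : ℝ≥0) ≠ 0 := by exact_mod_cast hJ
  have e : (0 : ℝ≥0) + ((n * J : ℕ) : ℝ≥0) * (ΔT / J) = n * ΔT := by
    push_cast
    rw [zero_add, mul_assoc, mul_div_cancel₀ _ hJ']
  rw [Nat.succ_mul, stochConv_add, e]
  abel

theorem fine_eq (hJ : J ≠ 0) (n : ℕ) (ω : Ω) (u : H) :
    fine P γ ε β F ΔT J n ω u = heatL (J * (ΔT / J)) u +
      ∑ j ∈ Finset.range J, ((ΔT / J : ℝ≥0) : ℝ) • heatL ((J - j : ℕ) * (ΔT / J))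
        (F (fineSteps P γ ε β F ΔT J n ω u j)) +
      (stochConv P γ ε β (ΔT / J) 0 ((n + 1) * J) ω -
        heatL (J * (ΔT / J)) (stochConv P γ ε β (ΔT / J) 0 (n * J) ω)) := by
  rw [fine, fineSteps_eq, stochConv_fine P γ ε β hJ]

/-- The single drift term `ΔT e^{ΔT A} F(u)` is spread over the `J` fine slots by writing `e^{ΔT A}
= e^{(J-j)δA} e^{jδA}`. This gives the coarse step the shape of the fine one. -/
theorem coarse_eq (hJ : J ≠ 0) (n : ℕ) (ω : Ω) (u : H) :
    coarse P γ ε β F ΔT n ω u = heatL (J * (ΔT / J)) u +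
      ∑ j ∈ Finset.range J, ((ΔT / J : ℝ≥0) : ℝ) • heatL ((J - j : ℕ) * (ΔT / J))
        (heatL (j * (ΔT / J)) (F u)) +
      (stochConv P γ ε β ΔT 0 (n + 1) ω -
        heatL (J * (ΔT / J)) (stochConv P γ ε β ΔT 0 n ω)) := by
  have hJ' : (J : ℝ≥0) ≠ 0 := by exact_mod_cast hJ
  have hΔ : (J : ℝ≥0) * (ΔT / J) = ΔT := mul_div_cancel₀ _ hJ'
  have h1 : ∀ j ∈ Finset.range J, ((ΔT / J : ℝ≥0) : ℝ) • heatL ((J - j : ℕ) * (ΔT / J))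
        (heatL (j * (ΔT / J)) (F u)) = ((ΔT / J : ℝ≥0) : ℝ) • heatL ΔT (F u) := by
    intro j hj
    have := (Finset.mem_range.1 hj).le
    rw [heatL_heatL, ← add_mul, ← Nat.cast_add, Nat.sub_add_cancel this, hΔ]
  rw [Finset.sum_congr rfl h1, Finset.sum_const, Finset.card_range, ← Nat.cast_smul_eq_nsmul ℝ,
    smul_smul, hΔ, coarse, expEuler, stochConv, heat_eq, heat_eq, zero_add]
  have : (J : ℝ) * ((ΔT / J : ℝ≥0) : ℝ) = ΔT := by exact_mod_cast hΔ
  rw [this, add_sub_cancel_left]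

theorem isMild_reference (hJ : J ≠ 0) (u₀ : H) (ω : Ω) :
    IsMild (ΔT / J) J (reference P γ ε β F u₀ ΔT J ω)
      (fun n j => F (fineSteps P γ ε β F ΔT J n ω (reference P γ ε β F u₀ ΔT J ω n) j))
      (fun n => stochConv P γ ε β (ΔT / J) 0 (n * J) ω) where
  zero := by simp [stochConv]
  step n := by rw [reference, fine_eq P γ ε β F hJ]

theorem isMild_parareal_zero (hJ : J ≠ 0) (u₀ : H) (ω : Ω) :
    IsMild (ΔT / J) J (parareal P γ ε β F u₀ ΔT J ω 0)
      (fun n j => heatL (j * (ΔT / J)) (F (parareal P γ ε β F u₀ ΔT J ω 0 n)))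
      (fun n => stochConv P γ ε β ΔT 0 n ω) where
  zero := by simp [stochConv]
  step n := by rw [parareal, coarse_eq P γ ε β F hJ]

/-- The coarse noises of the two coarse terms cancel, so only the fine noise remains, as in the
reference solution. -/
theorem isMild_parareal_succ (hJ : J ≠ 0) (u₀ : H) (ω : Ω) (k : ℕ) :
    IsMild (ΔT / J) J (parareal P γ ε β F u₀ ΔT J ω (k + 1))
      (fun n j => heatL (j * (ΔT / J)) (F (parareal P γ ε β F u₀ ΔT J ω (k + 1) n)) +
        F (fineSteps P γ ε β F ΔT J n ω (parareal P γ ε β F u₀ ΔT J ω k n) j) -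
        heatL (j * (ΔT / J)) (F (parareal P γ ε β F u₀ ΔT J ω k n)))
      (fun n => stochConv P γ ε β (ΔT / J) 0 (n * J) ω) where
  zero := by simp [stochConv]
  step n := by
    rw [parareal, coarse_eq P γ ε β F hJ, coarse_eq P γ ε β F hJ, fine_eq P γ ε β F hJ]
    simp only [map_add, map_sub, smul_add, smul_sub, Finset.sum_add_distrib, Finset.sum_sub_distrib]
    abel

theorem parareal_zero_right (u₀ : H) (ω : Ω) (k : ℕ) :
    parareal P γ ε β F u₀ ΔT J ω k 0 = u₀ := by
  cases k <;> rw [parareal]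

end mild

end

end Parareal

namespace Parareal

noncomputable section

/-! ### Consequences of the assumptions on `F` -/

theorem fracNorm_eq_zero_iff (r : ℝ) (u : H) : fracNorm r u = 0 ↔ u = 0 := by
  refine ⟨fun h => eigvec_complete u fun p => ?_, fun h => by rw [h, fracNorm_zero_right]⟩
  rw [fracNorm_eq, ENNReal.rpow_eq_zero_iff_of_pos (by norm_num), ENNReal.tsum_eq_zero] at h
  have := h p
  rw [ENNReal.rpow_eq_zero_iff_of_pos (by norm_num), mul_eq_zero] at this
  rcases this with h1 | h1
  · exact absurd h1 (ENNReal.ofReal_pos.2 (Real.rpow_pos_of_pos (eigval_pos p) r)).ne'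
  · simpa using h1

/-- The properties of `F` used in the convergence proof; `s` is the order gained per iteration. -/
structure DriftBounds (F : H → H) (α s : ℝ) (L M C : ℝ≥0) : Prop where
  lipschitz : LipschitzWith L F
  growth : ‖F 0‖₊ ≤ L
  differentiable : Differentiable ℝ F
  fderiv_lipschitz : LipschitzWith M (fderiv ℝ F)
  fderiv_neg : ∀ x h, fracNorm (-s) (fderiv ℝ F x h) ≤ C * (1 + fracNorm α x) * fracNorm (-s) h

/-- If `κ < α`, the negative-norm bound is the first estimate on `F` at the parameters `(α - κ, κ)`,
whose weight is then exactly `|x|_α`. If `κ ≥ α`, then `s = 0` and boundedness of the derivative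
suffices. -/
theorem AssumptionF.exists_driftBounds {F : H → H} (hF : AssumptionF F) {α κ : ℝ}
    (hα₁ : α < 1 / 2) (hκ : 0 < κ) : ∃ L M C : ℝ≥0, DriftBounds F α (max (α - κ) 0) L M C := by
  obtain ⟨L, hL⟩ := hF.lipschitz
  obtain ⟨M, hM⟩ := hF.bounded_fderiv_fderiv
  obtain ⟨M₁, hM₁⟩ := hF.bounded_fderiv
  have hC : ∃ C : ℝ≥0, ∀ x h, fracNorm (-max (α - κ) 0) (fderiv ℝ F x h) ≤
      C * (1 + fracNorm α x) * fracNorm (-max (α - κ) 0) h := by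
    rcases le_or_gt (α - κ) 0 with hs | hs
    · refine ⟨M₁.toNNReal, fun x h => ?_⟩
      rw [max_eq_right hs, neg_zero, fracNorm_zero_left, fracNorm_zero_left]
      have h1 : ‖fderiv ℝ F x h‖ₑ ≤ M₁.toNNReal * ‖h‖ₑ := by
        have h2 := (fderiv ℝ F x).le_of_opNorm_le (hM₁ x) h
        rw [← ofReal_norm, ← ofReal_norm]
        refine (ENNReal.ofReal_le_ofReal h2).trans ?_
        rw [ENNReal.ofReal_mul ((norm_nonneg _).trans (hM₁ x))]
        rfl
      refine h1.trans ?_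
      gcongr
      exact le_mul_of_one_le_right' (self_le_add_right _ _)
    · obtain ⟨C, hC0, hC, -, -⟩ := hF.estimates (α - κ) hs (by linarith) κ hκ (by linarith)
      refine ⟨C.toNNReal, fun x h => ?_⟩
      rw [max_eq_left hs.le]
      rw [sub_add_cancel] at hC
      rcases eq_or_ne h 0 with rfl | hh
      · simp [fracNorm_zero_right]
      by_cases hx : fracNorm α x < ∞
      · exact hC x hx h
      -- Outside the domain the right-hand side is `∞`, because `C > 0` and a nonzero `h` has
      -- nonzero norm. The bound thus holds for all `x` and `h`.
      · rw [not_lt, top_le_iff] at hx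
        have h1 : fracNorm (-(α - κ)) h ≠ 0 := by rwa [Ne, fracNorm_eq_zero_iff]
        have h2 : (C.toNNReal : ℝ≥0∞) ≠ 0 := by
          simpa using hC0
        rw [hx, add_top, ENNReal.mul_top h2, ENNReal.top_mul h1]
        exact le_top
  obtain ⟨C, hC⟩ := hC
  -- Enlarging the Lipschitz constant beyond `‖F 0‖` lets one constant serve for linear growth too.
  refine ⟨L ⊔ ‖F 0‖₊, M.toNNReal, C, hL.weaken le_sup_left, le_sup_right, hF.differentiable, ?_, hC⟩
  refine lipschitzWith_of_nnnorm_fderiv_le hF.differentiable_fderiv fun x => ?_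
  rw [← NNReal.coe_le_coe, coe_nnnorm]
  exact (hM x).trans (Real.le_coe_toNNReal M)

variable {F : H → H} {α s : ℝ} {L M C : ℝ≥0}

theorem DriftBounds.enorm_sub_le (h : DriftBounds F α s L M C) (x y : H) :
    ‖F x - F y‖ₑ ≤ L * ‖x - y‖ₑ := by
  simpa [edist_eq_enorm_sub] using h.lipschitz x y

theorem DriftBounds.enorm_le (h : DriftBounds F α s L M C) (x : H) :
    ‖F x‖ₑ ≤ L * (1 + ‖x‖ₑ) := by
  calc ‖F x‖ₑ = ‖F 0 + (F x - F 0)‖ₑ := by rw [add_sub_cancel]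
    _ ≤ ‖F 0‖ₑ + ‖F x - F 0‖ₑ := enorm_add_le _ _
    _ ≤ L + L * ‖x‖ₑ := by
        gcongr
        · rw [enorm_eq_nnnorm]
          exact_mod_cast h.growth
        · simpa using h.enorm_sub_le x 0
    _ = L * (1 + ‖x‖ₑ) := by ring

theorem DriftBounds.continuous (h : DriftBounds F α s L M C) : Continuous F :=
  h.differentiable.continuous

theorem enorm_smul_nnreal (δ : ℝ≥0) (x : H) : ‖(δ : ℝ) • x‖ₑ = δ * ‖x‖ₑ := by
  rw [enorm_smul]
  simp

/-- Second-order difference estimate. -/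
theorem DriftBounds.fracNorm_second_difference_le (hF : DriftBounds F α s L M C) (hs : 0 ≤ s)
    (u v w z : H) :
    fracNorm (-s) ((F w - F z) - (F u - F v)) ≤
      M * (‖z - v‖ₑ + ‖w - u‖ₑ) * ‖w - z‖ₑ +
        C * (1 + (fracNorm α u + fracNorm α v)) * fracNorm (-s) ((w - z) - (u - v)) := by
  set R := M * (‖z - v‖ₑ + ‖w - u‖ₑ) * ‖w - z‖ₑ +
        C * (1 + (fracNorm α u + fracNorm α v)) * fracNorm (-s) ((w - z) - (u - v)) with hR
  by_cases hRt : R = ∞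
  · rw [hRt]; exact le_top
  let B := negPow s hs
  have hBle : ∀ x, ‖B x‖ₑ = fracNorm (-s) x := enorm_negPow s hs
  -- Both segments, from `z` to `w` and from `v` to `u`, are traversed simultaneously; `f 1 - f 0`
  -- is the second difference, measured in `|·|_{-s}`.
  let f : ℝ → H := fun θ => B (F (z + θ • (w - z)) - F (v + θ • (u - v)))
  let f' : ℝ → H := fun θ => B (fderiv ℝ F (z + θ • (w - z)) (w - z) -
    fderiv ℝ F (v + θ • (u - v)) (u - v))
  have hline : ∀ (a b : H) (θ : ℝ), HasDerivAt (fun θ : ℝ => a + θ • b) b θ := fun a b θ => by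
    simpa using ((hasDerivAt_id θ).smul_const b).const_add a
  have hd : ∀ θ, HasDerivAt f (f' θ) θ := fun θ => by
    have h1 := (hF.differentiable (z + θ • (w - z))).hasFDerivAt.comp_hasDerivAt θ
      (hline z (w - z) θ)
    have h2 := (hF.differentiable (v + θ • (u - v))).hasFDerivAt.comp_hasDerivAt θ
      (hline v (u - v) θ)
    exact B.hasFDerivAt.comp_hasDerivAt θ (h1.sub h2)
  have hbound : ∀ θ ∈ Set.Ico (0 : ℝ) 1, ‖f' θ‖ ≤ R.toReal := by
    intro θ hθ
    rw [← toReal_enorm]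
    refine ENNReal.toReal_mono hRt ?_
    set x := z + θ • (w - z)
    set y := v + θ • (u - v)
    -- The first term sees the variation of the derivative between `x` and `y`, controlled in `H` by
    -- the second derivative. The second applies one derivative to the small vector `(w - z) - (u -
    -- v)`, where the negative norm is needed.
    have e1 : f' θ = B ((fderiv ℝ F x - fderiv ℝ F y) (w - z)) +
        B (fderiv ℝ F y ((w - z) - (u - v))) := by
      change B (fderiv ℝ F x (w - z) - fderiv ℝ F y (u - v)) = _
      rw [← map_add B, sub_apply, map_sub (fderiv ℝ F y) (w - z) (u - v)]
      congr 1
      abel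
    have hxy : ‖x - y‖ₑ ≤ ‖z - v‖ₑ + ‖w - u‖ₑ := by
      have : x - y = (1 - θ) • (z - v) + θ • (w - u) := by
        simp only [x, y]
        module
      rw [this]
      refine (enorm_add_le _ _).trans ?_
      rw [enorm_smul, enorm_smul]
      have h1 : ‖1 - θ‖ₑ ≤ 1 := by
        rw [Real.enorm_eq_ofReal (by linarith [hθ.2])]
        exact ENNReal.ofReal_le_one.2 (by linarith [hθ.1])
      have h2 : ‖θ‖ₑ ≤ 1 := by
        rw [Real.enorm_eq_ofReal hθ.1]
        exact ENNReal.ofReal_le_one.2 hθ.2.le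
      exact add_le_add (mul_le_of_le_one_left' h1) (mul_le_of_le_one_left' h2)
    have hy : fracNorm α y ≤ fracNorm α u + fracNorm α v := by
      have : y = θ • u + (1 - θ) • v := by
        simp only [y]
        module
      rw [this]
      refine (fracNorm_add_le _ _ _).trans (add_le_add ?_ ?_)
      · refine (fracNorm_smul_le _ _ _).trans (mul_le_of_le_one_left' ?_)
        rw [Real.enorm_eq_ofReal hθ.1]
        exact ENNReal.ofReal_le_one.2 hθ.2.le
      · refine (fracNorm_smul_le _ _ _).trans (mul_le_of_le_one_left' ?_)
        rw [Real.enorm_eq_ofReal (by linarith [hθ.2])]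
        exact ENNReal.ofReal_le_one.2 (by linarith [hθ.1])
    rw [e1]
    refine (enorm_add_le _ _).trans (add_le_add ?_ ?_)
    · rw [hBle]
      refine (fracNorm_mono (neg_nonpos.2 hs) _).trans ?_
      rw [fracNorm_zero_left]
      have h1 : ‖fderiv ℝ F x - fderiv ℝ F y‖ₑ ≤ M * ‖x - y‖ₑ := by
        simpa [edist_eq_enorm_sub] using hF.fderiv_lipschitz x y
      refine (ContinuousLinearMap.le_opENorm _ _).trans ?_
      gcongr
      exact h1.trans (by gcongr)
    · rw [hBle]
      refine (hF.fderiv_neg _ _).trans ?_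
      gcongr
  have := norm_image_sub_le_of_norm_deriv_le_segment_01' (f := f) (f' := f')
    (fun θ _ => (hd θ).hasDerivWithinAt) hbound
  have e2 : f 1 - f 0 = B ((F w - F z) - (F u - F v)) := by
    simp only [f]
    rw [← map_sub]
    congr 1
    simp only [one_smul, zero_smul, add_zero, add_sub_cancel]
    abel
  rw [e2] at this
  rw [← hBle, ← ofReal_norm]
  exact ENNReal.ofReal_le_of_le_toReal this

/-! ### Pathwise estimates for the fine integrator -/

section fine

variable {Ω : Type*} [MeasurableSpace Ω] {P : Measure Ω} {γ : ℕ → ℝ} {ε : HilbertBasis ℕ ℝ H}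
  {β : ℕ → ℝ≥0 → Ω → ℝ} {ΔT : ℝ≥0} {J : ℕ}

theorem step_mul_le (ΔT : ℝ≥0) {j J : ℕ} (hj : j ≤ J) : (j : ℝ≥0) * (ΔT / J) ≤ ΔT := by
  rcases eq_or_ne J 0 with rfl | hJ
  · simp
  · have hJ' : (J : ℝ≥0) ≠ 0 := by exact_mod_cast hJ
    calc (j : ℝ≥0) * (ΔT / J) ≤ J * (ΔT / J) := by gcongr
      _ = ΔT := mul_div_cancel₀ _ hJ'

theorem step_mul_le_one (hΔ : ΔT ≤ 1) {j J : ℕ} (hj : j ≤ J) :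
    (j : ℝ) * ((ΔT / J : ℝ≥0) : ℝ) ≤ 1 := by
  exact_mod_cast (step_mul_le ΔT hj).trans hΔ

/-- The Lipschitz constant of the fine integrator. -/
def fineLip (L : ℝ≥0) : ℝ≥0∞ := ENNReal.ofReal (Real.exp (L * 1))

theorem fineSteps_sub_eq (n : ℕ) (ω : Ω) (u v : H) (j : ℕ) :
    fineSteps P γ ε β F ΔT J n ω u j - fineSteps P γ ε β F ΔT J n ω v j =
      heatL (j * (ΔT / J)) (u - v) +
      ∑ i ∈ Finset.range j, ((ΔT / J : ℝ≥0) : ℝ) • heatL ((j - i : ℕ) * (ΔT / J))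
        (F (fineSteps P γ ε β F ΔT J n ω u i) - F (fineSteps P γ ε β F ΔT J n ω v i)) := by
  rw [fineSteps_eq, fineSteps_eq P γ ε β F ΔT J n ω v j]
  simp only [map_sub, smul_sub, Finset.sum_sub_distrib]
  abel

theorem enorm_sum_heatL_le (δ : ℝ≥0) (j : ℕ) (g : ℕ → H) (t : ℕ → ℝ≥0) :
    ‖∑ i ∈ Finset.range j, (δ : ℝ) • heatL (t i) (g i)‖ₑ ≤
      δ * ∑ i ∈ Finset.range j, ‖g i‖ₑ := by
  refine (enorm_sum_le _ _).trans ?_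
  rw [Finset.mul_sum]
  refine Finset.sum_le_sum fun i _ => ?_
  rw [enorm_smul_nnreal]
  gcongr
  exact enorm_heatL_le _ _

theorem DriftBounds.enorm_fineSteps_sub_le (hF : DriftBounds F α s L M C) (hΔ : ΔT ≤ 1) (n : ℕ)
    (ω : Ω) (u v : H) {j : ℕ} (hj : j ≤ J) :
    ‖fineSteps P γ ε β F ΔT J n ω u j - fineSteps P γ ε β F ΔT J n ω v j‖ₑ ≤
      fineLip L * ‖u - v‖ₑ := by
  have h := gronwall_sum (x := fun j => ‖fineSteps P γ ε β F ΔT J n ω u j -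
    fineSteps P γ ε β F ΔT J n ω v j‖ₑ) (K := ‖u - v‖ₑ) (c := L * ((ΔT / J : ℝ≥0) : ℝ≥0∞)) (N := J)
    (fun j hj => by
      rw [fineSteps_sub_eq]
      refine (enorm_add_le _ _).trans (add_le_add (enorm_heatL_le _ _) ?_)
      refine (enorm_sum_heatL_le _ _ _ _).trans ?_
      rw [mul_comm (L : ℝ≥0∞), mul_assoc, Finset.mul_sum (a := (L : ℝ≥0∞))]
      gcongr
      exact hF.enorm_sub_le _ _) j hj
  refine h.trans ?_
  rw [mul_comm]
  gcongr
  exact one_add_pow_le_exp (step_mul_le_one hΔ hj)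

theorem coe_le_rpow (hΔ : ΔT ≤ 1) (hs₁ : s ≤ 1) :
    (ΔT : ℝ≥0∞) ≤ (ΔT : ℝ≥0∞) ^ s := by
  rcases eq_or_ne ΔT 0 with rfl | h0
  · simp
  calc (ΔT : ℝ≥0∞) = (ΔT : ℝ≥0∞) ^ (1 : ℝ) := (ENNReal.rpow_one _).symm
    _ ≤ (ΔT : ℝ≥0∞) ^ s := ENNReal.rpow_le_rpow_of_exponent_ge (by exact_mod_cast hΔ) hs₁

/-- Both trajectories see the same noise, so what remains is `e^{jδA} - 1` applied to `u - v`, worth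
`ΔT^s` in `|·|_{-s}`, and a drift term of order `ΔT ≤ ΔT^s`. The estimate is pathwise and needs no
regularity of `u - v` beyond `H`. -/
theorem DriftBounds.fracNorm_fineSteps_sub_sub_le (hF : DriftBounds F α s L M C) (hs₀ : 0 ≤ s)
    (hs₁ : s ≤ 1) (hΔ : ΔT ≤ 1) (n : ℕ) (ω : Ω) (u v : H) {j : ℕ} (hj : j ≤ J) :
    fracNorm (-s) ((fineSteps P γ ε β F ΔT J n ω u j - fineSteps P γ ε β F ΔT J n ω v j) -
      (u - v)) ≤ (ΔT : ℝ≥0∞) ^ s * (1 + L * fineLip L) * ‖u - v‖ₑ := by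
  rw [fineSteps_sub_eq, add_sub_right_comm]
  refine (fracNorm_add_le _ _ _).trans ?_
  rw [mul_add, mul_one, add_mul]
  refine add_le_add ?_ ?_
  · refine (fracNorm_heatL_sub_le hs₀ hs₁ _ _ _).trans ?_
    rw [neg_add_cancel, fracNorm_zero_left]
    gcongr
    exact step_mul_le ΔT hj
  · refine (fracNorm_mono (neg_nonpos.2 hs₀) _).trans ?_
    rw [fracNorm_zero_left]
    refine (enorm_sum_heatL_le _ _ _ _).trans ?_
    calc _ ≤ ((ΔT / J : ℝ≥0) : ℝ≥0∞) * ∑ i ∈ Finset.range j, L * (fineLip L * ‖u - v‖ₑ) := by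
          gcongr with i hi
          refine (hF.enorm_sub_le _ _).trans ?_
          gcongr
          exact hF.enorm_fineSteps_sub_le hΔ n ω u v ((Finset.mem_range.1 hi).le.trans hj)
      _ = (((j : ℝ≥0) * (ΔT / J) : ℝ≥0) : ℝ≥0∞) * (L * (fineLip L * ‖u - v‖ₑ)) := by
          rw [Finset.sum_const, Finset.card_range, nsmul_eq_mul]
          push_cast
          ring
      _ ≤ (ΔT : ℝ≥0∞) ^ s * (L * (fineLip L * ‖u - v‖ₑ)) := by
          gcongr
          exact (ENNReal.coe_le_coe.2 (step_mul_le ΔT hj)).trans (coe_le_rpow hΔ hs₁)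
      _ = _ := by ring

/-- The pathwise bound for the local defect of the parareal correction. -/
theorem DriftBounds.fracNorm_defect_le (hF : DriftBounds F α s L M C) (hs₀ : 0 ≤ s)
    (hs₁ : s ≤ 1) (hΔ : ΔT ≤ 1) (n : ℕ) (ω : Ω) (u v : H) {j : ℕ} (hj : j ≤ J) :
    fracNorm (-s) ((F (fineSteps P γ ε β F ΔT J n ω u j) -
        F (fineSteps P γ ε β F ΔT J n ω v j)) - heatL (j * (ΔT / J)) (F u - F v)) ≤
      (M * fineLip L + C * (1 + L * fineLip L) + L) *
        ((‖fineSteps P γ ε β F ΔT J n ω v j - v‖ₑ + ‖fineSteps P γ ε β F ΔT J n ω u j - u‖ₑ +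
          (ΔT : ℝ≥0∞) ^ s * (1 + (fracNorm α u + fracNorm α v))) * ‖u - v‖ₑ) := by
  set w := fineSteps P γ ε β F ΔT J n ω u j
  set z := fineSteps P γ ε β F ΔT J n ω v j
  -- The defect is the second difference of `F` minus `e^{jδA} - 1` applied to `F u - F v`.
  have e : (F w - F z) - heatL (j * (ΔT / J)) (F u - F v) =
      ((F w - F z) - (F u - F v)) - (heatL (j * (ΔT / J)) (F u - F v) - (F u - F v)) := by abel
  rw [e]
  refine (fracNorm_sub_le _ _ _).trans ?_
  have h1 := hF.fracNorm_second_difference_le hs₀ u v w z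
  have h2 := hF.enorm_fineSteps_sub_le (P := P) (γ := γ) (ε := ε) (β := β) hΔ n ω u v hj
  have h3 := hF.fracNorm_fineSteps_sub_sub_le (P := P) (γ := γ) (ε := ε) (β := β) hs₀ hs₁ hΔ n ω
    u v hj
  have h4 : fracNorm (-s) (heatL (j * (ΔT / J)) (F u - F v) - (F u - F v)) ≤
      (ΔT : ℝ≥0∞) ^ s * (L * ‖u - v‖ₑ) := by
    refine (fracNorm_heatL_sub_le hs₀ hs₁ _ _ _).trans ?_
    rw [neg_add_cancel, fracNorm_zero_left]
    gcongr
    · exact step_mul_le ΔT hj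
    · exact hF.enorm_sub_le _ _
  set E := fineLip L
  set A := ‖z - v‖ₑ + ‖w - u‖ₑ
  set τ := (ΔT : ℝ≥0∞) ^ s
  set N := fracNorm α u + fracNorm α v
  set D := ‖u - v‖ₑ
  calc _ ≤ (M * A * (E * D) + C * (1 + N) * (τ * (1 + L * E) * D)) + τ * (L * D) := by
        refine add_le_add (h1.trans ?_) h4
        gcongr
    _ = M * E * (A * D) + C * (1 + L * E) * (τ * (1 + N) * D) + L * (τ * 1 * D) := by ring
    _ ≤ M * E * ((A + τ * (1 + N)) * D) + C * (1 + L * E) * ((A + τ * (1 + N)) * D) +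
        L * ((A + τ * (1 + N)) * D) := by
        gcongr
        · exact self_le_add_right _ _
        · exact self_le_add_left _ _
        · exact le_add_left (by gcongr; exact self_le_add_right _ _)
    _ = _ := by ring

end fine

end

end Parareal

namespace Parareal

noncomputable section

variable {Ω : Type*} [MeasurableSpace Ω]

/-! ### Moments of fractional norms -/

/-- The `L^p(Ω)`-norm of `|X|_r`. -/
def fracMoment (P : Measure Ω) (r : ℝ) (p : ℕ) (X : Ω → H) : ℝ≥0∞ :=
  eLpNorm (fun ω => fracNorm r (X ω)) p P

variable {P : Measure Ω} {p : ℕ} {r : ℝ} {X Y : Ω → H}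

theorem fracMoment_zero_left : fracMoment P 0 p X = eLpNorm X p P := by
  simp only [fracMoment, fracNorm_zero_left, eLpNorm_enorm]

theorem aestronglyMeasurable_fracNorm_comp (r : ℝ) (hX : StronglyMeasurable X) :
    AEStronglyMeasurable (fun ω => fracNorm r (X ω)) P :=
  (measurable_fracNorm_comp r hX).aestronglyMeasurable

theorem one_le_coe (hp : p ≠ 0) : (1 : ℝ≥0∞) ≤ p := by
  exact_mod_cast Nat.one_le_iff_ne_zero.2 hp

theorem eLpNorm_const_mul_le {f : Ω → ℝ≥0∞} {c : ℝ≥0∞} (hc : c ≠ ∞) :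
    eLpNorm (fun ω => c * f ω) p P ≤ c * eLpNorm f p P := by
  lift c to ℝ≥0 using hc
  exact eLpNorm_le_mul_eLpNorm_of_ae_le_mul' (ae_of_all _ fun ω => le_rfl) _

theorem eLpNorm_fun_add_le (hp : p ≠ 0) {f g : Ω → ℝ≥0∞} (hf : AEStronglyMeasurable f P)
    (hg : AEStronglyMeasurable g P) :
    eLpNorm (fun ω => f ω + g ω) p P ≤ eLpNorm f p P + eLpNorm g p P :=
  eLpNorm_add_le hf hg (one_le_coe hp)

theorem eLpNorm_fun_sum_le {ι : Type*} (hp : p ≠ 0) (s : Finset ι) {f : ι → Ω → ℝ≥0∞}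
    (hf : ∀ i ∈ s, AEStronglyMeasurable (f i) P) :
    eLpNorm (fun ω => ∑ i ∈ s, f i ω) p P ≤ ∑ i ∈ s, eLpNorm (f i) p P := by
  have h := eLpNorm_sum_le hf (one_le_coe hp)
  have h2 : (∑ i ∈ s, f i) = fun ω => ∑ i ∈ s, f i ω := by
    ext ω; simp
  rwa [h2] at h

theorem eLpNorm_const_eq [IsProbabilityMeasure P] (hp : p ≠ 0) (c : ℝ≥0∞) :
    eLpNorm (fun _ : Ω => c) p P = c := by
  rw [eLpNorm_const' c (by simpa using hp) (by simp)]
  simp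

/-- Cauchy–Schwarz; the doubled exponent is what forces the convergence induction to run over all
moments. -/
theorem eLpNorm_mul_le (hp : p ≠ 0) {f g : Ω → ℝ≥0∞} (hf : AEMeasurable f P)
    (hg : AEMeasurable g P) :
    eLpNorm (fun ω => f ω * g ω) p P ≤
      eLpNorm f ((2 * p : ℕ) : ℝ≥0∞) P * eLpNorm g ((2 * p : ℕ) : ℝ≥0∞) P := by
  have hp2 : ((2 * p : ℕ) : ℝ≥0∞) ≠ 0 := by simpa using hp
  have hp' : (p : ℝ) ≠ 0 := by exact_mod_cast hp
  rw [eLpNorm_eq_lintegral_rpow_enorm_toReal (by simpa using hp) (by simp),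
    eLpNorm_eq_lintegral_rpow_enorm_toReal hp2 (by finiteness),
    eLpNorm_eq_lintegral_rpow_enorm_toReal hp2 (by finiteness)]
  simp only [ENNReal.toReal_natCast, enorm_eq_self]
  have h := ENNReal.lintegral_mul_le_Lp_mul_Lq P (p := 2) (q := 2)
    (by rw [Real.holderConjugate_iff]; norm_num) (hf.pow_const (p : ℝ)) (hg.pow_const (p : ℝ))
  have e : ∀ x : ℝ≥0∞, (x ^ (p : ℝ)) ^ (2 : ℝ) = x ^ ((2 * p : ℕ) : ℝ) := fun x => by
    rw [← ENNReal.rpow_mul]; push_cast; ring_nf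
  simp only [Pi.mul_apply, e] at h
  simp_rw [ENNReal.mul_rpow_of_nonneg _ _ (Nat.cast_nonneg p)]
  refine (ENNReal.rpow_le_rpow h (by positivity)).trans (le_of_eq ?_)
  rw [ENNReal.mul_rpow_of_nonneg _ _ (by positivity), ← ENNReal.rpow_mul, ← ENNReal.rpow_mul]
  have e2 : (1 / 2 : ℝ) * (1 / p) = 1 / ((2 * p : ℕ) : ℝ) := by
    push_cast; field_simp
  rw [e2]

theorem fracMoment_mono {r s : ℝ} (h : ∀ ω, fracNorm r (X ω) ≤ fracNorm s (Y ω)) :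
    fracMoment P r p X ≤ fracMoment P s p Y :=
  eLpNorm_mono_enorm fun ω => h ω

theorem fracMoment_le_mul {r s : ℝ} {c : ℝ≥0∞} (hc : c ≠ ∞)
    (h : ∀ ω, fracNorm r (X ω) ≤ c * fracNorm s (Y ω)) :
    fracMoment P r p X ≤ c * fracMoment P s p Y :=
  (eLpNorm_mono_enorm fun ω => h ω).trans (eLpNorm_const_mul_le hc)

theorem fracMoment_mono_left {r s : ℝ} (h : r ≤ s) : fracMoment P r p X ≤ fracMoment P s p X :=
  fracMoment_mono fun _ => fracNorm_mono h _

theorem fracMoment_mono_exponent [IsProbabilityMeasure P] {p q : ℕ} (h : p ≤ q)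
    (hX : StronglyMeasurable X) : fracMoment P r p X ≤ fracMoment P r q X :=
  eLpNorm_le_eLpNorm_of_exponent_le (by exact_mod_cast h) (aestronglyMeasurable_fracNorm_comp r hX)

theorem fracMoment_const [IsProbabilityMeasure P] (hp : p ≠ 0) (u : H) :
    fracMoment P r p (fun _ => u) = fracNorm r u := eLpNorm_const_eq hp _

theorem fracMoment_add_le (hp : p ≠ 0) (hX : StronglyMeasurable X) (hY : StronglyMeasurable Y) :
    fracMoment P r p (fun ω => X ω + Y ω) ≤ fracMoment P r p X + fracMoment P r p Y :=
  (eLpNorm_mono_enorm fun _ => fracNorm_add_le r _ _).trans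
    (eLpNorm_fun_add_le hp (aestronglyMeasurable_fracNorm_comp r hX)
      (aestronglyMeasurable_fracNorm_comp r hY))

theorem fracMoment_sub_le (hp : p ≠ 0) (hX : StronglyMeasurable X) (hY : StronglyMeasurable Y) :
    fracMoment P r p (fun ω => X ω - Y ω) ≤ fracMoment P r p X + fracMoment P r p Y :=
  (eLpNorm_mono_enorm fun _ => fracNorm_sub_le r _ _).trans
    (eLpNorm_fun_add_le hp (aestronglyMeasurable_fracNorm_comp r hX)
      (aestronglyMeasurable_fracNorm_comp r hY))

theorem fracMoment_sum_le {ι : Type*} (hp : p ≠ 0) (s : Finset ι) {f : ι → Ω → H}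
    (hf : ∀ i ∈ s, StronglyMeasurable (f i)) :
    fracMoment P r p (fun ω => ∑ i ∈ s, f i ω) ≤ ∑ i ∈ s, fracMoment P r p (f i) :=
  (eLpNorm_mono_enorm fun _ => fracNorm_sum_le r _ _).trans
    (eLpNorm_fun_sum_le hp s fun i hi => aestronglyMeasurable_fracNorm_comp r (hf i hi))

theorem fracMoment_heatL_le (t : ℝ≥0) :
    fracMoment P r p (fun ω => heatL t (X ω)) ≤ fracMoment P r p X :=
  fracMoment_mono fun _ => fracNorm_heatL_le_self _ _ _

theorem stronglyMeasurable_heatL (t : ℝ≥0) (hX : StronglyMeasurable X) :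
    StronglyMeasurable fun ω => heatL t (X ω) := (heatL t).continuous.comp_stronglyMeasurable hX

theorem stronglyMeasurable_smul_heatL (δ t : ℝ≥0) (hX : StronglyMeasurable X) :
    StronglyMeasurable fun ω => (δ : ℝ) • heatL t (X ω) :=
  (stronglyMeasurable_heatL t hX).const_smul (δ : ℝ)

theorem fracMoment_smul_heatL_le {b : ℝ} (hb₀ : 0 ≤ b) (hb₁ : b ≤ 1) (δ : ℝ≥0) {t : ℝ≥0}
    (ht : 0 < t) :
    fracMoment P r p (fun ω => (δ : ℝ) • heatL t (X ω)) ≤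
      δ * (t : ℝ≥0∞) ^ (-b) * fracMoment P (r - b) p X := by
  refine fracMoment_le_mul (ENNReal.mul_ne_top ENNReal.coe_ne_top
    (ENNReal.rpow_ne_top_of_ne_zero (by exact_mod_cast ht.ne') ENNReal.coe_ne_top)) fun ω => ?_
  refine (fracNorm_smul_le _ _ _).trans ?_
  rw [mul_assoc]
  gcongr
  · simp
  · exact fracNorm_heatL_le hb₀ hb₁ ht _ _

theorem fracMoment_convSum_le (hp : p ≠ 0) {δ : ℝ≥0} (hδ : 0 < δ) {b : ℝ} (hb₀ : 0 ≤ b)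
    (hb₁ : b ≤ 1) {J N : ℕ} {g : ℕ → ℕ → Ω → H} (hg : ∀ n j, StronglyMeasurable (g n j)) :
    fracMoment P r p (fun ω => convSum δ J N fun n j => g n j ω) ≤
      ∑ n ∈ Finset.range N, ∑ j ∈ Finset.range J,
        δ * ((((N * J - (n * J + j) : ℕ) * δ : ℝ≥0)) : ℝ≥0∞) ^ (-b) *
          fracMoment P (r - b) p (g n j) := by
  have hm : ∀ n j, StronglyMeasurable fun ω =>
      (δ : ℝ) • heatL ((N * J - (n * J + j) : ℕ) * δ) (g n j ω) := fun n j =>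
    stronglyMeasurable_smul_heatL _ _ (hg n j)
  refine (fracMoment_sum_le hp _ fun n _ =>
    Finset.stronglyMeasurable_fun_sum _ fun j _ => hm n j).trans ?_
  refine Finset.sum_le_sum fun n hn => ?_
  refine (fracMoment_sum_le hp _ fun j _ => hm n j).trans ?_
  refine Finset.sum_le_sum fun j hj => ?_
  refine fracMoment_smul_heatL_le hb₀ hb₁ δ (mul_pos ?_ hδ)
  have hn := Finset.mem_range.1 hn
  have hj := Finset.mem_range.1 hj
  have h1 : (n + 1) * J ≤ N * J := Nat.mul_le_mul_right J hn
  have : 0 < N * J - (n * J + j) := by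
    rw [Nat.succ_mul] at h1
    omega
  exact_mod_cast this

/-! ### Moment bounds for mild recursions -/

section mild

variable {δ : ℝ≥0} {J : ℕ} {U : ℕ → Ω → H} {g : ℕ → ℕ → Ω → H} {Z : ℕ → Ω → H} {T : ℝ}

theorem stronglyMeasurable_convSum (N : ℕ) (hg : ∀ n j, StronglyMeasurable (g n j)) :
    StronglyMeasurable fun ω => convSum δ J N fun n j => g n j ω :=
  Finset.stronglyMeasurable_fun_sum _ fun n _ => Finset.stronglyMeasurable_fun_sum _ fun j _ =>
    stronglyMeasurable_smul_heatL _ _ (hg n j)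

theorem fracMoment_convSum_le_of_le (hp : p ≠ 0) (hδ : 0 < δ) {b : ℝ} (hb₀ : 0 ≤ b)
    (hb₁ : b < 1) {N : ℕ} (hT : (N : ℝ) * (J * δ) ≤ T) (hg : ∀ n j, StronglyMeasurable (g n j))
    {A : ℝ≥0∞} (hA : ∀ n < N, ∀ j < J, fracMoment P (r - b) p (g n j) ≤ A) :
    fracMoment P r p (fun ω => convSum δ J N fun n j => g n j ω) ≤ kernelConst T b * A := by
  refine (fracMoment_convSum_le hp hδ hb₀ hb₁.le hg).trans ?_
  refine le_trans ?_ (mul_le_mul_left (sum_kernel_le hδ hb₀ hb₁ hT) A)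
  simp_rw [Finset.sum_mul]
  refine Finset.sum_le_sum fun n hn => Finset.sum_le_sum fun j hj => ?_
  gcongr
  exact hA n (Finset.mem_range.1 hn) j (Finset.mem_range.1 hj)

theorem IsMild.fracMoment_le_of_le (hU : ∀ ω, IsMild δ J (fun n => U n ω) (fun n j => g n j ω)
      (fun n => Z n ω)) (hp : p ≠ 0) (hδ : 0 < δ) {b : ℝ} (hb₀ : 0 ≤ b) (hb₁ : b < 1) {N : ℕ}
    (hT : (N : ℝ) * (J * δ) ≤ T) (hU0 : StronglyMeasurable (U 0))
    (hg : ∀ n j, StronglyMeasurable (g n j)) (hZ : ∀ n, StronglyMeasurable (Z n)) {A : ℝ≥0∞}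
    (hA : ∀ n < N, ∀ j < J, fracMoment P (r - b) p (g n j) ≤ A) :
    fracMoment P r p (U N) ≤
      fracMoment P r p (U 0) + kernelConst T b * A + fracMoment P r p (Z N) := by
  have he : U N = fun ω => heatL (N * (J * δ)) (U 0 ω) + convSum δ J N (fun n j => g n j ω) +
    Z N ω := funext fun ω => (hU ω).eq N
  have hc := stronglyMeasurable_convSum (δ := δ) (J := J) N hg
  have hh := stronglyMeasurable_heatL (N * (J * δ)) hU0
  rw [he]
  refine (fracMoment_add_le hp (hh.add hc) (hZ N)).trans ?_
  gcongr
  refine (fracMoment_add_le hp hh hc).trans ?_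
  exact add_le_add (fracMoment_heatL_le _) (fracMoment_convSum_le_of_le hp hδ hb₀ hb₁ hT hg hA)

/-- Gronwall's inequality for the moments of a mild recursion whose drift is a Lipschitz part `g`
and a small part `k` measured in a negative norm. -/
theorem IsMild.fracMoment_zero_le {k : ℕ → ℕ → Ω → H}
    (hU : ∀ ω, IsMild δ J (fun n => U n ω) (fun n j => g n j ω + k n j ω) (fun n => Z n ω))
    (hp : p ≠ 0) (hδ : 0 < δ) {b : ℝ} (hb₀ : 0 ≤ b) (hb₁ : b < 1) {N : ℕ}
    (hT : (N : ℝ) * (J * δ) ≤ T) (hU0 : StronglyMeasurable (U 0))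
    (hg : ∀ n j, StronglyMeasurable (g n j)) (hk : ∀ n j, StronglyMeasurable (k n j))
    (hZ : ∀ n, StronglyMeasurable (Z n)) {L : ℝ≥0} {A₁ A₂ B : ℝ≥0∞}
    (hA₁ : ∀ n < N, ∀ j < J, fracMoment P 0 p (g n j) ≤ L * fracMoment P 0 p (U n) + A₁)
    (hA₂ : ∀ n < N, ∀ j < J, fracMoment P (-b) p (k n j) ≤ A₂)
    (hB : ∀ n ≤ N, fracMoment P 0 p (Z n) ≤ B) :
    ∀ n ≤ N, fracMoment P 0 p (U n) ≤
      (fracMoment P 0 p (U 0) + ENNReal.ofReal T * A₁ + kernelConst T b * A₂ + B) *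
        ENNReal.ofReal (Real.exp (L * T)) := by
  have hTn : ∀ n ≤ N, (n : ℝ) * (J * δ) ≤ T := fun n hn => by
    refine le_trans ?_ hT
    gcongr
  have key : ∀ n ≤ N, fracMoment P 0 p (U n) ≤
      (fracMoment P 0 p (U 0) + ENNReal.ofReal T * A₁ + kernelConst T b * A₂ + B) +
        L * ((J * δ : ℝ≥0) : ℝ≥0∞) * ∑ i ∈ Finset.range n, fracMoment P 0 p (U i) := by
    intro n hn
    have he : U n = fun ω => heatL (n * (J * δ)) (U 0 ω) +
        (convSum δ J n (fun n j => g n j ω) + convSum δ J n (fun n j => k n j ω)) + Z n ω :=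
      funext fun ω => by
        rw [(hU ω).eq n]
        congr 2
        simp only [convSum, map_add, smul_add, Finset.sum_add_distrib]
    have hc := stronglyMeasurable_convSum (δ := δ) (J := J) n hg
    have hc' := stronglyMeasurable_convSum (δ := δ) (J := J) n hk
    have hh := stronglyMeasurable_heatL (n * (J * δ)) hU0
    -- The Lipschitz part is estimated in `H` without smoothing, so the memory term has constant
    -- weights and the plain Gronwall inequality applies; the singular kernel falls only on `k`,
    -- which does not involve the unknown.
    have h1 : fracMoment P 0 p (fun ω => convSum δ J n fun n j => g n j ω) ≤
        ENNReal.ofReal T * A₁ +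
          L * ((J * δ : ℝ≥0) : ℝ≥0∞) * ∑ i ∈ Finset.range n, fracMoment P 0 p (U i) := by
      refine (fracMoment_convSum_le hp hδ le_rfl zero_le_one hg).trans ?_
      calc _ ≤ ∑ i ∈ Finset.range n, ∑ j ∈ Finset.range J,
            ((δ : ℝ≥0∞) * A₁ + L * δ * fracMoment P 0 p (U i)) := by
            refine Finset.sum_le_sum fun i hi => Finset.sum_le_sum fun j hj => ?_
            have h2 := hA₁ i ((Finset.mem_range.1 hi).trans_le hn) j (Finset.mem_range.1 hj)
            rw [neg_zero, ENNReal.rpow_zero, mul_one, sub_zero]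
            calc _ ≤ (δ : ℝ≥0∞) * (L * fracMoment P 0 p (U i) + A₁) := by gcongr
              _ = _ := by ring
        _ = (∑ _i ∈ Finset.range n, ∑ _j ∈ Finset.range J, (δ : ℝ≥0∞)) * A₁ +
            L * ((J * δ : ℝ≥0) : ℝ≥0∞) * ∑ i ∈ Finset.range n, fracMoment P 0 p (U i) := by
            simp only [Finset.sum_add_distrib, Finset.sum_const, Finset.card_range, nsmul_eq_mul,
              Finset.mul_sum]
            push_cast
            congr 1
            · ring
            · refine Finset.sum_congr rfl fun i _ => ?_
              ring
        _ ≤ _ := by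
            gcongr
            exact sum_delta_le (hTn n hn)
    have h2 : fracMoment P 0 p (fun ω => convSum δ J n fun n j => k n j ω) ≤
        kernelConst T b * A₂ :=
      fracMoment_convSum_le_of_le hp hδ hb₀ hb₁ (hTn n hn) hk fun i hi j hj => by
        rw [zero_sub]
        exact hA₂ i (hi.trans_le hn) j hj
    calc fracMoment P 0 p (U n) ≤ fracMoment P 0 p (U 0) +
          ((ENNReal.ofReal T * A₁ +
            L * ((J * δ : ℝ≥0) : ℝ≥0∞) * ∑ i ∈ Finset.range n, fracMoment P 0 p (U i)) +
              kernelConst T b * A₂) + B := by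
          nth_rewrite 1 [he]
          refine (fracMoment_add_le hp (hh.add (hc.add hc')) (hZ n)).trans ?_
          refine add_le_add ?_ (hB n hn)
          refine (fracMoment_add_le hp hh (hc.add hc')).trans ?_
          refine add_le_add (fracMoment_heatL_le _) ?_
          exact (fracMoment_add_le hp hc hc').trans (add_le_add h1 h2)
      _ = _ := by ring
  intro n hn
  refine (gronwall_sum key n hn).trans ?_
  gcongr
  refine one_add_pow_le_exp ?_
  push_cast
  exact hTn n hn

end mild

end

end Parareal

namespace Parareal

noncomputable section

variable {Ω : Type*} [MeasurableSpace Ω] {P : Measure Ω} {γ : ℕ → ℝ} {ε : HilbertBasis ℕ ℝ H}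
  {β : ℕ → ℝ≥0 → Ω → ℝ} {α T : ℝ} {p : ℕ}

/-! ### Uniform bounds for the stochastic convolutions -/

/-- Bounds for the discrete stochastic convolutions, uniform in the two step sizes. -/
structure NoiseBounds (P : Measure Ω) (γ : ℕ → ℝ) (ε : HilbertBasis ℕ ℝ H)
    (β : ℕ → ℝ≥0 → Ω → ℝ) (α T : ℝ) (p : ℕ) (B : ℝ≥0∞) : Prop where
  fine_step : ∀ ΔT : ℝ≥0, 0 < ΔT → ΔT < 1 → ∀ J : ℕ, J ≠ 0 → ∀ n, ∀ j ≤ J,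
    fracMoment P 0 p (stochConv P γ ε β (ΔT / J) (n * ΔT) j) ≤ B * (ΔT : ℝ≥0∞) ^ α
  fine : ∀ ΔT : ℝ≥0, 0 < ΔT → ∀ J : ℕ, J ≠ 0 → ∀ n : ℕ, (n : ℝ) * ΔT ≤ T →
    fracMoment P α p (stochConv P γ ε β (ΔT / J) 0 (n * J)) ≤ B
  coarse_sub_fine : ∀ ΔT : ℝ≥0, 0 < ΔT → ∀ J : ℕ, J ≠ 0 → ∀ n : ℕ, (n : ℝ) * ΔT ≤ T →
    fracMoment P 0 p (fun ω => stochConv P γ ε β ΔT 0 n ω -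
      stochConv P γ ε β (ΔT / J) 0 (n * J) ω) ≤ B * (ΔT : ℝ≥0∞) ^ α

theorem NoiseBounds.coarse {B : ℝ≥0∞} (h : NoiseBounds P γ ε β α T p B) {ΔT : ℝ≥0} (hΔ : 0 < ΔT)
    {n : ℕ} (hn : (n : ℝ) * ΔT ≤ T) : fracMoment P α p (stochConv P γ ε β ΔT 0 n) ≤ B := by
  simpa using h.fine ΔT hΔ 1 one_ne_zero n hn

theorem ofReal_sq_mul_mul_rpow_half {x : ℝ} (hx : 0 ≤ x) (y : ℝ) (c : ℝ≥0∞) :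
    (ENNReal.ofReal (x ^ 2 * y) * c) ^ (1 / 2 : ℝ) =
      (ENNReal.ofReal y * c) ^ (1 / 2 : ℝ) * ENNReal.ofReal x := by
  rw [ENNReal.ofReal_mul (by positivity), mul_assoc, ENNReal.mul_rpow_of_nonneg _ _ (by norm_num),
    ENNReal.ofReal_pow hx, ← ENNReal.rpow_natCast, ← ENNReal.rpow_mul]
  norm_num [mul_comm]

theorem natCast_mul_step {ΔT : ℝ≥0} {J : ℕ} (hJ : J ≠ 0) :
    (J : ℝ) * ((ΔT / J : ℝ≥0) : ℝ) = ΔT := by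
  have hJ' : (J : ℝ≥0) ≠ 0 := by exact_mod_cast hJ
  exact_mod_cast mul_div_cancel₀ ΔT hJ'

theorem exists_noiseBounds [IsProbabilityMeasure P] (hβ : IsIndepWiener P β) (hγ : ∀ p, 0 ≤ γ p)
    {a : ℝ} (ha₁ : a ≤ 1 / 2) (hQ : hsNormSq (a - 1 / 2) γ ε < ∞) (hα : 0 ≤ α) (hαa : α < a)
    (T : ℝ) (hp : p ≠ 0) : ∃ B ≠ ∞, NoiseBounds P γ ε β α T p B := by
  -- The convolution bounds are available for even exponents; on a probability space the `p`-th
  -- moment norm is below the `2p`-th.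
  have hpp : p ≤ 2 * p := by omega
  have ha₀ : 0 < a := hα.trans_lt hαa
  set q := hsNormSq (a - 1 / 2) γ ε
  -- The constant `b₁` serves one coarse interval, once the power of its length is taken out. The
  -- constant `b₂` serves convolutions up to time `T`, where `a - α` is what remains after spending
  -- `α` either on spatial regularity or on the rate.
  let b₁ := (ENNReal.ofReal (1 / (2 * a)) * q) ^ (1 / 2 : ℝ)
  let b₂ := (ENNReal.ofReal (T ^ (2 * (a - α)) / (2 * (a - α))) * q) ^ (1 / 2 : ℝ)
  have hb : ∀ y : ℝ, (ENNReal.ofReal y * q) ^ (1 / 2 : ℝ) ≠ ∞ := fun y =>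
    ENNReal.rpow_ne_top_of_nonneg (by norm_num) (ENNReal.mul_ne_top ENNReal.ofReal_ne_top hQ.ne)
  have hofReal : ∀ ΔT : ℝ≥0, 0 < ΔT → ENNReal.ofReal ((ΔT : ℝ) ^ α) = (ΔT : ℝ≥0∞) ^ α :=
    fun ΔT hΔ => by
      rw [← ENNReal.ofReal_rpow_of_pos (by exact_mod_cast hΔ), ENNReal.ofReal_coe_nnreal]
  have hδ : ∀ (ΔT : ℝ≥0) (J : ℕ), 0 < ΔT → J ≠ 0 → 0 < ΔT / J := fun ΔT J hΔ hJ =>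
    div_pos hΔ (by exact_mod_cast Nat.pos_of_ne_zero hJ)
  refine ⟨momentConst (2 * p) * (b₁ + b₂), ENNReal.mul_ne_top (momentConst_ne_top _)
    (ENNReal.add_ne_top.2 ⟨hb _, hb _⟩), ?_, ?_, ?_⟩
  · intro ΔT hΔ hΔ₁ J hJ n j hj
    refine (fracMoment_mono_exponent hpp (stronglyMeasurable_stochConv P γ ε β _ _ _)).trans ?_
    refine (eLpNorm_fracNorm_stochConv_le hβ hγ hp ha₁ hQ le_rfl ha₀ (hδ ΔT J hΔ hJ) _ _).trans ?_
    rw [mul_assoc]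
    gcongr
    refine le_trans ?_ (mul_le_mul_left le_self_add ((ΔT : ℝ≥0∞) ^ α))
    rw [← hofReal ΔT hΔ, ← ofReal_sq_mul_mul_rpow_half (by positivity)]
    gcongr
    rw [sub_zero, ← Real.rpow_mul_natCast (by positivity), mul_one_div]
    gcongr
    have h1 : (j : ℝ) * ((ΔT / J : ℝ≥0) : ℝ) ≤ ΔT := by exact_mod_cast step_mul_le ΔT hj
    calc ((j : ℝ) * ((ΔT / J : ℝ≥0) : ℝ)) ^ (2 * a) ≤ (ΔT : ℝ) ^ (2 * a) := by gcongr
      -- The exponent `2a` is lowered to `2α`, which uses `ΔT < 1`.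
      _ ≤ (ΔT : ℝ) ^ (α * (2 : ℕ)) :=
        Real.rpow_le_rpow_of_exponent_ge (by exact_mod_cast hΔ) (by exact_mod_cast hΔ₁.le)
          (by push_cast; linarith)
  · intro ΔT hΔ J hJ n hn
    refine (fracMoment_mono_exponent hpp (stronglyMeasurable_stochConv P γ ε β _ _ _)).trans ?_
    refine (eLpNorm_fracNorm_stochConv_le hβ hγ hp ha₁ hQ hα hαa (hδ ΔT J hΔ hJ) _ _).trans ?_
    gcongr
    refine le_trans ?_ le_add_self
    simp only [b₂]
    have := natCast_mul_step (ΔT := ΔT) hJ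
    have h0 : 0 ≤ a - α := by linarith
    gcongr
    push_cast at this ⊢
    rw [mul_assoc, this]
    exact hn
  · intro ΔT hΔ J hJ n hn
    have hs : (J : ℝ≥0) * (ΔT / J) = ΔT := by exact_mod_cast natCast_mul_step (ΔT := ΔT) hJ
    have hsm : StronglyMeasurable fun ω => stochConv P γ ε β ΔT 0 n ω -
        stochConv P γ ε β (ΔT / J) 0 (n * J) ω :=
      (stronglyMeasurable_stochConv P γ ε β _ _ _).sub (stronglyMeasurable_stochConv P γ ε β _ _ _)
    refine (fracMoment_mono_exponent hpp hsm).trans ?_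
    rw [fracMoment_zero_left]
    have h := eLpNorm_stochConv_sub_le (n := p) hβ hγ hp ha₁ hQ hα hαa (hδ ΔT J hΔ hJ) hJ n
    rw [hs] at h
    refine h.trans ?_
    rw [mul_assoc]
    gcongr
    refine le_trans ?_ (mul_le_mul_left le_add_self ((ΔT : ℝ≥0∞) ^ α))
    have hs' := natCast_mul_step (ΔT := ΔT) hJ
    rw [← hofReal ΔT hΔ, ← ofReal_sq_mul_mul_rpow_half (by positivity), hs']
    have h0 : 0 ≤ a - α := by linarith
    gcongr
    push_cast at hs' ⊢
    rw [mul_assoc, hs']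
    exact hn

/-! ### Measurability of the schemes -/

variable {F : H → H} {ΔT : ℝ≥0} {J : ℕ} {X Y : Ω → H}

theorem stronglyMeasurable_expEuler (hF : Continuous F) (h s : ℝ≥0) (hX : StronglyMeasurable X) :
    StronglyMeasurable fun ω => expEuler P γ ε β F h s ω (X ω) :=
  ((stronglyMeasurable_heatL h hX).add (stronglyMeasurable_smul_heatL h h
    (hF.comp_stronglyMeasurable hX))).add (stronglyMeasurable_smoothedIncrement P γ ε β h s (s + h))

theorem stronglyMeasurable_fineSteps (hF : Continuous F) (n : ℕ) (hX : StronglyMeasurable X)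
    (j : ℕ) : StronglyMeasurable fun ω => fineSteps P γ ε β F ΔT J n ω (X ω) j := by
  induction j with
  | zero => exact hX
  | succ j ih => exact stronglyMeasurable_expEuler hF _ _ ih

theorem stronglyMeasurable_reference (hF : Continuous F) (u₀ : H) (n : ℕ) :
    StronglyMeasurable fun ω => reference P γ ε β F u₀ ΔT J ω n := by
  induction n with
  | zero => exact stronglyMeasurable_const
  | succ n ih => exact stronglyMeasurable_fineSteps hF n ih J

theorem stronglyMeasurable_parareal (hF : Continuous F) (u₀ : H) (k n : ℕ) :
    StronglyMeasurable fun ω => parareal P γ ε β F u₀ ΔT J ω k n := by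
  induction k generalizing n with
  | zero =>
    induction n with
    | zero => simpa only [parareal_zero_right] using stronglyMeasurable_const
    | succ n ih =>
      simp only [parareal]
      exact stronglyMeasurable_expEuler hF _ _ ih
  | succ k ihk =>
    induction n with
    | zero => simpa only [parareal_zero_right] using stronglyMeasurable_const
    | succ n ih =>
      simp only [parareal]
      exact ((stronglyMeasurable_expEuler hF _ _ ih).add
        (stronglyMeasurable_fineSteps hF n (ihk n) J)).sub (stronglyMeasurable_expEuler hF _ _ (ihk n))

/-! ### Moments of the fine integrator -/

variable {s : ℝ} {L M C : ℝ≥0} {B : ℝ≥0∞}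

theorem DriftBounds.fracMoment_comp_le [IsProbabilityMeasure P] (hF : DriftBounds F α s L M C)
    (hp : p ≠ 0) (hX : StronglyMeasurable X) :
    fracMoment P 0 p (fun ω => F (X ω)) ≤ L * (1 + fracMoment P 0 p X) := by
  simp only [fracMoment, fracNorm_zero_left]
  calc _ ≤ eLpNorm (fun ω => (L : ℝ≥0∞) * (1 + ‖X ω‖ₑ)) p P :=
        eLpNorm_mono_enorm fun ω => hF.enorm_le _
    _ ≤ L * eLpNorm (fun ω => 1 + ‖X ω‖ₑ) p P := eLpNorm_const_mul_le ENNReal.coe_ne_top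
    _ ≤ L * (eLpNorm (fun _ : Ω => (1 : ℝ≥0∞)) p P + eLpNorm (fun ω => ‖X ω‖ₑ) p P) := by
        gcongr
        exact eLpNorm_fun_add_le hp aestronglyMeasurable_const
          hX.enorm.aestronglyMeasurable
    _ = _ := by rw [eLpNorm_const_eq hp]

theorem DriftBounds.fracMoment_comp_sub_le (hF : DriftBounds F α s L M C) :
    fracMoment P 0 p (fun ω => F (X ω) - F (Y ω)) ≤ L * fracMoment P 0 p (fun ω => X ω - Y ω) :=
  fracMoment_le_mul ENNReal.coe_ne_top fun ω => by
    simpa only [fracNorm_zero_left] using hF.enorm_sub_le _ _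

theorem fracMoment_fineSteps_drift_le (hF : Continuous F) (hp : p ≠ 0) (n : ℕ)
    (hX : StronglyMeasurable X) (j : ℕ) :
    fracMoment P 0 p (fun ω => ∑ i ∈ Finset.range j, ((ΔT / J : ℝ≥0) : ℝ) •
        heatL ((j - i : ℕ) * (ΔT / J)) (F (fineSteps P γ ε β F ΔT J n ω (X ω) i))) ≤
      ((ΔT / J : ℝ≥0) : ℝ≥0∞) * ∑ i ∈ Finset.range j,
        fracMoment P 0 p (fun ω => F (fineSteps P γ ε β F ΔT J n ω (X ω) i)) := by
  refine (fracMoment_sum_le hp _ fun i _ => stronglyMeasurable_smul_heatL _ _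
    (hF.comp_stronglyMeasurable (stronglyMeasurable_fineSteps hF n hX i))).trans ?_
  rw [Finset.mul_sum]
  refine Finset.sum_le_sum fun i _ => fracMoment_le_mul ENNReal.coe_ne_top fun ω => ?_
  rw [fracNorm_zero_left, fracNorm_zero_left, enorm_smul_nnreal]
  gcongr
  exact enorm_heatL_le _ _

/-- Gronwall over one coarse interval: its length is below `1`, so the constant does not depend on
`J`. -/
theorem fracMoment_fineSteps_le [IsProbabilityMeasure P] (hF : DriftBounds F α s L M C)
    (hB : NoiseBounds P γ ε β α T p B) (hα : 0 ≤ α) (hp : p ≠ 0) (hΔ₀ : 0 < ΔT) (hΔ₁ : ΔT < 1)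
    (hJ : J ≠ 0) (n : ℕ) (hX : StronglyMeasurable X) {j : ℕ} (hj : j ≤ J) :
    fracMoment P 0 p (fun ω => fineSteps P γ ε β F ΔT J n ω (X ω) j) ≤
      (fracMoment P 0 p X + L + B) * fineLip L := by
  have hc := hF.continuous
  have hV := fun i => stronglyMeasurable_fineSteps (P := P) (γ := γ) (ε := ε) (β := β)
    (ΔT := ΔT) (J := J) hc n hX i
  have h := gronwall_sum (x := fun j => fracMoment P 0 p fun ω =>
      fineSteps P γ ε β F ΔT J n ω (X ω) j)
    (K := fracMoment P 0 p X + L + B) (c := L * ((ΔT / J : ℝ≥0) : ℝ≥0∞)) (N := J)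
    (fun j hj => by
      have hh := stronglyMeasurable_heatL (j * (ΔT / J)) hX
      have hs : StronglyMeasurable fun ω => ∑ i ∈ Finset.range j, ((ΔT / J : ℝ≥0) : ℝ) •
          heatL ((j - i : ℕ) * (ΔT / J)) (F (fineSteps P γ ε β F ΔT J n ω (X ω) i)) :=
        Finset.stronglyMeasurable_fun_sum _ fun i _ => stronglyMeasurable_smul_heatL _ _
          (hc.comp_stronglyMeasurable (hV i))
      have hz := stronglyMeasurable_stochConv P γ ε β (ΔT / J) (n * ΔT) j
      simp only [fineSteps_eq P γ ε β F ΔT J n _ _ j]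
      have h1 : fracMoment P 0 p (fun ω => ∑ i ∈ Finset.range j, ((ΔT / J : ℝ≥0) : ℝ) •
          heatL ((j - i : ℕ) * (ΔT / J)) (F (fineSteps P γ ε β F ΔT J n ω (X ω) i))) ≤
          L + L * ((ΔT / J : ℝ≥0) : ℝ≥0∞) * ∑ i ∈ Finset.range j,
            fracMoment P 0 p fun ω => fineSteps P γ ε β F ΔT J n ω (X ω) i := by
        refine (fracMoment_fineSteps_drift_le hc hp n hX j).trans ?_
        calc _ ≤ ((ΔT / J : ℝ≥0) : ℝ≥0∞) * ∑ i ∈ Finset.range j, L * (1 +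
              fracMoment P 0 p fun ω => fineSteps P γ ε β F ΔT J n ω (X ω) i) := by
              gcongr
              exact hF.fracMoment_comp_le hp (hV _)
          _ = (((j : ℝ≥0) * (ΔT / J) : ℝ≥0) : ℝ≥0∞) * L +
              L * ((ΔT / J : ℝ≥0) : ℝ≥0∞) * ∑ i ∈ Finset.range j,
                fracMoment P 0 p fun ω => fineSteps P γ ε β F ΔT J n ω (X ω) i := by
              rw [← Finset.mul_sum, Finset.sum_add_distrib, Finset.sum_const, Finset.card_range,
                nsmul_eq_mul]
              push_cast
              ring
          _ ≤ _ := by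
              gcongr
              refine mul_le_of_le_one_left' ?_
              exact_mod_cast (step_mul_le ΔT hj).trans hΔ₁.le
      have h2 : fracMoment P 0 p (stochConv P γ ε β (ΔT / J) (n * ΔT) j) ≤ B := by
        refine (hB.fine_step ΔT hΔ₀ hΔ₁ J hJ n j hj).trans (mul_le_of_le_one_right' ?_)
        exact ENNReal.rpow_le_one (by exact_mod_cast hΔ₁.le) hα
      refine (fracMoment_add_le hp (hh.add hs) hz).trans ?_
      refine (add_le_add ((fracMoment_add_le hp hh hs).trans
        (add_le_add (fracMoment_heatL_le _) h1)) h2).trans (le_of_eq ?_)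
      ring) j hj
  refine h.trans ?_
  gcongr
  exact one_add_pow_le_exp (step_mul_le_one hΔ₁.le hj)

/-- Over one coarse interval the initial value moves by `ΔT^α |X|_α` under the semigroup, the drift
contributes `ΔT ≤ ΔT^α`, and the noise contributes `ΔT^α`. -/
theorem fracMoment_fineSteps_sub_le [IsProbabilityMeasure P] (hF : DriftBounds F α s L M C)
    (hB : NoiseBounds P γ ε β α T p B) (hα : 0 ≤ α) (hα₁ : α ≤ 1) (hp : p ≠ 0) (hΔ₀ : 0 < ΔT)
    (hΔ₁ : ΔT < 1) (hJ : J ≠ 0) (n : ℕ) (hX : StronglyMeasurable X) {j : ℕ} (hj : j ≤ J) :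
    fracMoment P 0 p (fun ω => fineSteps P γ ε β F ΔT J n ω (X ω) j - X ω) ≤
      (fracMoment P α p X + L * (1 + (fracMoment P 0 p X + L + B) * fineLip L) + B) *
        (ΔT : ℝ≥0∞) ^ α := by
  have hc := hF.continuous
  have hV := fun i => stronglyMeasurable_fineSteps (P := P) (γ := γ) (ε := ε) (β := β)
    (ΔT := ΔT) (J := J) hc n hX i
  have hh : StronglyMeasurable fun ω => heatL (j * (ΔT / J)) (X ω) - X ω :=
    (stronglyMeasurable_heatL (j * (ΔT / J)) hX).sub hX
  have hs : StronglyMeasurable fun ω => ∑ i ∈ Finset.range j, ((ΔT / J : ℝ≥0) : ℝ) •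
      heatL ((j - i : ℕ) * (ΔT / J)) (F (fineSteps P γ ε β F ΔT J n ω (X ω) i)) :=
    Finset.stronglyMeasurable_fun_sum _ fun i _ => stronglyMeasurable_smul_heatL _ _
      (hc.comp_stronglyMeasurable (hV i))
  have hz := stronglyMeasurable_stochConv P γ ε β (ΔT / J) (n * ΔT) j
  have e : (fun ω => fineSteps P γ ε β F ΔT J n ω (X ω) j - X ω) = fun ω =>
      (heatL (j * (ΔT / J)) (X ω) - X ω) + (∑ i ∈ Finset.range j, ((ΔT / J : ℝ≥0) : ℝ) •
        heatL ((j - i : ℕ) * (ΔT / J)) (F (fineSteps P γ ε β F ΔT J n ω (X ω) i))) +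
      stochConv P γ ε β (ΔT / J) (n * ΔT) j ω := by
    funext ω
    rw [fineSteps_eq]
    abel
  have h1 : fracMoment P 0 p (fun ω => heatL (j * (ΔT / J)) (X ω) - X ω) ≤
      (ΔT : ℝ≥0∞) ^ α * fracMoment P α p X := by
    refine fracMoment_le_mul (ENNReal.rpow_ne_top_of_nonneg hα ENNReal.coe_ne_top) fun ω => ?_
    refine (fracNorm_heatL_sub_le hα hα₁ _ _ _).trans ?_
    rw [zero_add]
    gcongr
    exact step_mul_le ΔT hj
  have h2 : fracMoment P 0 p (fun ω => ∑ i ∈ Finset.range j, ((ΔT / J : ℝ≥0) : ℝ) •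
        heatL ((j - i : ℕ) * (ΔT / J)) (F (fineSteps P γ ε β F ΔT J n ω (X ω) i))) ≤
      (ΔT : ℝ≥0∞) ^ α * (L * (1 + (fracMoment P 0 p X + L + B) * fineLip L)) := by
    refine (fracMoment_fineSteps_drift_le hc hp n hX j).trans ?_
    calc _ ≤ ((ΔT / J : ℝ≥0) : ℝ≥0∞) * ∑ i ∈ Finset.range j,
          L * (1 + (fracMoment P 0 p X + L + B) * fineLip L) := by
          gcongr with i hi
          refine (hF.fracMoment_comp_le hp (hV _)).trans ?_
          gcongr
          exact fracMoment_fineSteps_le hF hB hα hp hΔ₀ hΔ₁ hJ n hX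
            ((Finset.mem_range.1 hi).le.trans hj)
      _ = (((j : ℝ≥0) * (ΔT / J) : ℝ≥0) : ℝ≥0∞) *
          (L * (1 + (fracMoment P 0 p X + L + B) * fineLip L)) := by
          rw [Finset.sum_const, Finset.card_range, nsmul_eq_mul]
          push_cast
          ring
      _ ≤ _ := by
          gcongr
          exact (ENNReal.coe_le_coe.2 (step_mul_le ΔT hj)).trans (coe_le_rpow hΔ₁.le hα₁)
  rw [e]
  refine (fracMoment_add_le hp (hh.add hs) hz).trans ?_
  refine (add_le_add ((fracMoment_add_le hp hh hs).trans (add_le_add h1 h2))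
    (hB.fine_step ΔT hΔ₀ hΔ₁ J hJ n j hj)).trans (le_of_eq ?_)
  ring

end

end Parareal

namespace Parareal

noncomputable section

variable {Ω : Type*} [MeasurableSpace Ω] {P : Measure Ω} {γ : ℕ → ℝ} {ε : HilbertBasis ℕ ℝ H}
  {β : ℕ → ℝ≥0 → Ω → ℝ} {F : H → H} {α s T r θ : ℝ} {L M C : ℝ≥0} {p : ℕ}

/-! ### Convergence rates of families indexed by the step sizes -/

/-- The family `X` of random variables, indexed by the coarse step `ΔT`, the number `J` of fine
steps per coarse step, the coarse index `n` and the fine index `j`, is `O(ΔT^θ)` in the `p`-th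
moment of `|·|_r`, uniformly over `n ΔT ≤ T` and `j ≤ J`. -/
structure HasRate (P : Measure Ω) (T r : ℝ) (p : ℕ) (θ : ℝ) (X : ℝ≥0 → ℕ → ℕ → ℕ → Ω → H) :
    Prop where
  stronglyMeasurable : ∀ ΔT J n j, StronglyMeasurable (X ΔT J n j)
  bound : ∃ K ≠ ∞, ∀ ΔT : ℝ≥0, 0 < ΔT → ΔT < 1 → ∀ J : ℕ, J ≠ 0 → ∀ n : ℕ, (n : ℝ) * ΔT ≤ T →
    ∀ j ≤ J, fracMoment P r p (X ΔT J n j) ≤ K * (ΔT : ℝ≥0∞) ^ θ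

variable {X Y : ℝ≥0 → ℕ → ℕ → ℕ → Ω → H}

theorem HasRate.add (hp : p ≠ 0) (hX : HasRate P T r p θ X) (hY : HasRate P T r p θ Y) :
    HasRate P T r p θ (fun ΔT J n j ω => X ΔT J n j ω + Y ΔT J n j ω) := by
  obtain ⟨hXm, K, hK, hXb⟩ := hX
  obtain ⟨hYm, K', hK', hYb⟩ := hY
  refine ⟨fun ΔT J n j => (hXm ΔT J n j).add (hYm ΔT J n j), K + K',
    ENNReal.add_ne_top.2 ⟨hK, hK'⟩, fun ΔT hΔ₀ hΔ₁ J hJ n hn j hj => ?_⟩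
  rw [add_mul]
  exact (fracMoment_add_le hp (hXm _ _ _ _) (hYm _ _ _ _)).trans
    (add_le_add (hXb ΔT hΔ₀ hΔ₁ J hJ n hn j hj) (hYb ΔT hΔ₀ hΔ₁ J hJ n hn j hj))

theorem HasRate.sub (hp : p ≠ 0) (hX : HasRate P T r p θ X) (hY : HasRate P T r p θ Y) :
    HasRate P T r p θ (fun ΔT J n j ω => X ΔT J n j ω - Y ΔT J n j ω) := by
  obtain ⟨hXm, K, hK, hXb⟩ := hX
  obtain ⟨hYm, K', hK', hYb⟩ := hY
  refine ⟨fun ΔT J n j => (hXm ΔT J n j).sub (hYm ΔT J n j), K + K',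
    ENNReal.add_ne_top.2 ⟨hK, hK'⟩, fun ΔT hΔ₀ hΔ₁ J hJ n hn j hj => ?_⟩
  rw [add_mul]
  exact (fracMoment_sub_le hp (hXm _ _ _ _) (hYm _ _ _ _)).trans
    (add_le_add (hXb ΔT hΔ₀ hΔ₁ J hJ n hn j hj) (hYb ΔT hΔ₀ hΔ₁ J hJ n hn j hj))

/-- Transfers a rate through an estimate that gains `θ' - θ` powers of `ΔT`: the gain is `s` for
`e^{jδA} - 1` and `0` for composition with `F`. -/
theorem HasRate.of_le (hX : HasRate P T r p θ X) {r' θ' : ℝ}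
    (hY : ∀ ΔT J n j, StronglyMeasurable (Y ΔT J n j)) (K : ℝ≥0∞) (hK : K ≠ ∞)
    (h : ∀ ΔT : ℝ≥0, 0 < ΔT → ΔT < 1 → ∀ J : ℕ, J ≠ 0 → ∀ n : ℕ, ∀ j ≤ J,
      fracMoment P r' p (Y ΔT J n j) ≤
        K * (fracMoment P r p (X ΔT J n j) * (ΔT : ℝ≥0∞) ^ (θ' - θ))) :
    HasRate P T r' p θ' Y := by
  obtain ⟨hXm, K', hK', hXb⟩ := hX
  refine ⟨hY, K * K', ENNReal.mul_ne_top hK hK', fun ΔT hΔ₀ hΔ₁ J hJ n hn j hj => ?_⟩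
  have e : (ΔT : ℝ≥0∞) ^ θ' = (ΔT : ℝ≥0∞) ^ θ * (ΔT : ℝ≥0∞) ^ (θ' - θ) := by
    rw [← ENNReal.rpow_add _ _ (by exact_mod_cast hΔ₀.ne') ENNReal.coe_ne_top, add_sub_cancel]
  rw [e]
  calc _ ≤ K * (fracMoment P r p (X ΔT J n j) * (ΔT : ℝ≥0∞) ^ (θ' - θ)) :=
        h ΔT hΔ₀ hΔ₁ J hJ n j hj
    _ ≤ K * ((K' * (ΔT : ℝ≥0∞) ^ θ) * (ΔT : ℝ≥0∞) ^ (θ' - θ)) := by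
        gcongr
        exact hXb ΔT hΔ₀ hΔ₁ J hJ n hn j hj
    _ = _ := by ring

theorem HasRate.mono_rate (hX : HasRate P T r p θ X) {θ' : ℝ} (h : θ' ≤ θ) :
    HasRate P T r p θ' X := by
  obtain ⟨hXm, K, hK, hXb⟩ := hX
  refine ⟨hXm, K, hK, fun ΔT hΔ₀ hΔ₁ J hJ n hn j hj =>
    (hXb ΔT hΔ₀ hΔ₁ J hJ n hn j hj).trans ?_⟩
  have h1 : (ΔT : ℝ≥0∞) ≤ 1 := by exact_mod_cast hΔ₁.le
  have h2 := ENNReal.rpow_le_rpow_of_exponent_ge h1 h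
  gcongr

theorem HasRate.mono_left (hX : HasRate P T r p θ X) {r' : ℝ} (h : r' ≤ r) :
    HasRate P T r' p θ X := by
  obtain ⟨hXm, K, hK, hXb⟩ := hX
  exact ⟨hXm, K, hK, fun ΔT hΔ₀ hΔ₁ J hJ n hn j hj =>
    (fracMoment_mono_left h).trans (hXb ΔT hΔ₀ hΔ₁ J hJ n hn j hj)⟩

theorem hasRate_const [IsProbabilityMeasure P] (hp : p ≠ 0) {u : H} (hu : fracNorm r u ≠ ∞) :
    HasRate P T r p 0 fun _ _ _ _ _ => u :=
  ⟨fun _ _ _ _ => stronglyMeasurable_const, fracNorm r u, hu, fun ΔT _ _ J _ n _ j _ => by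
    rw [fracMoment_const hp, ENNReal.rpow_zero, mul_one]⟩

theorem HasRate.map_heatL (hX : HasRate P T r p θ X) :
    HasRate P T r p θ (fun ΔT J n j ω => heatL (j * (ΔT / J)) (X ΔT J n j ω)) := by
  obtain ⟨hXm, K, hK, hXb⟩ := hX
  exact ⟨fun ΔT J n j => stronglyMeasurable_heatL _ (hXm ΔT J n j), K, hK,
    fun ΔT hΔ₀ hΔ₁ J hJ n hn j hj =>
      (fracMoment_heatL_le _).trans (hXb ΔT hΔ₀ hΔ₁ J hJ n hn j hj)⟩

theorem HasRate.map_heatL_sub (hX : HasRate P T 0 p θ X) (hs₀ : 0 ≤ s) (hs₁ : s ≤ 1) :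
    HasRate P T (-s) p (θ + s)
      (fun ΔT J n j ω => heatL (j * (ΔT / J)) (X ΔT J n j ω) - X ΔT J n j ω) := by
  have hm := hX.stronglyMeasurable
  refine hX.of_le (fun ΔT J n j => (stronglyMeasurable_heatL _ (hm ΔT J n j)).sub (hm ΔT J n j)) 1
    ENNReal.one_ne_top fun ΔT hΔ₀ hΔ₁ J hJ n j hj => ?_
  rw [one_mul, add_sub_cancel_left, mul_comm (fracMoment _ _ _ _)]
  refine fracMoment_le_mul (ENNReal.rpow_ne_top_of_nonneg hs₀ ENNReal.coe_ne_top) fun ω => ?_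
  refine (fracNorm_heatL_sub_le hs₀ hs₁ _ _ _).trans ?_
  rw [neg_add_cancel]
  gcongr
  exact step_mul_le ΔT hj

theorem HasRate.comp [IsProbabilityMeasure P] (hp : p ≠ 0) (hF : DriftBounds F α s L M C)
    (hX : HasRate P T 0 p 0 X) : HasRate P T 0 p 0 (fun ΔT J n j ω => F (X ΔT J n j ω)) := by
  obtain ⟨hXm, K, hK, hXb⟩ := hX
  refine ⟨fun ΔT J n j => hF.continuous.comp_stronglyMeasurable (hXm ΔT J n j), L * (1 + K),
    by finiteness, fun ΔT hΔ₀ hΔ₁ J hJ n hn j hj => ?_⟩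
  rw [ENNReal.rpow_zero, mul_one]
  refine (hF.fracMoment_comp_le hp (hXm _ _ _ _)).trans ?_
  gcongr
  simpa using hXb ΔT hΔ₀ hΔ₁ J hJ n hn j hj

theorem HasRate.comp_sub_comp (hF : DriftBounds F α s L M C)
    (hX : ∀ ΔT J n j, StronglyMeasurable (X ΔT J n j))
    (hY : ∀ ΔT J n j, StronglyMeasurable (Y ΔT J n j))
    (h : HasRate P T 0 p θ (fun ΔT J n j ω => X ΔT J n j ω - Y ΔT J n j ω)) :
    HasRate P T 0 p θ (fun ΔT J n j ω => F (X ΔT J n j ω) - F (Y ΔT J n j ω)) := by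
  refine h.of_le (fun ΔT J n j => (hF.continuous.comp_stronglyMeasurable (hX ΔT J n j)).sub
    (hF.continuous.comp_stronglyMeasurable (hY ΔT J n j))) L ENNReal.coe_ne_top
      fun ΔT hΔ₀ hΔ₁ J hJ n j hj => ?_
  rw [sub_self, ENNReal.rpow_zero, mul_one]
  exact hF.fracMoment_comp_sub_le

theorem HasRate.map_fineSteps [IsProbabilityMeasure P] (hF : DriftBounds F α s L M C) (hα : 0 ≤ α)
    (hp : p ≠ 0) {B : ℝ≥0∞} (hBt : B ≠ ∞) (hB : NoiseBounds P γ ε β α T p B)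
    (hX : HasRate P T 0 p 0 X) :
    HasRate P T 0 p 0 (fun ΔT J n j ω => fineSteps P γ ε β F ΔT J n ω (X ΔT J n j ω) j) := by
  obtain ⟨hXm, K, hK, hXb⟩ := hX
  refine ⟨fun ΔT J n j => stronglyMeasurable_fineSteps hF.continuous n (hXm ΔT J n j) j,
    (K + L + B) * fineLip L, by unfold fineLip; finiteness, fun ΔT hΔ₀ hΔ₁ J hJ n hn j hj => ?_⟩
  rw [ENNReal.rpow_zero, mul_one]
  refine (fracMoment_fineSteps_le hF hB hα hp hΔ₀ hΔ₁ hJ n (hXm _ _ _ _) hj).trans ?_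
  gcongr
  simpa using hXb ΔT hΔ₀ hΔ₁ J hJ n hn j hj

theorem HasRate.map_fineSteps_sub [IsProbabilityMeasure P] (hF : DriftBounds F α s L M C)
    (hα : 0 ≤ α) (hα₁ : α ≤ 1) (hp : p ≠ 0) {B : ℝ≥0∞} (hBt : B ≠ ∞)
    (hB : NoiseBounds P γ ε β α T p B) (hX : HasRate P T α p 0 X) :
    HasRate P T 0 p α (fun ΔT J n j ω =>
      fineSteps P γ ε β F ΔT J n ω (X ΔT J n j ω) j - X ΔT J n j ω) := by
  obtain ⟨hXm, K, hK, hXb⟩ := hX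
  refine ⟨fun ΔT J n j => (stronglyMeasurable_fineSteps hF.continuous n (hXm ΔT J n j) j).sub
    (hXm ΔT J n j), K + L * (1 + (K + L + B) * fineLip L) + B, by unfold fineLip; finiteness,
    fun ΔT hΔ₀ hΔ₁ J hJ n hn j hj => ?_⟩
  refine (fracMoment_fineSteps_sub_le hF hB hα hα₁ hp hΔ₀ hΔ₁ hJ n (hXm _ _ _ _) hj).trans ?_
  have h1 : fracMoment P α p (X ΔT J n j) ≤ K := by
    simpa using hXb ΔT hΔ₀ hΔ₁ J hJ n hn j hj
  have h2 := (fracMoment_mono_left hα).trans h1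
  gcongr

theorem stronglyMeasurable_defect (hF : DriftBounds F α s L M C)
    (hX : ∀ ΔT J n j, StronglyMeasurable (X ΔT J n j))
    (hY : ∀ ΔT J n j, StronglyMeasurable (Y ΔT J n j)) (ΔT : ℝ≥0) (J n j : ℕ) :
    StronglyMeasurable fun ω => (F (fineSteps P γ ε β F ΔT J n ω (X ΔT J n j ω) j) -
      F (fineSteps P γ ε β F ΔT J n ω (Y ΔT J n j ω) j)) -
        heatL (j * (ΔT / J)) (F (X ΔT J n j ω) - F (Y ΔT J n j ω)) := by
  have hc := hF.continuous
  exact ((hc.comp_stronglyMeasurable (stronglyMeasurable_fineSteps hc n (hX ΔT J n j) j)).sub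
    (hc.comp_stronglyMeasurable (stronglyMeasurable_fineSteps hc n (hY ΔT J n j) j))).sub
    (stronglyMeasurable_heatL _ ((hc.comp_stronglyMeasurable (hX ΔT J n j)).sub
      (hc.comp_stronglyMeasurable (hY ΔT J n j))))

/-- The local defect of the parareal correction gains the factor `ΔT^s`. -/
theorem HasRate.defect [IsProbabilityMeasure P] (hF : DriftBounds F α s L M C)
    (hα : 0 ≤ α) (hα₁ : α ≤ 1) (hs₀ : 0 ≤ s) (hsα : s ≤ α) (hp : p ≠ 0) {B : ℝ≥0∞} (hBt : B ≠ ∞)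
    (hB : NoiseBounds P γ ε β α T (2 * p) B) (hX : HasRate P T α (2 * p) 0 X)
    (hY : HasRate P T α (2 * p) 0 Y)
    (h : HasRate P T 0 (2 * p) θ (fun ΔT J n j ω => X ΔT J n j ω - Y ΔT J n j ω)) :
    HasRate P T (-s) p (θ + s) (fun ΔT J n j ω =>
      (F (fineSteps P γ ε β F ΔT J n ω (X ΔT J n j ω) j) -
        F (fineSteps P γ ε β F ΔT J n ω (Y ΔT J n j ω) j)) -
          heatL (j * (ΔT / J)) (F (X ΔT J n j ω) - F (Y ΔT J n j ω))) := by
  have hpp : 2 * p ≠ 0 := by omega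
  have hXs := (hX.map_fineSteps_sub hF hα hα₁ hpp hBt hB).mono_rate hsα
  have hYs := (hY.map_fineSteps_sub hF hα hα₁ hpp hBt hB).mono_rate hsα
  obtain ⟨hXm, K₁, hK₁, hXb⟩ := hX
  obtain ⟨hYm, K₂, hK₂, hYb⟩ := hY
  obtain ⟨hXsm, K₃, hK₃, hXsb⟩ := hXs
  obtain ⟨hYsm, K₄, hK₄, hYsb⟩ := hYs
  obtain ⟨hm, K, hK, hb⟩ := h
  have hDt : (M * fineLip L + C * (1 + L * fineLip L) + L : ℝ≥0∞) ≠ ∞ := by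
    unfold fineLip; finiteness
  refine ⟨stronglyMeasurable_defect hF hXm hYm, (M * fineLip L + C * (1 + L * fineLip L) + L) *
      ((K₄ + K₃ + (1 + (K₁ + K₂))) * K), by finiteness, fun ΔT hΔ₀ hΔ₁ J hJ n hn j hj => ?_⟩
  have e : (ΔT : ℝ≥0∞) ^ (θ + s) = (ΔT : ℝ≥0∞) ^ θ * (ΔT : ℝ≥0∞) ^ s :=
    ENNReal.rpow_add _ _ (by exact_mod_cast hΔ₀.ne') ENNReal.coe_ne_top
  have hτ : (ΔT : ℝ≥0∞) ^ s ≠ ∞ := ENNReal.rpow_ne_top_of_nonneg hs₀ ENNReal.coe_ne_top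
  have hXα : fracMoment P α (2 * p) (X ΔT J n j) ≤ K₁ := by
    simpa using hXb ΔT hΔ₀ hΔ₁ J hJ n hn j hj
  have hYα : fracMoment P α (2 * p) (Y ΔT J n j) ≤ K₂ := by
    simpa using hYb ΔT hΔ₀ hΔ₁ J hJ n hn j hj
  have hX' := hXsb ΔT hΔ₀ hΔ₁ J hJ n hn j hj
  have hY' := hYsb ΔT hΔ₀ hΔ₁ J hJ n hn j hj
  have hD := hb ΔT hΔ₀ hΔ₁ J hJ n hn j hj
  simp only [fracMoment, fracNorm_zero_left] at hX' hY' hD hXα hYα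
  have mX := measurable_fracNorm_comp α (hXm ΔT J n j)
  have mY := measurable_fracNorm_comp α (hYm ΔT J n j)
  have mXs := (hXsm ΔT J n j).enorm
  have mYs := (hYsm ΔT J n j).enorm
  have mD := (hm ΔT J n j).enorm
  have mN : Measurable fun ω => (ΔT : ℝ≥0∞) ^ s *
      (1 + (fracNorm α (X ΔT J n j ω) + fracNorm α (Y ΔT J n j ω))) :=
    (measurable_const.add (mX.add mY)).const_mul _
  calc _ ≤ eLpNorm (fun ω => (M * fineLip L + C * (1 + L * fineLip L) + L) *
        ((‖fineSteps P γ ε β F ΔT J n ω (Y ΔT J n j ω) j - Y ΔT J n j ω‖ₑ +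
          ‖fineSteps P γ ε β F ΔT J n ω (X ΔT J n j ω) j - X ΔT J n j ω‖ₑ +
          (ΔT : ℝ≥0∞) ^ s * (1 + (fracNorm α (X ΔT J n j ω) + fracNorm α (Y ΔT J n j ω)))) *
            ‖X ΔT J n j ω - Y ΔT J n j ω‖ₑ)) p P :=
        eLpNorm_mono_enorm fun ω => hF.fracNorm_defect_le hs₀ (hsα.trans hα₁) hΔ₁.le n ω _ _ hj
    _ ≤ (M * fineLip L + C * (1 + L * fineLip L) + L) *
        ((K₄ * (ΔT : ℝ≥0∞) ^ s + K₃ * (ΔT : ℝ≥0∞) ^ s + (ΔT : ℝ≥0∞) ^ s * (1 + (K₁ + K₂))) *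
          (K * (ΔT : ℝ≥0∞) ^ θ)) := by
        refine (eLpNorm_const_mul_le hDt).trans ?_
        gcongr
        -- The random factor and the error `X - Y` are not independent. Cauchy–Schwarz separates
        -- them, and each is bounded by a `2p`-th moment.
        refine (eLpNorm_mul_le hp ((mYs.add mXs).add mN).aemeasurable mD.aemeasurable).trans ?_
        gcongr
        refine (eLpNorm_fun_add_le hpp (mYs.add mXs).aestronglyMeasurable
          mN.aestronglyMeasurable).trans ?_
        refine add_le_add ((eLpNorm_fun_add_le hpp mYs.aestronglyMeasurable
          mXs.aestronglyMeasurable).trans (add_le_add hY' hX')) ?_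
        refine (eLpNorm_const_mul_le hτ).trans ?_
        gcongr
        refine (eLpNorm_fun_add_le hpp aestronglyMeasurable_const
          (mX.add mY).aestronglyMeasurable).trans ?_
        refine add_le_add (eLpNorm_const_eq hpp _).le ?_
        exact (eLpNorm_fun_add_le hpp mX.aestronglyMeasurable mY.aestronglyMeasurable).trans
          (add_le_add hXα hYα)
    _ = _ := by
        rw [e]
        ring

/-! ### Rates for mild recursions -/

section mild

variable {U Z : ℝ≥0 → ℕ → ℕ → Ω → H} {g k : ℝ≥0 → ℕ → ℕ → ℕ → Ω → H}

theorem natCast_mul_mul_step_le {ΔT : ℝ≥0} {J n : ℕ} (hJ : J ≠ 0) (hn : (n : ℝ) * ΔT ≤ T) :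
    (n : ℝ) * (J * ((ΔT / J : ℝ≥0) : ℝ)) ≤ T := by
  rwa [natCast_mul_step hJ]

theorem step_pos {ΔT : ℝ≥0} {J : ℕ} (hΔ : 0 < ΔT) (hJ : J ≠ 0) : 0 < ΔT / J :=
  div_pos hΔ (by exact_mod_cast Nat.pos_of_ne_zero hJ)

theorem mul_le_of_lt {ΔT : ℝ≥0} {i n : ℕ} (h : i ≤ n) (hn : (n : ℝ) * ΔT ≤ T) :
    (i : ℝ) * ΔT ≤ T := by
  refine le_trans ?_ hn
  gcongr

/-- Gronwall's inequality for rates. -/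
theorem HasRate.of_isMild
    (hU : ∀ (ΔT : ℝ≥0) (J : ℕ), J ≠ 0 → ∀ ω, IsMild (ΔT / J) J (fun n => U ΔT J n ω)
      (fun n j => g ΔT J n j ω + k ΔT J n j ω) (fun n => Z ΔT J n ω))
    (hp : p ≠ 0) (hs₀ : 0 ≤ s) (hs₁ : s < 1)
    (hUm : ∀ ΔT J n, StronglyMeasurable (U ΔT J n))
    (hgm : ∀ ΔT J n j, StronglyMeasurable (g ΔT J n j)) {L : ℝ≥0} {A : ℝ≥0∞} (hA : A ≠ ∞)
    (hg : ∀ ΔT : ℝ≥0, 0 < ΔT → ΔT < 1 → ∀ J : ℕ, J ≠ 0 → ∀ n : ℕ, ∀ j ≤ J,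
      fracMoment P 0 p (g ΔT J n j) ≤ L * fracMoment P 0 p (U ΔT J n) + A * (ΔT : ℝ≥0∞) ^ θ)
    (hk : HasRate P T (-s) p θ k)
    (hU0 : HasRate P T 0 p θ (fun ΔT J _ _ => U ΔT J 0))
    (hZ : HasRate P T 0 p θ (fun ΔT J n _ => Z ΔT J n)) :
    HasRate P T 0 p θ (fun ΔT J n _ => U ΔT J n) := by
  obtain ⟨hkm, K, hK, hkb⟩ := hk
  obtain ⟨-, K₀, hK₀, hU0b⟩ := hU0
  obtain ⟨hZm, B, hB, hZb⟩ := hZ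
  refine ⟨fun ΔT J n _ => hUm ΔT J n,
    (K₀ + ENNReal.ofReal T * A + kernelConst T s * K + B) * ENNReal.ofReal (Real.exp (L * T)), ?_,
    fun ΔT hΔ₀ hΔ₁ J hJ n hn j hj => ?_⟩
  · have := kernelConst_ne_top T s
    finiteness
  refine (IsMild.fracMoment_zero_le (hU ΔT J hJ) hp (step_pos hΔ₀ hJ) hs₀ hs₁
    (natCast_mul_mul_step_le hJ hn) (hUm _ _ _) (hgm ΔT J) (hkm ΔT J) (fun n => hZm ΔT J n 0)
    (fun i _ j hj => hg ΔT hΔ₀ hΔ₁ J hJ i j hj.le)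
    (fun i hi j hj => hkb ΔT hΔ₀ hΔ₁ J hJ i (mul_le_of_lt hi.le hn) j hj.le)
    (fun i hi => hZb ΔT hΔ₀ hΔ₁ J hJ i (mul_le_of_lt hi hn) 0 (Nat.zero_le _)) n le_rfl).trans ?_
  have h0 := hU0b ΔT hΔ₀ hΔ₁ J hJ n hn 0 (Nat.zero_le _)
  calc _ ≤ (K₀ * (ΔT : ℝ≥0∞) ^ θ + ENNReal.ofReal T * (A * (ΔT : ℝ≥0∞) ^ θ) +
        kernelConst T s * (K * (ΔT : ℝ≥0∞) ^ θ) + B * (ΔT : ℝ≥0∞) ^ θ) *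
          ENNReal.ofReal (Real.exp (L * T)) := by gcongr
    _ = _ := by ring

/-- Smoothing for mild recursions. -/
theorem HasRate.of_isMild_smoothing
    (hU : ∀ (ΔT : ℝ≥0) (J : ℕ), J ≠ 0 → ∀ ω, IsMild (ΔT / J) J (fun n => U ΔT J n ω)
      (fun n j => g ΔT J n j ω) (fun n => Z ΔT J n ω))
    (hp : p ≠ 0) (hα₀ : 0 ≤ α) (hα₁ : α < 1)
    (hUm : ∀ ΔT J n, StronglyMeasurable (U ΔT J n))
    (hg : HasRate P T 0 p θ g)
    (hU0 : HasRate P T α p θ (fun ΔT J _ _ => U ΔT J 0))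
    (hZ : HasRate P T α p θ (fun ΔT J n _ => Z ΔT J n)) :
    HasRate P T α p θ (fun ΔT J n _ => U ΔT J n) := by
  obtain ⟨hgm, K, hK, hgb⟩ := hg
  obtain ⟨-, K₀, hK₀, hU0b⟩ := hU0
  obtain ⟨hZm, B, hB, hZb⟩ := hZ
  refine ⟨fun ΔT J n _ => hUm ΔT J n, K₀ + kernelConst T α * K + B, ?_,
    fun ΔT hΔ₀ hΔ₁ J hJ n hn j hj => ?_⟩
  · have := kernelConst_ne_top T α
    finiteness
  -- Taking `b = r = α` asks only for moments of the drift in `H`; the kernel `t^{-α}` is summable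
  -- because `α < 1`.
  refine (IsMild.fracMoment_le_of_le (r := α) (b := α) (hU ΔT J hJ) hp (step_pos hΔ₀ hJ) hα₀ hα₁
    (natCast_mul_mul_step_le hJ hn) (hUm _ _ _) (hgm ΔT J) (fun n => hZm ΔT J n 0)
    (A := K * (ΔT : ℝ≥0∞) ^ θ) (fun i hi j hj => ?_)).trans ?_
  · rw [sub_self]
    exact hgb ΔT hΔ₀ hΔ₁ J hJ i (mul_le_of_lt hi.le hn) j hj.le
  have h0 := hU0b ΔT hΔ₀ hΔ₁ J hJ n hn 0 (Nat.zero_le _)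
  have hz := hZb ΔT hΔ₀ hΔ₁ J hJ n hn 0 (Nat.zero_le _)
  calc _ ≤ K₀ * (ΔT : ℝ≥0∞) ^ θ + kernelConst T α * (K * (ΔT : ℝ≥0∞) ^ θ) +
        B * (ΔT : ℝ≥0∞) ^ θ := by gcongr
    _ = _ := by ring

end mild

end

end Parareal

namespace Parareal

noncomputable section

variable {Ω : Type*} [MeasurableSpace Ω] {P : Measure Ω} {γ : ℕ → ℝ} {ε : HilbertBasis ℕ ℝ H}
  {β : ℕ → ℝ≥0 → Ω → ℝ} {F : H → H} {α s T : ℝ} {L M C : ℝ≥0} {p : ℕ} {u₀ : H}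

/-! ### Moment bounds and convergence of the parareal iterates -/

theorem IsMild.congr {δ : ℝ≥0} {J : ℕ} {X : ℕ → H} {g g' : ℕ → ℕ → H} {Z Z' : ℕ → H}
    (h : IsMild δ J X g Z) (hg : ∀ n j, g n j = g' n j) (hZ : ∀ n, Z n = Z' n) :
    IsMild δ J X g' Z' := by
  obtain rfl : g = g' := funext fun n => funext fun j => hg n j
  obtain rfl : Z = Z' := funext hZ
  exact h

theorem NoiseBounds.hasRate_fine {B : ℝ≥0∞} (h : NoiseBounds P γ ε β α T p B) (hB : B ≠ ∞) :
    HasRate P T α p 0 (fun ΔT J n _ => stochConv P γ ε β (ΔT / J) 0 (n * J)) :=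
  ⟨fun _ _ _ _ => stronglyMeasurable_stochConv P γ ε β _ _ _, B, hB,
    fun ΔT hΔ₀ _ J hJ n hn _ _ => by simpa using h.fine ΔT hΔ₀ J hJ n hn⟩

theorem NoiseBounds.hasRate_coarse {B : ℝ≥0∞} (h : NoiseBounds P γ ε β α T p B) (hB : B ≠ ∞) :
    HasRate P T α p 0 (fun ΔT _ n _ => stochConv P γ ε β ΔT 0 n) :=
  ⟨fun _ _ _ _ => stronglyMeasurable_stochConv P γ ε β _ _ _, B, hB,
    fun ΔT hΔ₀ _ J hJ n hn _ _ => by simpa using h.coarse hΔ₀ hn⟩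

theorem NoiseBounds.hasRate_coarse_sub_fine {B : ℝ≥0∞} (h : NoiseBounds P γ ε β α T p B)
    (hB : B ≠ ∞) :
    HasRate P T 0 p α (fun ΔT J n _ ω => stochConv P γ ε β ΔT 0 n ω -
      stochConv P γ ε β (ΔT / J) 0 (n * J) ω) :=
  ⟨fun _ _ _ _ => (stronglyMeasurable_stochConv P γ ε β _ _ _).sub
    (stronglyMeasurable_stochConv P γ ε β _ _ _), B, hB,
    fun ΔT hΔ₀ _ J hJ n hn _ _ => h.coarse_sub_fine ΔT hΔ₀ J hJ n hn⟩

section rates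

variable [IsProbabilityMeasure P]

theorem hasRate_zero (hp : p ≠ 0) (r θ : ℝ) : HasRate P T r p θ fun _ _ _ _ _ => 0 :=
  ⟨fun _ _ _ _ => stronglyMeasurable_const, 0, ENNReal.zero_ne_top, fun ΔT _ _ J _ n _ j _ => by
    simp [fracMoment_const hp, fracNorm_zero_right]⟩

/-- A bootstrap: Gronwall first bounds the moments in `H`, hence those of the drift by linear
growth, and the smoothing of the semigroup then lifts the bound to `|·|_α`. -/
theorem hasRate_reference (hF : DriftBounds F α s L M C) (hα₀ : 0 ≤ α) (hα₁ : α < 1)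
    (hN : ∀ p : ℕ, p ≠ 0 → ∃ B ≠ ∞, NoiseBounds P γ ε β α T p B) (hu₀ : fracNorm α u₀ ≠ ∞)
    (hp : p ≠ 0) :
    HasRate P T α p 0 (fun ΔT J n _ ω => reference P γ ε β F u₀ ΔT J ω n) := by
  obtain ⟨B, hBt, hB⟩ := hN p hp
  have hc := hF.continuous
  have hm : ∀ (ΔT : ℝ≥0) (J n : ℕ), StronglyMeasurable fun ω => reference P γ ε β F u₀ ΔT J ω n :=
    fun ΔT J n => stronglyMeasurable_reference hc u₀ n
  have hu : HasRate P T α p 0 fun (_ : ℝ≥0) (_ _ _ : ℕ) (_ : Ω) => u₀ := hasRate_const hp hu₀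
  have h0 : HasRate P T 0 p 0 (fun ΔT J n _ ω => reference P γ ε β F u₀ ΔT J ω n) := by
    refine HasRate.of_isMild (s := 0) (k := fun _ _ _ _ _ => 0)
      (g := fun ΔT J n j ω => F (fineSteps P γ ε β F ΔT J n ω (reference P γ ε β F u₀ ΔT J ω n) j))
      (Z := fun ΔT J n ω => stochConv P γ ε β (ΔT / J) 0 (n * J) ω)
      -- The drift is `F` at a fine substep; expressed through the value at the coarse node, its
      -- growth constant acquires the factor `fineLip L`.
      (L := L * (Real.exp (L * 1)).toNNReal) (A := L * (1 + (L + B) * fineLip L))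
      (fun ΔT J hJ ω => ?_) hp le_rfl zero_lt_one hm (fun ΔT J n j => ?_) ?_
      (fun ΔT hΔ₀ hΔ₁ J hJ n j hj => ?_) (hasRate_zero hp _ _) (hu.mono_left hα₀)
      ((hB.hasRate_fine hBt).mono_left hα₀)
    · simpa only [add_zero] using isMild_reference P γ ε β F hJ u₀ ω
    · exact hc.comp_stronglyMeasurable (stronglyMeasurable_fineSteps hc n (hm _ _ _) j)
    · unfold fineLip; finiteness
    · have h1 := fracMoment_fineSteps_le hF hB hα₀ hp hΔ₀ hΔ₁ hJ n (hm ΔT J n) hj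
      refine (hF.fracMoment_comp_le hp
        (stronglyMeasurable_fineSteps hc n (hm _ _ _) j)).trans ?_
      rw [ENNReal.coe_mul]
      change _ ≤ L * fineLip L * _ + _
      rw [ENNReal.rpow_zero, mul_one]
      refine (mul_le_mul_right (add_le_add_right h1 1) _).trans (le_of_eq ?_)
      ring
  exact HasRate.of_isMild_smoothing (U := fun ΔT J n ω => reference P γ ε β F u₀ ΔT J ω n)
    (Z := fun ΔT J n ω => stochConv P γ ε β (ΔT / J) 0 (n * J) ω)
    (fun ΔT J hJ ω => isMild_reference P γ ε β F hJ u₀ ω) hp hα₀ hα₁ hm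
    ((h0.map_fineSteps hF hα₀ hp hBt hB).comp hp hF) hu (hB.hasRate_fine hBt)

/-- The same bootstrap, inside an induction on `k`: the previous iterate enters the recursion only
through a drift that is already bounded. The `|·|_α` moments are needed for the weight of the
derivative bound and for the time regularity of the fine steps. -/
theorem hasRate_parareal (hF : DriftBounds F α s L M C) (hα₀ : 0 ≤ α) (hα₁ : α < 1)
    (hN : ∀ p : ℕ, p ≠ 0 → ∃ B ≠ ∞, NoiseBounds P γ ε β α T p B) (hu₀ : fracNorm α u₀ ≠ ∞)
    (k : ℕ) (hp : p ≠ 0) :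
    HasRate P T α p 0 (fun ΔT J n _ ω => parareal P γ ε β F u₀ ΔT J ω k n) := by
  obtain ⟨B, hBt, hB⟩ := hN p hp
  have hc := hF.continuous
  have hm : ∀ (k : ℕ) (ΔT : ℝ≥0) (J n : ℕ),
      StronglyMeasurable fun ω => parareal P γ ε β F u₀ ΔT J ω k n :=
    fun k ΔT J n => stronglyMeasurable_parareal hc u₀ k n
  have hu : ∀ k, HasRate P T α p 0
      fun (ΔT : ℝ≥0) (J _ _ : ℕ) (ω : Ω) => parareal P γ ε β F u₀ ΔT J ω k 0 := fun k => by
    simp only [parareal_zero_right]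
    exact hasRate_const hp hu₀
  have hgm : ∀ k (ΔT : ℝ≥0) (J n j : ℕ), StronglyMeasurable fun ω =>
      heatL (j * (ΔT / J)) (F (parareal P γ ε β F u₀ ΔT J ω k n)) := fun k ΔT J n j =>
    stronglyMeasurable_heatL _ (hc.comp_stronglyMeasurable (hm k ΔT J n))
  have hgb : ∀ k (ΔT : ℝ≥0) (J n j : ℕ), fracMoment P 0 p (fun ω =>
      heatL (j * (ΔT / J)) (F (parareal P γ ε β F u₀ ΔT J ω k n))) ≤
      L * fracMoment P 0 p (fun ω => parareal P γ ε β F u₀ ΔT J ω k n) +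
        L * (ΔT : ℝ≥0∞) ^ (0 : ℝ) := fun k ΔT J n j => by
    refine (fracMoment_heatL_le _).trans ((hF.fracMoment_comp_le hp (hm _ _ _ _)).trans ?_)
    rw [ENNReal.rpow_zero, mul_add, add_comm]
  induction k with
  | zero =>
    have h0 : HasRate P T 0 p 0 (fun ΔT J n _ ω => parareal P γ ε β F u₀ ΔT J ω 0 n) :=
      HasRate.of_isMild (s := 0) (k := fun _ _ _ _ _ => 0)
        (g := fun ΔT J n j ω => heatL (j * (ΔT / J)) (F (parareal P γ ε β F u₀ ΔT J ω 0 n)))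
        (Z := fun ΔT _ n ω => stochConv P γ ε β ΔT 0 n ω)
        (fun ΔT J hJ ω => by
          simpa only [add_zero] using isMild_parareal_zero P γ ε β F hJ u₀ ω)
        hp le_rfl zero_lt_one (hm 0) (hgm 0) ENNReal.coe_ne_top
        (fun ΔT _ _ J _ n j _ => hgb 0 ΔT J n j) (hasRate_zero hp _ _) ((hu 0).mono_left hα₀)
        ((hB.hasRate_coarse hBt).mono_left hα₀)
    exact HasRate.of_isMild_smoothing (U := fun ΔT J n ω => parareal P γ ε β F u₀ ΔT J ω 0 n)
      (Z := fun ΔT _ n ω => stochConv P γ ε β ΔT 0 n ω)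
      (fun ΔT J hJ ω => isMild_parareal_zero P γ ε β F hJ u₀ ω) hp hα₀ hα₁ (hm 0)
      ((h0.comp hp hF).map_heatL) (hu 0) (hB.hasRate_coarse hBt)
  | succ k ih =>
    have ih0 := ih.mono_left hα₀
    have hk := HasRate.sub hp ((ih0.map_fineSteps hF hα₀ hp hBt hB).comp hp hF)
      (ih0.comp hp hF).map_heatL
    have hmild : ∀ (ΔT : ℝ≥0) (J : ℕ), J ≠ 0 → ∀ ω, IsMild (ΔT / J) J
        (fun n => parareal P γ ε β F u₀ ΔT J ω (k + 1) n)
        (fun n j => heatL (j * (ΔT / J)) (F (parareal P γ ε β F u₀ ΔT J ω (k + 1) n)) +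
          (F (fineSteps P γ ε β F ΔT J n ω (parareal P γ ε β F u₀ ΔT J ω k n) j) -
            heatL (j * (ΔT / J)) (F (parareal P γ ε β F u₀ ΔT J ω k n))))
        (fun n => stochConv P γ ε β (ΔT / J) 0 (n * J) ω) := fun ΔT J hJ ω => by
      simpa only [add_sub_assoc] using isMild_parareal_succ P γ ε β F hJ u₀ ω k
    have h0 : HasRate P T 0 p 0 (fun ΔT J n _ ω => parareal P γ ε β F u₀ ΔT J ω (k + 1) n) :=
      HasRate.of_isMild (s := 0)
        (g := fun ΔT J n j ω =>
          heatL (j * (ΔT / J)) (F (parareal P γ ε β F u₀ ΔT J ω (k + 1) n)))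
        (Z := fun ΔT J n ω => stochConv P γ ε β (ΔT / J) 0 (n * J) ω) hmild
        hp le_rfl zero_lt_one (hm (k + 1)) (hgm (k + 1)) ENNReal.coe_ne_top
        (fun ΔT _ _ J _ n j _ => hgb (k + 1) ΔT J n j) (by rw [neg_zero]; exact hk)
        ((hu (k + 1)).mono_left hα₀) ((hB.hasRate_fine hBt).mono_left hα₀)
    exact HasRate.of_isMild_smoothing
      (U := fun ΔT J n ω => parareal P γ ε β F u₀ ΔT J ω (k + 1) n)
      (Z := fun ΔT J n ω => stochConv P γ ε β (ΔT / J) 0 (n * J) ω)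
      hmild hp hα₀ hα₁ (hm (k + 1)) (HasRate.add hp (h0.comp hp hF).map_heatL hk)
      (hu (k + 1)) (hB.hasRate_fine hBt)

/-- The heart of the convergence proof: the defect turns the order `(k+1)s` of one error into
`(k+2)s` for the next, and Gronwall preserves it. -/
theorem hasRate_pararealError (hF : DriftBounds F α s L M C) (hα₀ : 0 ≤ α) (hα₁ : α < 1)
    (hN : ∀ p : ℕ, p ≠ 0 → ∃ B ≠ ∞, NoiseBounds P γ ε β α T p B) (hu₀ : fracNorm α u₀ ≠ ∞)
    (hs₀ : 0 ≤ s) (hsα : s ≤ α) (k : ℕ) (hp : p ≠ 0) :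
    HasRate P T 0 p ((k + 1) * s) (fun ΔT J n _ => pararealError P γ ε β F u₀ ΔT J k n) := by
  have hc := hF.continuous
  have hrm : ∀ (ΔT : ℝ≥0) (J n : ℕ), StronglyMeasurable fun ω => reference P γ ε β F u₀ ΔT J ω n :=
    fun ΔT J n => stronglyMeasurable_reference hc u₀ n
  have hm : ∀ (k : ℕ) (ΔT : ℝ≥0) (J n : ℕ),
      StronglyMeasurable fun ω => parareal P γ ε β F u₀ ΔT J ω k n :=
    fun k ΔT J n => stronglyMeasurable_parareal hc u₀ k n
  have hem : ∀ (k : ℕ) (ΔT : ℝ≥0) (J n : ℕ),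
      StronglyMeasurable (pararealError P γ ε β F u₀ ΔT J k n) :=
    fun k ΔT J n => (hm k ΔT J n).sub (hrm ΔT J n)
  have hgm : ∀ k (ΔT : ℝ≥0) (J n j : ℕ), StronglyMeasurable fun ω =>
      heatL (j * (ΔT / J)) (F (parareal P γ ε β F u₀ ΔT J ω k n) -
        F (reference P γ ε β F u₀ ΔT J ω n)) := fun k ΔT J n j =>
    stronglyMeasurable_heatL _ ((hc.comp_stronglyMeasurable (hm k ΔT J n)).sub
      (hc.comp_stronglyMeasurable (hrm ΔT J n)))
  have hgb : ∀ (p k : ℕ) (θ : ℝ) (ΔT : ℝ≥0) (J n j : ℕ), fracMoment P 0 p (fun ω =>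
      heatL (j * (ΔT / J)) (F (parareal P γ ε β F u₀ ΔT J ω k n) -
        F (reference P γ ε β F u₀ ΔT J ω n))) ≤
      L * fracMoment P 0 p (pararealError P γ ε β F u₀ ΔT J k n) + 0 * (ΔT : ℝ≥0∞) ^ θ :=
    fun p k θ ΔT J n j => by
      rw [zero_mul, add_zero]
      exact (fracMoment_heatL_le _).trans hF.fracMoment_comp_sub_le
  have hu : ∀ (p k : ℕ) (θ : ℝ), p ≠ 0 → HasRate P T 0 p θ
      fun (ΔT : ℝ≥0) (J _ _ : ℕ) => pararealError P γ ε β F u₀ ΔT J k 0 := fun p k θ hp => by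
    have : ∀ (ΔT : ℝ≥0) (J : ℕ), pararealError P γ ε β F u₀ ΔT J k 0 = fun _ => 0 :=
      fun ΔT J => funext fun ω => by rw [pararealError, parareal_zero_right, reference, sub_self]
    simp only [this]
    exact hasRate_zero hp _ _
  have hs₁ : s < 1 := hsα.trans_lt hα₁
  induction k generalizing p with
  | zero =>
    obtain ⟨B, hBt, hB⟩ := hN p hp
    have hr := hasRate_reference hF hα₀ hα₁ hN hu₀ hp
    -- Beyond its Lipschitz part, the drift difference `e^{jδA} F(u^{(0)}) - F(v_j(u^ref))` consists
    -- of `(e^{jδA} - 1) F(u^ref)`, of order `s` in `|·|_{-s}`, minus `F(v_j(u^ref)) - F(u^ref)`, of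
    -- order `α` in `H`.
    have h1 := ((hr.mono_left hα₀).comp hp hF).map_heatL_sub hs₀ hs₁.le
    rw [zero_add] at h1
    have h2 := HasRate.comp_sub_comp hF
      (fun ΔT J n j => stronglyMeasurable_fineSteps hc n (hrm ΔT J n) j)
      (fun ΔT J n _ => hrm ΔT J n) (hr.map_fineSteps_sub hF hα₀ hα₁.le hp hBt hB)
    have h3 := HasRate.sub hp h1 ((h2.mono_rate hsα).mono_left (neg_nonpos.2 hs₀))
    have e : ((0 : ℕ) + 1 : ℝ) * s = s := by norm_num
    rw [e]
    refine HasRate.of_isMild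
      (g := fun ΔT J n j ω => heatL (j * (ΔT / J)) (F (parareal P γ ε β F u₀ ΔT J ω 0 n) -
        F (reference P γ ε β F u₀ ΔT J ω n)))
      (Z := fun ΔT J n ω => stochConv P γ ε β ΔT 0 n ω -
        stochConv P γ ε β (ΔT / J) 0 (n * J) ω) (fun ΔT J hJ ω => ?_) hp hs₀ hs₁ (hem 0) (hgm 0)
      ENNReal.zero_ne_top (fun ΔT _ _ J _ n j _ => hgb p 0 s ΔT J n j) h3 (hu p 0 s hp)
      ((hB.hasRate_coarse_sub_fine hBt).mono_rate hsα)
    refine ((isMild_parareal_zero P γ ε β F hJ u₀ ω).sub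
      (isMild_reference P γ ε β F hJ u₀ ω)).congr (fun n j => ?_) fun n => rfl
    rw [map_sub]
    abel
  | succ k ih =>
    -- The induction hypothesis is invoked at the exponent `2p`, as the defect estimate requires.
    have hpp : 2 * p ≠ 0 := by omega
    obtain ⟨B, hBt, hB⟩ := hN (2 * p) hpp
    have hk := HasRate.defect hF hα₀ hα₁.le hs₀ hsα hp hBt hB
      (hasRate_parareal hF hα₀ hα₁ hN hu₀ k hpp) (hasRate_reference hF hα₀ hα₁ hN hu₀ hpp) (ih hpp)
    have e : ((k + 1 : ℕ) + 1 : ℝ) * s = (k + 1) * s + s := by push_cast; ring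
    rw [e]
    refine HasRate.of_isMild
      (g := fun ΔT J n j ω => heatL (j * (ΔT / J)) (F (parareal P γ ε β F u₀ ΔT J ω (k + 1) n) -
        F (reference P γ ε β F u₀ ΔT J ω n)))
      -- Iterate and reference accumulate the same fine noise, so no noise term limits the rate.
      (Z := fun _ _ _ _ => 0) (fun ΔT J hJ ω => ?_) hp hs₀ hs₁ (hem (k + 1)) (hgm (k + 1))
      ENNReal.zero_ne_top (fun ΔT _ _ J _ n j _ => hgb p (k + 1) _ ΔT J n j) hk
      (hu p (k + 1) _ hp) (hasRate_zero hp _ _)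
    refine ((isMild_parareal_succ P γ ε β F hJ u₀ ω k).sub
      (isMild_reference P γ ε β F hJ u₀ ω)).congr (fun n j => ?_) fun n => sub_self _
    simp only [map_sub]
    abel

end rates

/-! ### Choice of the noise exponent and conclusion -/

theorem exists_regularity {a : ℝ} (h : (a : EReal) < min (alphaBar γ ε) ((1 / 2 : ℝ) : EReal)) :
    ∃ b : ℝ, a < b ∧ b ≤ 1 / 2 ∧ hsNormSq (b - 1 / 2) γ ε < ∞ := by
  obtain ⟨h1, h2⟩ := lt_min_iff.1 h
  obtain ⟨_, ⟨b, ⟨-, hb⟩, rfl⟩, hab⟩ := lt_sSup_iff.1 h1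
  -- The cap at `1/2` keeps the exponent `1 - 2η` of the singular kernel nonnegative in the
  -- convolution bound; lowering the exponent preserves the finite Hilbert–Schmidt norm.
  refine ⟨min b (1 / 2), lt_min (EReal.coe_lt_coe_iff.1 hab) (EReal.coe_lt_coe_iff.1 h2),
    min_le_right _ _, (hsNormSq_mono ?_ γ ε).trans_lt hb⟩
  gcongr
  exact min_le_left _ _

end

end Parareal

theorem mainTheorem2 {Ω : Type*} [MeasurableSpace Ω] (P : Measure Ω) [IsProbabilityMeasure P]
    (γ : ℕ → ℝ) (hγ : ∀ p, 0 ≤ γ p) (ε : HilbertBasis ℕ ℝ Parareal.H)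
    (β : ℕ → ℝ≥0 → Ω → ℝ) (hβ : Parareal.IsIndepWiener P β)
    (hQ : Parareal.AssumptionQ γ ε)
    (F : Parareal.H → Parareal.H) (hF : Parareal.AssumptionF F)
    (T : ℝ) (hT : 0 < T) (k q : ℕ) (hq : 1 ≤ q)
    (α : ℝ) (hα₀ : 0 ≤ α) (hα : (α : EReal) < min (Parareal.alphaBar γ ε) ((1 / 2 : ℝ) : EReal))
    (κ : ℝ) (hκ : 0 < κ)
    (u₀ : Parareal.H) (hu₀ : u₀ ∈ Parareal.fracDomain α) :
    ∃ C : ℝ, 0 < C ∧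
      ∀ ΔT : ℝ≥0, 0 < ΔT → ΔT < 1 →
      ∀ J : ℕ, 1 ≤ J →
      ∀ n : ℕ, (n : ℝ) * ΔT ≤ T →
        MemLp (Parareal.pararealError P γ ε β F u₀ ΔT J k n) q P ∧
        eLpNorm (Parareal.pararealError P γ ε β F u₀ ΔT J k n) q P ≤
          ENNReal.ofReal (C * (ΔT : ℝ) ^ (((k : ℝ) + 1) * (α - κ))) := by
  obtain ⟨a, hαa, ha₁, hQa⟩ := Parareal.exists_regularity hα
  obtain ⟨L, M, C, hFb⟩ := hF.exists_driftBounds (hαa.trans_le ha₁) hκ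
  obtain ⟨hm, K, hK, hb⟩ := Parareal.hasRate_pararealError (P := P) (γ := γ) (ε := ε) (β := β)
    (T := T) hFb hα₀ (by linarith)
    (fun p hp => Parareal.exists_noiseBounds hβ hγ ha₁ hQa hα₀ hαa T hp) (u₀ := u₀) hu₀.ne
    (le_max_right _ _) (max_le (by linarith) hα₀) k (p := q) (by omega)
  refine ⟨K.toReal + 1, by positivity, fun ΔT hΔ₀ hΔ₁ J hJ n hn => ?_⟩
  have hle : eLpNorm (Parareal.pararealError P γ ε β F u₀ ΔT J k n) q P ≤
      ENNReal.ofReal ((K.toReal + 1) * (ΔT : ℝ) ^ (((k : ℝ) + 1) * (α - κ))) := by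
    have h := hb ΔT hΔ₀ hΔ₁ J (by omega) n hn 0 (Nat.zero_le _)
    rw [Parareal.fracMoment_zero_left] at h
    refine h.trans ?_
    have hΔ₁' : (ΔT : ℝ≥0∞) ≤ 1 := by exact_mod_cast hΔ₁.le
    rw [ENNReal.ofReal_mul (by positivity), ← ENNReal.ofReal_rpow_of_pos (by exact_mod_cast hΔ₀),
      ENNReal.ofReal_coe_nnreal]
    -- The rate obtained is `(k+1) max(α - κ, 0)`, and `ΔT < 1` makes the power with the larger
    -- exponent the smaller one.
    refine mul_le_mul' ?_ (ENNReal.rpow_le_rpow_of_exponent_ge hΔ₁' ?_)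
    · calc K = ENNReal.ofReal K.toReal := (ENNReal.ofReal_toReal hK).symm
        _ ≤ _ := ENNReal.ofReal_le_ofReal (by linarith)
    · gcongr
      exact le_max_left _ _
  exact ⟨⟨(hm ΔT J n 0).aestronglyMeasurable, hle.trans_lt ENNReal.ofReal_lt_top⟩, hle⟩
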